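/- Let $K$ be a field of characteristic $0$. Let $V_d$ be the $SL_2(K)$-module of binary forms of degree $d$ over $K$, write $kV_d$ for the direct sum of $k$ copies of $V_d$, and let $K[V]^{SL_2}$ be the algebra of $SL_2(K)$-invariant polynomial functions on $V$, graded by polynomial degree. Let $V$ be one of $$V_1\oplus V_3,\; V_1\oplus V_4,\; V_2\oplus V_3,\; V_2\oplus V_4,\; V_4\oplus V_4,\; 2V_1\oplus V_2,\; V_1\oplus 2V_2,\; 3V_2,\; 4V_1,$$ and let $e=12,\,18,\,14,\,12,\,12,\,6,\,8,\,6,\,4$ respectively. Then $\mathcal I=K[V]^{SL_2}$ has a finite minimal system of homogeneous generators, and for every such system $f_1,\dots,f_m$ the following holds. Let $R=K[x_1,\dots,x_m]$ be graded by $\deg x_i=\deg f_i$ and regard $\mathcal I$ as an $R$-module through the homomorphism $R\to\mathcal I$, $x_i\mapsto f_i$. Then $\mathcal I$ is a hypersurface, that is, the kernel of $R\to\mathcal I$ is generated by one nonzero homogeneous element of degree $e$; there is a minimal graded free resolution $$0\longrightarrow R(-e)\longrightarrow R\longrightarrow\mathcal I\longrightarrow 0$$ over $R$ in which the map $R\to\mathcal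 I$ is $x_i\mapsto f_i$ and the maps are homogeneous of degree $0$, where $R(-e)_k=R_{k-e}$ and minimality means that the image of $R(-e)$ lies in the ideal $(x_1,\dots,x_m)$; and the homological (projective) dimension of $\mathcal I$ over $R$ is $1$. -/

import Mathlib

open MvPolynomial

noncomputable section

namespace SL2Invariants

universe u

/-- The group `SL₂(K)`. -/
abbrev SL2 (K : Type u) [Field K] : Type u := Matrix.SpecialLinearGroup (Fin 2) K

/-- Linear substitution in two variables: `x i ↦ ∑ j, A i j * x j`, that is, `F(v) ↦ F(A v)`. -/
def subst {K : Type u} [Field K] (A : Matrix (Fin 2) (Fin 2) K) :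
    MvPolynomial (Fin 2) K →ₐ[K] MvPolynomial (Fin 2) K :=
  aeval fun i => ∑ j, C (A i j) * X j

theorem subst_one {K : Type u} [Field K] :
    subst (1 : Matrix (Fin 2) (Fin 2) K) = AlgHom.id K _ := by
  ext1 i
  fin_cases i <;> simp [subst, Fin.sum_univ_two]

theorem subst_mul {K : Type u} [Field K] (A B : Matrix (Fin 2) (Fin 2) K) :
    subst (A * B) = (subst B).comp (subst A) := by
  ext1 i
  simp only [subst, AlgHom.comp_apply, aeval_X, map_mul, Matrix.mul_apply,
    Fin.sum_univ_two, map_add]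
  simp only [algHom_C, algebraMap_eq]
  ring

theorem subst_isHomogeneous {K : Type u} [Field K] (A : Matrix (Fin 2) (Fin 2) K) {d : ℕ}
    {F : MvPolynomial (Fin 2) K} (hF : F.IsHomogeneous d) : (subst A F).IsHomogeneous d := by
  have h := hF.aeval (g := fun i => ∑ j, C (A i j) * X j) (n := 1) fun i =>
    IsHomogeneous.sum _ _ _ fun j _ => by
      simpa using (isHomogeneous_C (Fin 2) (A i j)).mul (isHomogeneous_X K j)
  simpa [subst] using h

/-- The representation of `SL₂(K)` on `K[x, y]`: `(g • F)(v) = F(g⁻¹ v)`. -/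
def polyRep (K : Type u) [Field K] : Representation K (SL2 K) (MvPolynomial (Fin 2) K) where
  toFun g := (subst (g⁻¹ : SL2 K).1).toLinearMap
  map_one' := by
    rw [inv_one, Matrix.SpecialLinearGroup.coe_one, subst_one]
    rfl
  map_mul' g h := by
    rw [mul_inv_rev, Matrix.SpecialLinearGroup.coe_mul, subst_mul]
    rfl

/-- `V_d`: the space of binary forms of degree `d`. -/
abbrev BinaryForm (K : Type u) [Field K] (d : ℕ) : Type u :=
  homogeneousSubmodule (Fin 2) K d

/-- `V_d` as an `SL₂(K)`-module. -/
def formRep (K : Type u) [Field K] (d : ℕ) : Representation K (SL2 K) (BinaryForm K d) :=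
  (polyRep K).subrepresentation (homogeneousSubmodule (Fin 2) K d) fun g F hF =>
    subst_isHomogeneous (g⁻¹ : SL2 K).1 (F := F) hF

/-- `V_{d 0} ⊕ V_{d 1} ⊕ ⋯`: tuples of binary forms of degrees `d 0, d 1, …`. -/
abbrev FormSpace (K : Type u) [Field K] {n : ℕ} (d : Fin n → ℕ) : Type u :=
  (i : Fin n) → BinaryForm K (d i)

/-- The (diagonal) action of `SL₂(K)` on a direct sum of spaces of binary forms. -/
def act {K : Type u} [Field K] {n : ℕ} {d : Fin n → ℕ} (g : SL2 K) (v : FormSpace K d) :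
    FormSpace K d :=
  fun i => formRep K (d i) g (v i)

/-- Index set of the linear coordinates on `V_{d 0} ⊕ V_{d 1} ⊕ ⋯`. -/
abbrev CoordIdx {n : ℕ} (d : Fin n → ℕ) : Type := (i : Fin n) × Fin (d i + 1)

/-- The linear coordinates: coordinate `(i, j)` of `v` is the coefficient of `x ^ (d i - j) * y ^ j`
in the `i`-th form. -/
def coords {K : Type u} [Field K] {n : ℕ} {d : Fin n → ℕ} (v : FormSpace K d) :
    CoordIdx d → K :=
  fun c => coeff (Finsupp.single 0 (d c.1 - (c.2 : ℕ)) + Finsupp.single 1 (c.2 : ℕ))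
    (v c.1 : MvPolynomial (Fin 2) K)

/-- `K[V]`: polynomial functions on `V = V_{d 0} ⊕ V_{d 1} ⊕ ⋯`, as polynomials in the linear
coordinates. -/
abbrev CoordRing (K : Type u) [Field K] {n : ℕ} (d : Fin n → ℕ) : Type u :=
  MvPolynomial (CoordIdx d) K

/-- The value of a polynomial function at a point of `V`. -/
def value {K : Type u} [Field K] {n : ℕ} {d : Fin n → ℕ} (v : FormSpace K d) :
    CoordRing K d →ₐ[K] K :=
  aeval (coords v)

/-- The algebra `K[V]^{SL₂}` of invariant polynomial functions. -/
def invariants (K : Type u) [Field K] {n : ℕ} (d : Fin n → ℕ) : Subalgebra K (CoordRing K d) where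
  carrier := {p | ∀ (g : SL2 K) (v : FormSpace K d), value (act g v) p = value v p}
  mul_mem' hp hq g v := by rw [map_mul, map_mul, hp g v, hq g v]
  add_mem' hp hq g v := by rw [map_add, map_add, hp g v, hq g v]
  algebraMap_mem' r g v := by rw [AlgHom.commutes, AlgHom.commutes]

/-- `f` is a finite minimal system of homogeneous generators of the algebra of invariants. -/
structure IsMinimalGeneratingSystem {K : Type u} [Field K] {n : ℕ} {d : Fin n → ℕ} {m : ℕ}
    (f : Fin m → invariants K d) : Prop where
  homogeneous : ∀ i, (f i : CoordRing K d).IsHomogeneous (f i : CoordRing K d).totalDegree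
  generates : Algebra.adjoin K (Set.range f) = ⊤
  minimal : ∀ i, Algebra.adjoin K (f '' {i}ᶜ) ≠ ⊤

/-- `deg f_i`, the degree given to the variable `x_i` of `R = K[x_1, …, x_m]`. -/
def genDeg {K : Type u} [Field K] {n : ℕ} {d : Fin n → ℕ} {m : ℕ}
    (f : Fin m → invariants K d) (i : Fin m) : ℕ :=
  (f i : CoordRing K d).totalDegree

/-- The homogeneous component `R_k` of `R = K[x_1, …, x_m]`, where `deg x_i = deg f_i`. -/
def gradedPart {K : Type u} [Field K] {n : ℕ} {d : Fin n → ℕ} {m : ℕ}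
    (f : Fin m → invariants K d) (k : ℕ) : Submodule K (MvPolynomial (Fin m) K) :=
  weightedHomogeneousSubmodule K (genDeg f) k

/-- The homomorphism `R = K[x_1, …, x_m] → K[V]^{SL₂}`, `x_i ↦ f_i`. -/
def presentation {K : Type u} [Field K] {n : ℕ} {d : Fin n → ℕ} {m : ℕ}
    (f : Fin m → invariants K d) : MvPolynomial (Fin m) K →ₐ[K] invariants K d :=
  aeval f

/-- The algebra of invariants as an `R`-module, through `x_i ↦ f_i`. -/
def invariantsModule {K : Type u} [Field K] {n : ℕ} {d : Fin n → ℕ} {m : ℕ}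
    (f : Fin m → invariants K d) : ModuleCat.{u} (MvPolynomial (Fin m) K) :=
  (ModuleCat.restrictScalars (presentation f).toRingHom).obj
    (ModuleCat.of (invariants K d) (invariants K d))

/-- `0 → R(-e) → R → K[V]^{SL₂} → 0`, with maps `δ` and `x_i ↦ f_i`, is a minimal graded free
resolution. Since `R(-e)` is `R` with `R(-e)_{k + e} = R_k`, the map `δ` is homogeneous of
degree zero on `R(-e)` when it sends `R_k` to `R_{k + e}`. -/
structure IsMinimalGradedResolution {K : Type u} [Field K] {n : ℕ} {d : Fin n → ℕ} {m : ℕ}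
    (f : Fin m → invariants K d) (e : ℕ)
    (δ : MvPolynomial (Fin m) K →ₗ[MvPolynomial (Fin m) K] MvPolynomial (Fin m) K) : Prop where
  injective : Function.Injective δ
  exact : Function.Exact δ (presentation f)
  surjective : Function.Surjective (presentation f)
  graded_left : ∀ k, ∀ p ∈ gradedPart f k, δ p ∈ gradedPart f (k + e)
  graded_right : ∀ k, ∀ p ∈ gradedPart f k,
    (presentation f p : CoordRing K d).IsHomogeneous k
  minimal : ∀ p, δ p ∈ Ideal.span (Set.range (X : Fin m → MvPolynomial (Fin m) K))

/-- `K[V]^{SL₂}`, for `V = V_{d 0} ⊕ V_{d 1} ⊕ ⋯`, is a hypersurface with a relation of degree `e`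
and minimal graded free resolution `0 → R(-e) → R → K[V]^{SL₂} → 0`: finite minimal homogeneous
systems of generators exist, and for each of them (with `m` members, `R = K[x_1, …, x_m]`) the
ideal of relations is generated by one nonzero form of degree `e`, there is a minimal
resolution of the given shape, and the projective dimension over `R` is one. -/
def IsHypersurfaceOfDegree (K : Type u) [Field K] {n : ℕ} (d : Fin n → ℕ) (e : ℕ) : Prop :=
  (∃ (m : ℕ) (f : Fin m → invariants K d), IsMinimalGeneratingSystem f) ∧
  ∀ (m : ℕ) (f : Fin m → invariants K d), IsMinimalGeneratingSystem f →
    (∃ F ∈ gradedPart f e, F ≠ 0 ∧ RingHom.ker (presentation f) = Ideal.span {F}) ∧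
    (∃ δ, IsMinimalGradedResolution f e δ) ∧
    CategoryTheory.projectiveDimension (invariantsModule f) = 1

end SL2Invariants

end

noncomputable section

namespace SL2Invariants

universe u

/-! ### Graded homomorphisms of polynomial rings -/

section Graded

variable {R : Type*} [CommRing R] {σ τ : Type*}

/-! For each `V`, classical covariant formulas give a system of invariants `Φ = (z, u₀, …, uₖ)` in
which `z` satisfies a monic equation over `K[u]`: `z² = G(u)` in eight cases, a cubic for two
quartics. It has to be shown that `Φ` generates all invariants, that this equation generates all
relations, and that the conclusion passes to every minimal system of generators. Values are tested
at points over an algebraically closed extension `L` of `K`.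

Generation is proved by localization. A general point over `L` can be moved into a slice of normal
forms. If a linear form is present, it becomes `y` and a shear removes one more coefficient; the
remaining coordinates are polynomials in `Φ` divided by powers of `u₀`. If a quadratic form is
present instead, it becomes `t x y`; invariance under the torus leaves only monomials of weight
zero, and the flip `t ↦ -t` removes odd powers of `t`. Either way `u₀ ^ N * p` lies in `K[Φ]` for
every invariant `p`.

The denominators disappear because an element `P₁(u) z + P₀(u)` that is divisible by `u₀` as a
polynomial function has both coefficients divisible by `u₀`: on `u₀ = 0` enough points `(u, z)` and
`(u, -z)` are attained to force `P₁ = P₀ = 0` there. The same divisibility, iterated, excludes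
relations of degree below two in `z`. This is `exists_of_descent`, `eq_zero_of_descent` and
`isHypersurfaceOfDegree_of_quadratic`.

For two quartics the slice is `a x⁴ + c x² y² + a y⁴` with an arbitrary second form. The stabilizer
acts by sign changes, and averaging over `a ↦ -a` and over the three roots `c` of a resolvent cubic
leaves a power of the discriminant of the first form as denominator. Exchanging the forms gives a
power of the discriminant of the second form. These discriminants are coprime in the invariants, so
no denominator is needed.

Finally, `isHypersurfaceOfDegree_of_presentation` compares two minimal systems. Lifting each through
the other gives graded maps of polynomial rings whose composites are the identity modulo relations.
Relations of a minimal system have no constant or linear terms, so the composites are bijective and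
the single relation is transported. -/

theorem coeff_aeval_C_mul_X (χ : σ → R) (p : MvPolynomial σ R) (m : σ →₀ ℕ) :
    coeff m (aeval (fun i => C (χ i) * X i) p) = (m.prod fun i k => χ i ^ k) * coeff m p := by
  induction p using MvPolynomial.induction_on' with
  | add p q hp hq => rw [map_add, coeff_add, coeff_add, hp, hq, mul_add]
  | monomial n c =>
    have : aeval (fun i => C (χ i) * X i) (monomial n c) =
        monomial n (c * n.prod fun i k => χ i ^ k) := by
      rw [aeval_monomial, algebraMap_eq]
      simp only [mul_pow]
      rw [Finsupp.prod_mul, monomial_eq (s := n) (a := c * _), C_mul, mul_assoc]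
      congr 2
      simp [Finsupp.prod, map_prod]
    rw [this]
    classical
    rw [coeff_monomial, coeff_monomial]
    split_ifs with h
    · rw [h, mul_comm]
    · simp

/-- A polynomial which is an eigenvector for a diagonal substitution is supported on monomials with
the same eigenvalue. -/
theorem prod_pow_eq_of_mem_support {K L : Type*} [Field K] [Infinite K] [Field L] [Algebra K L]
    (χ : σ → K) (b : K) (p : MvPolynomial σ K)
    (h : ∀ x : σ → L, aeval (fun i => algebraMap K L (χ i) * x i) p =
      algebraMap K L b * aeval x p) {m : σ →₀ ℕ} (hm : m ∈ p.support) :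
    (m.prod fun i k => χ i ^ k) = b := by
  -- Points over `K` are among the points over `L`, and `K` is infinite, so the pointwise
  -- eigenvector equation is an identity of polynomials.
  have key : aeval (fun i => C (χ i) * X i) p = C b * p := by
    refine MvPolynomial.funext fun x => (algebraMap K L).injective ?_
    have := h fun i => algebraMap K L (x i)
    simp only [← map_mul] at this
    have e : ∀ y : σ → K, algebraMap K L (eval y p) = aeval (fun i => algebraMap K L (y i)) p :=
      fun y => by
        rw [← aeval_eq_eval, ← aeval_algebraMap_apply]; rfl
    rw [← e, ← e] at this
    rw [← map_mul] at this
    convert this using 2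
    · rw [← aeval_eq_eval, ← AlgHom.comp_apply, comp_aeval]
      simp [aeval_eq_eval]
    · simp
  have := congrArg (coeff m) key
  rw [coeff_aeval_C_mul_X, coeff_C_mul] at this
  exact mul_right_cancel₀ (mem_support_iff.mp hm) this

/-- A single scalar suffices: powers of `2` are distinct in characteristic zero, so the eigenvalue
`2 ^ k` determines the weight of each monomial. -/
theorem isWeightedHomogeneous_of_scaling {K L : Type*} [Field K] [CharZero K] [Field L]
    [Algebra K L] (w : σ → ℕ) (k : ℕ) (p : MvPolynomial σ K)
    (h : ∀ x : σ → L, aeval (fun i => (2 : L) ^ w i * x i) p = 2 ^ k * aeval x p) :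
    IsWeightedHomogeneous w p k := by
  intro m hm
  have := prod_pow_eq_of_mem_support (L := L) (fun i => (2 : K) ^ w i) (2 ^ k) p
    (fun x => by simpa [map_ofNat] using h x) (mem_support_iff.mpr hm)
  have e : (m.prod fun i k => ((2 : K) ^ w i) ^ k) = 2 ^ (Finsupp.weight w m) := by
    rw [Finsupp.weight_apply, Finsupp.sum, Finsupp.prod, ← Finset.prod_pow_eq_pow_sum]
    exact Finset.prod_congr rfl fun i _ => by rw [← pow_mul, smul_eq_mul, mul_comm]
  rw [e] at this
  exact Nat.pow_right_injective le_rfl (by exact_mod_cast this)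

theorem isHomogeneous_of_scaling {K L : Type*} [Field K] [CharZero K] [Field L]
    [Algebra K L] (k : ℕ) (p : MvPolynomial σ K)
    (h : ∀ x : σ → L, aeval (fun i => (2 : L) * x i) p = 2 ^ k * aeval x p) :
    p.IsHomogeneous k :=
  isWeightedHomogeneous_of_scaling (L := L) 1 k p (by simpa using h)

theorem isWeightedHomogeneous_aeval {w : σ → ℕ} {v : τ → ℕ} {g : σ → MvPolynomial τ R}
    (hg : ∀ i, IsWeightedHomogeneous v (g i) (w i)) {k : ℕ} {p : MvPolynomial σ R}
    (hp : IsWeightedHomogeneous w p k) : IsWeightedHomogeneous v (aeval g p) k := by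
  rw [aeval_def, eval₂_eq]
  refine IsWeightedHomogeneous.sum _ _ _ fun m hm => ?_
  have h1 : IsWeightedHomogeneous v (∏ i ∈ m.support, g i ^ m i) k := by
    have := IsWeightedHomogeneous.prod m.support (fun i => g i ^ m i) (fun i => m i • w i)
      fun i _ => (hg i).pow (m i)
    rwa [show ∑ i ∈ m.support, m i • w i = k from by
      rw [← hp (mem_support_iff.mp hm), Finsupp.weight_apply, Finsupp.sum]] at this
  exact h1.C_mul _

theorem weightedHomogeneousComponent_aeval {w : σ → ℕ} {v : τ → ℕ} {g : σ → MvPolynomial τ R}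
    (hg : ∀ i, IsWeightedHomogeneous v (g i) (w i)) (k : ℕ) (p : MvPolynomial σ R) :
    weightedHomogeneousComponent v k (aeval g p) =
      aeval g (weightedHomogeneousComponent w k p) := by
  have hfin := weightedHomogeneousComponent_finsupp (w := w) p
  conv_lhs => rw [← sum_weightedHomogeneousComponent w p, finsum_eq_sum _ hfin, map_sum, map_sum]
  have hc := fun j => isWeightedHomogeneous_aeval hg
    (weightedHomogeneousComponent_isWeightedHomogeneous (w := w) j p)
  by_cases hk : k ∈ hfin.toFinset
  · rw [Finset.sum_eq_single k (fun j _ hj => (hc j).weightedHomogeneousComponent_ne k hj.symm)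
      (fun h => absurd hk h)]
    exact (hc k).weightedHomogeneousComponent_same
  · rw [Finset.sum_eq_zero fun j hj => (hc j).weightedHomogeneousComponent_ne k
      (fun h => hk (by rwa [h]))]
    have hk' : weightedHomogeneousComponent w k p = 0 := by
      by_contra hne
      exact hk ((Set.Finite.mem_toFinset hfin).mpr hne)
    rw [hk', map_zero]

/-- The kernels of the iterates of `θ` form a stationary chain. If `θ ^ n y` is killed by the next
step, then `y` already lies in the kernel of `θ ^ n`. -/
theorem injective_of_surjective_of_isNoetherianRing {S : Type*} [CommRing S] [IsNoetherianRing S]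
    (θ : S →+* S) (h : Function.Surjective θ) : Function.Injective θ := by
  have hmono : Monotone fun n : ℕ => RingHom.ker (θ ^ n) := by
    refine monotone_nat_of_le_succ fun n x hx => ?_
    rw [RingHom.mem_ker] at hx ⊢
    rw [pow_succ', RingHom.mul_def, RingHom.comp_apply, hx, map_zero]
  obtain ⟨n, hn⟩ := monotone_stabilizes_iff_noetherian.mpr ‹_› ⟨_, hmono⟩
  have hsurj : Function.Surjective (θ ^ n) := by
    rw [RingHom.coe_pow]
    exact h.iterate n
  rw [injective_iff_map_eq_zero]
  intro x hx
  obtain ⟨y, rfl⟩ := hsurj x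
  have h1 : y ∈ RingHom.ker (θ ^ (n + 1)) := by
    rw [RingHom.mem_ker, pow_succ', RingHom.mul_def, RingHom.comp_apply, hx]
  rw [← show RingHom.ker (θ ^ n) = RingHom.ker (θ ^ (n + 1)) from hn (n + 1) n.le_succ] at h1
  exact h1

/-- A graded endomorphism of a polynomial ring which is the identity modulo the square of the
ideal of the variables is surjective. -/
theorem surjective_aeval_of_sub_mem {w : σ → ℕ} (hw : ∀ i, 0 < w i) {g : σ → MvPolynomial σ R}
    (hg : ∀ i, IsWeightedHomogeneous w (g i) (w i))
    (h : ∀ i, X i - g i ∈ idealOfVars σ R ^ 2) :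
    Function.Surjective (aeval g : MvPolynomial σ R →ₐ[R] MvPolynomial σ R) := by
  classical
  -- Induction on the weight of the variable: a monomial of that weight and of degree at least two
  -- involves only variables of strictly smaller weight, since all weights are positive.
  have key : ∀ n i, w i = n → X i ∈ (aeval g : MvPolynomial σ R →ₐ[R] MvPolynomial σ R).range := by
    intro n
    induction n using Nat.strong_induction_on with
    | _ n ih =>
    intro i hi
    have h1 : X i - g i ∈ (aeval g : MvPolynomial σ R →ₐ[R] MvPolynomial σ R).range := by
      rw [as_sum (X i - g i)]
      refine sum_mem fun m hm => ?_
      have hdeg := (mem_pow_idealOfVars_iff 2 _).mp (h i) m hm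
      have hwt : Finsupp.weight w m = w i :=
        ((isWeightedHomogeneous_X R w i).sub (hg i)) (mem_support_iff.mp hm)
      rw [monomial_eq]
      refine mul_mem (Subalgebra.algebraMap_mem _ _) (prod_mem fun j hj => pow_mem (ih (w j) ?_ j rfl) _)
      have hj0 : m j ≠ 0 := Finsupp.mem_support_iff.mp hj
      rw [← hi, ← hwt, Finsupp.weight_apply, Finsupp.sum, ← Finset.add_sum_erase _ _ hj]
      simp only [smul_eq_mul]
      -- Either the variable occurs at least twice, or a second variable occurs; both make its
      -- weight smaller than the total.
      rcases Nat.lt_or_ge 1 (m j) with h2 | h2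
      · have := hw j
        nlinarith [Nat.zero_le (∑ x ∈ m.support.erase j, m x * w x)]
      · have hj1 : m j = 1 := by omega
        have : (m.support.erase j).Nonempty := by
          by_contra hne
          rw [Finset.not_nonempty_iff_eq_empty] at hne
          have : m.degree = m j := by
            rw [Finsupp.degree_apply, ← Finset.add_sum_erase _ _ hj, hne, Finset.sum_empty, add_zero]
          omega
        have : 0 < ∑ x ∈ m.support.erase j, m x * w x := by
          refine Finset.sum_pos (fun x hx => Nat.mul_pos (Nat.pos_of_ne_zero ?_) (hw x)) this
          exact Finsupp.mem_support_iff.mp (Finset.mem_of_mem_erase hx)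
        rw [hj1]; omega
    have h2 : g i ∈ (aeval g : MvPolynomial σ R →ₐ[R] MvPolynomial σ R).range :=
      ⟨X i, by simp⟩
    simpa using add_mem h1 h2
  rw [← AlgHom.range_eq_top, eq_top_iff, ← adjoin_range_X, Algebra.adjoin_le_iff]
  rintro _ ⟨i, rfl⟩
  exact key _ i rfl

end Graded

/-! ### Hypersurfaces from one presentation -/

section Criterion

variable {K : Type u} [Field K] {n : ℕ} {d : Fin n → ℕ} {m m' : ℕ}

theorem eq_single_of_degree_eq_one {σ : Type*} {a : σ →₀ ℕ} (ha : a.degree = 1) :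
    ∃ i, a = Finsupp.single i 1 := by
  have hne : a ≠ 0 := by
    rintro rfl
    simp at ha
  obtain ⟨i, hi⟩ := Finsupp.ne_iff.mp hne
  have hle : Finsupp.single i 1 ≤ a := by
    rw [Finsupp.single_le_iff]
    exact Nat.pos_of_ne_zero hi
  obtain ⟨b, rfl⟩ := exists_add_of_le hle
  rw [map_add, Finsupp.degree_single] at ha
  exact ⟨i, by rw [(Finsupp.degree_eq_zero_iff b).mp (by omega), add_zero]⟩

theorem presentation_isHomogeneous {f : Fin m → invariants K d} {w : Fin m → ℕ}
    (hf : ∀ i, (f i : CoordRing K d).IsHomogeneous (w i)) {k : ℕ} {p : MvPolynomial (Fin m) K}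
    (hp : IsWeightedHomogeneous w p k) : (presentation f p : CoordRing K d).IsHomogeneous k := by
  have : (presentation f p : CoordRing K d) =
      aeval (fun i => (f i : CoordRing K d)) p := by
    rw [← Subalgebra.coe_val, ← AlgHom.comp_apply, presentation, comp_aeval]
  rw [this]
  exact isWeightedHomogeneous_aeval (v := 1) hf hp

theorem presentation_weightedHomogeneousComponent {f : Fin m → invariants K d} {w : Fin m → ℕ}
    (hf : ∀ i, (f i : CoordRing K d).IsHomogeneous (w i)) (k : ℕ) (p : MvPolynomial (Fin m) K) :
    (presentation f (weightedHomogeneousComponent w k p) : CoordRing K d) =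
      homogeneousComponent k (presentation f p : CoordRing K d) := by
  have (q : MvPolynomial (Fin m) K) : (presentation f q : CoordRing K d) =
      aeval (fun i => (f i : CoordRing K d)) q := by
    rw [← Subalgebra.coe_val, ← AlgHom.comp_apply, presentation, comp_aeval]
  rw [this, this]
  exact (weightedHomogeneousComponent_aeval (v := 1) hf k p).symm

theorem weightedHomogeneousComponent_mem_ker {f : Fin m → invariants K d} {w : Fin m → ℕ}
    (hf : ∀ i, (f i : CoordRing K d).IsHomogeneous (w i)) (k : ℕ) {p : MvPolynomial (Fin m) K}
    (hp : p ∈ RingHom.ker (presentation f)) :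
    weightedHomogeneousComponent w k p ∈ RingHom.ker (presentation f) := by
  rw [RingHom.mem_ker] at hp ⊢
  ext1
  rw [presentation_weightedHomogeneousComponent hf, hp]
  simp

theorem range_presentation (f : Fin m → invariants K d) :
    (presentation f).range = Algebra.adjoin K (Set.range f) :=
  (Algebra.adjoin_range_eq_range_aeval K f).symm

theorem IsMinimalGeneratingSystem.surjective {f : Fin m → invariants K d}
    (h : IsMinimalGeneratingSystem f) : Function.Surjective (presentation f) := by
  rw [← AlgHom.range_eq_top, range_presentation, h.generates]

theorem adjoin_image_compl_eq_top {f : Fin m → invariants K d}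
    (h : Algebra.adjoin K (Set.range f) = ⊤) {i : Fin m}
    (hi : f i ∈ Algebra.adjoin K (f '' {i}ᶜ)) : Algebra.adjoin K (f '' {i}ᶜ) = ⊤ := by
  rw [eq_top_iff, ← h, Algebra.adjoin_le_iff]
  rintro _ ⟨j, rfl⟩
  by_cases hj : j = i
  · exact hj ▸ hi
  · exact Algebra.subset_adjoin ⟨j, hj, rfl⟩

theorem IsMinimalGeneratingSystem.genDeg_pos {f : Fin m → invariants K d}
    (h : IsMinimalGeneratingSystem f) (i : Fin m) : 0 < genDeg f i := by
  rw [Nat.pos_iff_ne_zero]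
  intro h0
  refine h.minimal i (adjoin_image_compl_eq_top h.generates ?_)
  have h1 := (totalDegree_eq_zero_iff_eq_C (p := (f i : CoordRing K d))).mp h0
  have h2 : f i = algebraMap K _ (coeff 0 (f i : CoordRing K d)) := Subtype.ext h1
  rw [h2]
  exact Subalgebra.algebraMap_mem _ _

/-- The homogeneous component of a relation at the weight of an offending monomial is again a
relation. A constant term would make that component a nonzero constant. With a linear term in `X i`,
positivity of the weights keeps `X i` out of the other monomials, so `f i` would be a polynomial in
the other generators. -/
theorem IsMinimalGeneratingSystem.ker_le {f : Fin m → invariants K d}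
    (h : IsMinimalGeneratingSystem f) :
    RingHom.ker (presentation f) ≤ idealOfVars (Fin m) K ^ 2 := by
  classical
  have : Finsupp.NonTorsionWeight ℕ (genDeg f) :=
    Finsupp.nonTorsionWeight_of (w := genDeg f) ℕ (fun i => (h.genDeg_pos i).ne')
  intro P hP
  rw [mem_pow_idealOfVars_iff]
  intro a ha
  by_contra hlt
  set k := Finsupp.weight (genDeg f) a with hk
  set Q := weightedHomogeneousComponent (genDeg f) k P with hQ
  have hQk : Q ∈ RingHom.ker (presentation f) :=
    weightedHomogeneousComponent_mem_ker h.homogeneous k hP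
  have hQh : IsWeightedHomogeneous (genDeg f) Q k :=
    weightedHomogeneousComponent_isWeightedHomogeneous _ _
  have hQa : coeff a Q ≠ 0 := by
    rw [hQ, coeff_weightedHomogeneousComponent, if_pos rfl]
    exact mem_support_iff.mp ha
  have hcases : a = 0 ∨ ∃ i, a = Finsupp.single i 1 := by
    rcases Nat.lt_or_ge a.degree 1 with h1 | h1
    · exact Or.inl ((Finsupp.degree_eq_zero_iff a).mp (by omega))
    · exact Or.inr (eq_single_of_degree_eq_one (by omega))
  rcases hcases with rfl | ⟨i, rfl⟩
  · have hC : Q = C (coeff 0 Q) := by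
      ext b
      rw [coeff_C]
      split_ifs with hb
      · rw [hb]
      · by_contra hne
        have h2 := hQh hne
        rw [hk, map_zero, Finsupp.weight_eq_zero_iff_eq_zero (genDeg f)] at h2
        exact hb h2.symm
    rw [hC, RingHom.mem_ker, presentation, aeval_C] at hQk
    exact hQa ((algebraMap K (invariants K d)).injective (by rw [hQk, map_zero]))
  · refine h.minimal i (adjoin_image_compl_eq_top h.generates ?_)
    set c := coeff (Finsupp.single i 1) Q
    have hsupp : C c * X i - Q ∈ supported K ({i}ᶜ : Set (Fin m)) := by
      rw [mem_supported]
      intro j hj hji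
      rw [Set.mem_singleton_iff] at hji
      subst hji
      rw [Finset.mem_coe, mem_vars_iff_mem_support] at hj
      obtain ⟨b, hb, hjb⟩ := hj
      rw [mem_support_iff, coeff_sub, coeff_C_mul, coeff_X] at hb
      by_cases hbj : Finsupp.single j 1 = b
      · subst hbj
        simp [c] at hb
      · rw [if_neg hbj, mul_zero, zero_sub, neg_ne_zero] at hb
        have h2 := hQh hb
        have hj0 : b j ≠ 0 := Finsupp.mem_support_iff.mp hjb
        have hle : Finsupp.single j 1 ≤ b := by
          rw [Finsupp.single_le_iff]; omega
        obtain ⟨b', rfl⟩ := exists_add_of_le hle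
        rw [map_add, hk] at h2
        have h3 : Finsupp.weight (genDeg f) b' = 0 := by omega
        rw [Finsupp.weight_eq_zero_iff_eq_zero (genDeg f)] at h3
        exact hbj (by rw [h3, add_zero])
    have hmem : presentation f (C c * X i - Q) ∈ Algebra.adjoin K (f '' {i}ᶜ) := by
      rw [supported_eq_adjoin_X] at hsupp
      have := Subalgebra.mem_map (f := presentation f).mpr ⟨_, hsupp, rfl⟩
      rwa [AlgHom.map_adjoin, Set.image_image, show (fun x => presentation f (X x)) = f from
        funext fun j => by simp [presentation]] at this
    have hval : presentation f (C c * X i - Q) = c • f i := by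
      rw [map_sub, (RingHom.mem_ker).mp hQk, sub_zero, map_mul]
      simp [presentation, Algebra.smul_def]
    rw [hval] at hmem
    have := Subalgebra.smul_mem _ hmem c⁻¹
    rwa [smul_smul, inv_mul_cancel₀ hQa, one_smul] at this

theorem exists_lift {f : Fin m → invariants K d} {w : Fin m → ℕ}
    (hf : ∀ i, (f i : CoordRing K d).IsHomogeneous (w i))
    (hsurj : Function.Surjective (presentation f)) {k : ℕ} {y : invariants K d}
    (hy : (y : CoordRing K d).IsHomogeneous k) :
    ∃ p, IsWeightedHomogeneous w p k ∧ presentation f p = y := by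
  obtain ⟨p, hp⟩ := hsurj y
  refine ⟨weightedHomogeneousComponent w k p,
    weightedHomogeneousComponent_isWeightedHomogeneous _ _, Subtype.ext ?_⟩
  rw [presentation_weightedHomogeneousComponent hf, hp]
  exact homogeneousComponent_of_mem hy |>.trans (if_pos rfl)

/-- If `f i` were a polynomial `q` in the other members, `X i - q` would be a relation with a linear
term. -/
theorem isMinimalGeneratingSystem_of_ker_le {f : Fin m → invariants K d} {w : Fin m → ℕ}
    (hf : ∀ i, (f i : CoordRing K d).IsHomogeneous (w i))
    (hsurj : Function.Surjective (presentation f))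
    (hker : RingHom.ker (presentation f) ≤ idealOfVars (Fin m) K ^ 2) :
    IsMinimalGeneratingSystem f where
  homogeneous i := by
    have h0 : (f i : CoordRing K d) ≠ 0 := by
      intro h0
      have : X i ∈ RingHom.ker (presentation f) := by
        rw [RingHom.mem_ker, presentation, aeval_X]
        exact Subtype.ext h0
      have := (mem_pow_idealOfVars_iff 2 _).mp (hker this) (Finsupp.single i 1) (by simp)
      simp at this
    rw [(hf i).totalDegree h0]
    exact hf i
  generates := by rw [← range_presentation, AlgHom.range_eq_top]; exact hsurj
  minimal i htop := by
    have h1 : f i ∈ Algebra.adjoin K (f '' {i}ᶜ) := htop ▸ Algebra.mem_top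
    have h2 : (supported K ({i}ᶜ : Set (Fin m))).map (presentation f) =
        Algebra.adjoin K (f '' {i}ᶜ) := by
      rw [supported_eq_adjoin_X, AlgHom.map_adjoin, Set.image_image,
        show (fun x => presentation f (X x)) = f from funext fun j => by simp [presentation]]
    rw [← h2] at h1
    obtain ⟨q, hq, hqi⟩ := Subalgebra.mem_map.mp h1
    have h3 : X i - q ∈ RingHom.ker (presentation f) := by
      rw [RingHom.mem_ker, map_sub]
      change presentation f (X i) - (presentation f q) = 0
      rw [show presentation f q = f i from hqi]
      simp [presentation]
    have h4 : Finsupp.single i 1 ∈ (X i - q).support := by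
      rw [mem_support_iff, coeff_sub, coeff_X]
      have : coeff (Finsupp.single i 1) q = 0 := by
        by_contra hne
        have : i ∈ q.vars := (mem_vars_iff_mem_support i).mpr ⟨_, mem_support_iff.mpr hne, by simp⟩
        exact mem_supported.mp hq this rfl
      rw [this]; simp
    have := (mem_pow_idealOfVars_iff 2 _).mp (hker h3) _ h4
    simp at this

-- Multiplication by `F` gives a free resolution of length one. If the module were projective, a
-- section of the quotient map would send the class of `1` to an element killed by `F`, hence to
-- zero.
open CategoryTheory in
theorem projectiveDimension_invariantsModule {f : Fin m → invariants K d}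
    (hsurj : Function.Surjective (presentation f)) {F : MvPolynomial (Fin m) K} (hF : F ≠ 0)
    (hker : RingHom.ker (presentation f) = Ideal.span {F}) :
    projectiveDimension (invariantsModule f) = 1 := by
  let R := MvPolynomial (Fin m) K
  let π : R →ₗ[R] invariantsModule f :=
    { toFun := fun p => (presentation f p : invariants K d)
      map_add' := fun p q => map_add (presentation f) p q
      map_smul' := fun p q => map_mul (presentation f) p q }
  have hπ : Function.Surjective π := hsurj
  have hker' : ∀ p, π p = 0 ↔ F ∣ p := fun p => by
    rw [← Ideal.mem_span_singleton, ← hker, RingHom.mem_ker]; rfl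
  let S : ShortComplex (ModuleCat.{u} R) := ShortComplex.mk
    (ModuleCat.ofHom (LinearMap.mulLeft R F)) (ModuleCat.ofHom π) (by
      ext
      exact (hker' _).mpr (dvd_mul_right F _))
  have hS : S.ShortExact :=
    { exact := by
        rw [ShortComplex.moduleCat_exact_iff]
        intro x hx
        obtain ⟨y, hy⟩ := (hker' x).mp hx
        exact ⟨y, hy.symm⟩
      mono_f := by
        rw [ModuleCat.mono_iff_injective]
        exact mul_right_injective₀ hF
      epi_g := by
        rw [ModuleCat.epi_iff_surjective]
        exact hπ }
  have hP : Projective (ModuleCat.of R R) := (IsProjective.iff_projective (R := R) R).mp inferInstance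
  have hP1 : Projective S.X₁ := hP
  have hP2 : Projective S.X₂ := hP
  have h2 : HasProjectiveDimensionLT (invariantsModule f) 2 :=
    hS.hasProjectiveDimensionLT_X₃ 1 inferInstance inferInstance
  have h1 : ¬ HasProjectiveDimensionLT (invariantsModule f) 1 := by
    intro h
    have hproj : Projective (invariantsModule f) :=
      projective_iff_hasProjectiveDimensionLT_one.mpr h
    have hproj' : Module.Projective R (invariantsModule f) :=
      (IsProjective.iff_projective (R := R) (invariantsModule f)).mpr hproj
    obtain ⟨s, hs⟩ := Module.projective_lifting_property π LinearMap.id hπ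
    have h3 : F * s (π 1) = 0 := by
      rw [← smul_eq_mul, ← map_smul, ← map_smul, (hker' _).mpr, map_zero]
      simp
    have h4 : π 1 = 0 := by
      have := LinearMap.congr_fun hs (π 1)
      rw [LinearMap.comp_apply, (mul_eq_zero.mp h3).resolve_left hF, map_zero] at this
      exact this.symm
    have h5 : (1 : invariants K d) = 0 := by
      rw [← map_one (presentation f)]; exact h4
    exact one_ne_zero h5
  refine le_antisymm ((projectiveDimension_le_iff _ 1).mpr h2) ?_
  exact (projectiveDimension_ge_iff _ 1).mpr h1

/-- If one homogeneous system of invariants presents the algebra of invariants with a single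
relation, of degree bigger than the degrees of the members, then the algebra is a hypersurface. -/
theorem isHypersurfaceOfDegree_of_presentation (f : Fin m → invariants K d) (w : Fin m → ℕ)
    (hf : ∀ i, (f i : CoordRing K d).IsHomogeneous (w i))
    (hsurj : Function.Surjective (presentation f)) (F : MvPolynomial (Fin m) K) {e : ℕ}
    (hker : RingHom.ker (presentation f) = Ideal.span {F}) (hF0 : F ≠ 0)
    (hFe : IsWeightedHomogeneous w F e) (he : 0 < e) (hwe : ∀ i, w i < e) :
    IsHypersurfaceOfDegree K d e := by
  -- A constant has weight `0 < e` and a variable has weight `w i < e`, so neither can occur in `F`.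
  have hF2 : F ∈ idealOfVars (Fin m) K ^ 2 := by
    rw [mem_pow_idealOfVars_iff]
    intro a ha
    by_contra hlt
    have h1 := hFe (mem_support_iff.mp ha)
    rcases Nat.lt_or_ge a.degree 1 with h2 | h2
    · have h3 : a = 0 := (Finsupp.degree_eq_zero_iff a).mp (Nat.lt_one_iff.mp h2)
      rw [h3, map_zero] at h1
      omega
    · obtain ⟨i, rfl⟩ := eq_single_of_degree_eq_one (a := a) (by omega)
      have := hwe i
      simp [Finsupp.weight_single] at h1
      omega
  have hmin : IsMinimalGeneratingSystem f := by
    refine isMinimalGeneratingSystem_of_ker_le hf hsurj ?_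
    rw [hker, Ideal.span_le, Set.singleton_subset_iff]
    exact hF2
  have hw : genDeg f = w := by
    funext i
    refine (hf i).totalDegree fun h0 => ?_
    have : genDeg f i = 0 := by rw [genDeg, h0, totalDegree_zero]
    exact (hmin.genDeg_pos i).ne' this
  refine ⟨⟨m, f, hmin⟩, fun m' f' hf' => ?_⟩
  have hsurj' := hf'.surjective
  -- Each system is expressed homogeneously through the other; `φ` and `ψ` are the resulting maps
  -- over the algebra of invariants.
  choose g hg hgf using fun i => exists_lift hf hsurj (hf'.homogeneous i)
  choose g' hg' hgf' using fun i => exists_lift hf'.homogeneous hsurj' (hf i)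
  set φ : MvPolynomial (Fin m') K →ₐ[K] MvPolynomial (Fin m) K := aeval g with hφ
  set ψ : MvPolynomial (Fin m) K →ₐ[K] MvPolynomial (Fin m') K := aeval g' with hψ
  have hφf : ∀ p, presentation f (φ p) = presentation f' p := by
    intro p
    rw [← AlgHom.comp_apply]
    congr 1
    ext1 i
    rw [AlgHom.comp_apply, hφ, aeval_X, hgf, presentation, aeval_X]
  have hψf : ∀ p, presentation f' (ψ p) = presentation f p := by
    intro p
    rw [← AlgHom.comp_apply]
    congr 1
    ext1 i
    rw [AlgHom.comp_apply, hψ, aeval_X, hgf', presentation, aeval_X]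
  -- The composite fixes each variable modulo a relation, and relations lie in the square of the
  -- ideal of variables. Hence it is surjective, and then injective by the Noetherian argument.
  have hφψ : Function.Bijective (φ.comp ψ) := by
    have h1 : φ.comp ψ = aeval fun i => φ (g' i) := by rw [hψ, comp_aeval]
    have h2 : Function.Surjective (φ.comp ψ) := by
      rw [h1]
      refine surjective_aeval_of_sub_mem (w := w) (fun i => hw ▸ hmin.genDeg_pos i)
        (fun i => isWeightedHomogeneous_aeval hg (hg' i)) fun i => hmin.ker_le ?_
      rw [RingHom.mem_ker, map_sub, hφf, hgf']
      simp [presentation]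
    exact ⟨injective_of_surjective_of_isNoetherianRing (φ.comp ψ).toRingHom h2, h2⟩
  have hψφ : Function.Bijective (ψ.comp φ) := by
    have h1 : ψ.comp φ = aeval fun i => ψ (g i) := by rw [hφ, comp_aeval]
    have h2 : Function.Surjective (ψ.comp φ) := by
      rw [h1]
      refine surjective_aeval_of_sub_mem (w := genDeg f') hf'.genDeg_pos
        (fun i => isWeightedHomogeneous_aeval hg' (hg i)) fun i => hf'.ker_le ?_
      rw [RingHom.mem_ker, map_sub, hψf, hgf]
      simp [presentation]
    exact ⟨injective_of_surjective_of_isNoetherianRing (ψ.comp φ).toRingHom h2, h2⟩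
  have hφinj : Function.Injective φ := Function.Injective.of_comp (f := ψ) hψφ.1
  have hφsurj : Function.Surjective φ := Function.Surjective.of_comp (g := ψ) hφψ.2
  obtain ⟨F', hF'⟩ := hφsurj F
  have hF'0 : F' ≠ 0 := by
    rintro rfl
    exact hF0 (by rw [← hF', map_zero])
  have hker' : RingHom.ker (presentation f') = Ideal.span {F'} := by
    ext p
    rw [RingHom.mem_ker, ← hφf, ← RingHom.mem_ker, hker, Ideal.mem_span_singleton,
      Ideal.mem_span_singleton, ← hF']
    constructor
    · rintro ⟨q, hq⟩
      obtain ⟨q, rfl⟩ := hφsurj q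
      exact ⟨q, hφinj (by rw [hq, map_mul])⟩
    · exact map_dvd φ
  have hF'e : IsWeightedHomogeneous (genDeg f') F' e := by
    have : weightedHomogeneousComponent (genDeg f') e F' = F' := by
      apply hφinj
      have h1 := weightedHomogeneousComponent_aeval (w := genDeg f') hg e F'
      rw [← hφ, hF', hFe.weightedHomogeneousComponent_same] at h1
      rw [← h1, hF']
    rw [← this]
    exact weightedHomogeneousComponent_isWeightedHomogeneous _ _
  refine ⟨⟨F', hF'e, hF'0, hker'⟩, ⟨LinearMap.mulLeft _ F', ?_⟩,
    projectiveDimension_invariantsModule hsurj' hF'0 hker'⟩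
  exact
    { injective := mul_right_injective₀ hF'0
      exact := by
        intro p
        rw [← RingHom.mem_ker, hker', Ideal.mem_span_singleton]
        exact ⟨fun ⟨q, hq⟩ => ⟨q, hq.symm⟩, fun ⟨q, hq⟩ => ⟨q, hq.symm⟩⟩
      surjective := hsurj'
      graded_left := fun k p hp => by
        rw [add_comm]
        exact IsWeightedHomogeneous.mul hF'e hp
      graded_right := fun k p hp => presentation_isHomogeneous hf'.homogeneous hp
      minimal := fun p => by
        refine Ideal.mul_mem_right _ _ (Ideal.pow_le_self two_ne_zero (hf'.ker_le ?_))
        rw [hker']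
        exact Ideal.mem_span_singleton_self F' }

end Criterion

/-! ### Invariants as functions on coordinate vectors -/

/-- Coefficients of `F(x + t y, y)`, for the form `F` with coefficients `a`. -/
def shear {R : Type*} [CommRing R] (d : ℕ) (t : R) (a : Fin (d + 1) → R) : Fin (d + 1) → R :=
  fun j => ∑ i : Fin (d + 1), (Nat.choose (d - i) (d - j) : R) * t ^ ((j : ℕ) - i) * a i

/-- Coefficients of `F(y, -x)`, for the form `F` with coefficients `a`. -/
def flip {R : Type*} [CommRing R] (d : ℕ) (a : Fin (d + 1) → R) : Fin (d + 1) → R :=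
  fun j => (-1) ^ (d - (j : ℕ)) * a j.rev

/-- Coefficients of `F(s x, s⁻¹ y)`, for the form `F` with coefficients `a`. -/
def torus {R : Type*} [Field R] (d : ℕ) (s : R) (a : Fin (d + 1) → R) : Fin (d + 1) → R :=
  fun j => s ^ (d - (j : ℕ)) * s⁻¹ ^ (j : ℕ) * a j

/-- The form with given coefficients. -/
def toForm {K : Type*} [Field K] (d : ℕ) (a : Fin (d + 1) → K) : MvPolynomial (Fin 2) K :=
  ∑ j : Fin (d + 1), C (a j) * (X 0 ^ (d - (j : ℕ)) * X 1 ^ (j : ℕ))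

/-! ### Substitutions on binary forms and generators of `SL₂`. -/

section Forms

variable {K : Type u} [Field K]

theorem toForm_eq_sum_monomial (d : ℕ) (a : Fin (d + 1) → K) :
    toForm d a = ∑ j : Fin (d + 1), monomial (Finsupp.single 0 (d - (j : ℕ)) + Finsupp.single 1 (j : ℕ)) (a j) := by
  refine Finset.sum_congr rfl fun j _ => ?_
  rw [X_pow_eq_monomial, X_pow_eq_monomial, monomial_mul, C_mul_monomial]
  simp

theorem coeff_toForm (d : ℕ) (a : Fin (d + 1) → K) (j : Fin (d + 1)) :
    coeff (Finsupp.single 0 (d - (j : ℕ)) + Finsupp.single 1 (j : ℕ)) (toForm d a) = a j := by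
  classical
  rw [toForm_eq_sum_monomial, coeff_sum, Finset.sum_eq_single j]
  · simp
  · intro i _ hij
    rw [coeff_monomial, if_neg]
    intro h
    have := DFunLike.congr_fun h 1
    simp at this
    exact hij (Fin.ext this)
  · simp

theorem toForm_isHomogeneous (d : ℕ) (a : Fin (d + 1) → K) : (toForm d a).IsHomogeneous d := by
  rw [toForm_eq_sum_monomial]
  refine IsHomogeneous.sum _ _ _ fun j _ => isHomogeneous_monomial _ ?_
  rw [map_add, Finsupp.degree_single, Finsupp.degree_single]
  omega

theorem toForm_coeff (d : ℕ) {F : MvPolynomial (Fin 2) K} (hF : F.IsHomogeneous d) :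
    toForm d (fun j => coeff (Finsupp.single 0 (d - (j : ℕ)) + Finsupp.single 1 (j : ℕ)) F) = F := by
  ext m
  by_cases hm : m.degree = d
  · have h2 : m 0 + m 1 = d := by
      rw [← hm, Finsupp.degree_eq_sum, Fin.sum_univ_two]
    have h1 : m = Finsupp.single 0 (d - m 1) + Finsupp.single 1 (m 1) := by
      ext i
      fin_cases i <;> simp
      omega
    rw [h1]
    exact coeff_toForm d _ ⟨m 1, by omega⟩
  · rw [(toForm_isHomogeneous d _).coeff_eq_zero hm, hF.coeff_eq_zero hm]

theorem subst_shear (d : ℕ) (t : K) (a : Fin (d + 1) → K) :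
    subst !![1, t; 0, 1] (toForm d a) = toForm d (shear d t a) := by
  have key : ∀ i : Fin (d + 1), ((X 0 + C t * X 1) ^ (d - (i : ℕ)) * X 1 ^ (i : ℕ) :
      MvPolynomial (Fin 2) K) = ∑ j : Fin (d + 1), C ((Nat.choose (d - i) (d - j) : K) *
        t ^ ((j : ℕ) - i)) * (X 0 ^ (d - (j : ℕ)) * X 1 ^ (j : ℕ)) := by
    intro i
    have hi : (i : ℕ) ≤ d := by omega
    -- The sum is reflected so that the exponent of `X 0` becomes the summation index of the
    -- binomial theorem; terms beyond `d - i` have zero binomial coefficient.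
    rw [Fin.sum_univ_eq_sum_range fun j => C ((Nat.choose (d - i) (d - j) : K) *
        t ^ (j - (i : ℕ))) * (X 0 ^ (d - j) * X 1 ^ j), ← Finset.sum_range_reflect, add_pow,
      Finset.sum_mul, ← Finset.sum_subset (Finset.range_subset_range.mpr
        (show d - (i : ℕ) + 1 ≤ d + 1 by omega))]
    · refine Finset.sum_congr rfl fun k hk => ?_
      rw [Finset.mem_range] at hk
      rw [show d + 1 - 1 - k = (d - i - k) + i by omega, show d - (d - ↑i - k + ↑i) = k by omega,
        Nat.add_sub_cancel, mul_pow, pow_add, C_mul, C_pow]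
      simp only [map_natCast]
      ring
    · intro k hk hk'
      rw [Finset.mem_range] at hk hk'
      rw [show d - (d + 1 - 1 - k) = k by omega, Nat.choose_eq_zero_of_lt (by omega)]
      simp
  rw [toForm, map_sum]
  have h0 : subst !![1, t; 0, 1] (X 0 : MvPolynomial (Fin 2) K) = X 0 + C t * X 1 := by
    simp [subst, Fin.sum_univ_two]
  have h1 : subst !![1, t; 0, 1] (X 1 : MvPolynomial (Fin 2) K) = X 1 := by
    simp [subst, Fin.sum_univ_two]
  simp only [map_mul, map_pow, h0, h1, key, algHom_C, algebraMap_eq]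
  rw [toForm]
  simp only [shear, map_sum, Finset.mul_sum, Finset.sum_mul]
  rw [Finset.sum_comm]
  refine Finset.sum_congr rfl fun j _ => Finset.sum_congr rfl fun i _ => ?_
  simp only [map_mul, map_pow]
  ring

theorem subst_flip (d : ℕ) (a : Fin (d + 1) → K) :
    subst !![0, 1; -1, 0] (toForm d a) = toForm d (flip d a) := by
  have h0 : subst !![0, 1; -1, 0] (X 0 : MvPolynomial (Fin 2) K) = X 1 := by
    simp [subst, Fin.sum_univ_two]
  have h1 : subst !![0, 1; -1, 0] (X 1 : MvPolynomial (Fin 2) K) = - X 0 := by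
    simp [subst, Fin.sum_univ_two]
  rw [toForm, map_sum, toForm, ← Equiv.sum_comp Fin.revPerm]
  refine Finset.sum_congr rfl fun j _ => ?_
  simp only [map_mul, map_pow, h0, h1, algHom_C, algebraMap_eq, flip, Fin.revPerm_apply,
    Fin.val_rev, map_neg, map_one]
  rw [show d - (d + 1 - (↑j + 1)) = (j : ℕ) by omega,
    show d + 1 - (↑j + 1) = d - (j : ℕ) by omega, neg_pow (X 0 : MvPolynomial (Fin 2) K)]
  ring

theorem subst_torus (d : ℕ) (s : K) (a : Fin (d + 1) → K) :
    subst !![s, 0; 0, s⁻¹] (toForm d a) = toForm d (torus d s a) := by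
  have h0 : subst !![s, 0; 0, s⁻¹] (X 0 : MvPolynomial (Fin 2) K) = C s * X 0 := by
    simp [subst, Fin.sum_univ_two]
  have h1 : subst !![s, 0; 0, s⁻¹] (X 1 : MvPolynomial (Fin 2) K) = C s⁻¹ * X 1 := by
    simp [subst, Fin.sum_univ_two]
  rw [toForm, map_sum, toForm]
  refine Finset.sum_congr rfl fun j _ => ?_
  simp only [map_mul, map_pow, h0, h1, algHom_C, algebraMap_eq, torus]
  ring

/-- Upper unipotents and the Weyl element `W` generate the group. Conjugating by `W`, whose inverse
is `W³`, gives the lower unipotents; a matrix with nonzero lower left entry is a product upper,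
lower, upper, and any other is brought to that case by one lower unipotent. -/
theorem sl2_induction {P : SL2 K → Prop} (hmul : ∀ g h, P g → P h → P (g * h))
    (hU : ∀ g : SL2 K, ∀ t, g.1 = !![1, t; 0, 1] → P g)
    (hW : ∀ g : SL2 K, g.1 = !![0, 1; -1, 0] → P g) (g : SL2 K) : P g := by
  obtain ⟨U, hUc⟩ : ∃ U : K → SL2 K, ∀ t, (U t).1 = !![1, t; 0, 1] :=
    ⟨fun t => ⟨!![1, t; 0, 1], by simp⟩, fun t => rfl⟩
  obtain ⟨W, hWc⟩ : ∃ W : SL2 K, W.1 = !![0, 1; -1, 0] := ⟨⟨!![0, 1; -1, 0], by simp⟩, rfl⟩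
  obtain ⟨N, hNc⟩ : ∃ N : K → SL2 K, ∀ t, (N t).1 = !![1, 0; t, 1] :=
    ⟨fun t => ⟨!![1, 0; t, 1], by simp⟩, fun t => rfl⟩
  have hU' : ∀ t, P (U t) := fun t => hU _ t (hUc t)
  have hW' : P W := hW _ hWc
  have hN : ∀ t, P (N t) := by
    intro t
    have : N t = W * U (-t) * (W * W * W) := by
      apply Subtype.ext
      simp only [Matrix.SpecialLinearGroup.coe_mul, hUc, hNc, hWc, Matrix.mul_fin_two]
      simp
    rw [this]
    exact hmul _ _ (hmul _ _ hW' (hU' _)) (hmul _ _ (hmul _ _ hW' hW') hW')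
  have hc : ∀ g : SL2 K, g.1 1 0 ≠ 0 → P g := by
    intro g hg
    have hdet : g.1 0 0 * g.1 1 1 - g.1 0 1 * g.1 1 0 = 1 := by
      rw [← Matrix.det_fin_two]; exact g.2
    have : g = U ((g.1 0 0 - 1) / g.1 1 0) * N (g.1 1 0) * U ((g.1 1 1 - 1) / g.1 1 0) := by
      apply Subtype.ext
      simp only [Matrix.SpecialLinearGroup.coe_mul, hUc, hNc, Matrix.mul_fin_two]
      ext i j
      fin_cases i <;> fin_cases j <;> simp <;> field_simp
      · ring
      · linear_combination -hdet
      · ring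
    rw [this]
    exact hmul _ _ (hmul _ _ (hU' _) (hN _)) (hU' _)
  by_cases hg : g.1 1 0 = 0
  · have hdet : g.1 0 0 * g.1 1 1 - g.1 0 1 * g.1 1 0 = 1 := by
      rw [← Matrix.det_fin_two]; exact g.2
    have h1 : P (N 1 * g) := by
      refine hc _ ?_
      rw [Matrix.SpecialLinearGroup.coe_mul, hNc, Matrix.mul_apply, Fin.sum_univ_two, hg]
      intro h0
      simp at h0
      rw [h0, hg] at hdet
      simp at hdet
    have : g = N (-1) * (N 1 * g) := by
      rw [← mul_assoc]
      have : N (-1) * N 1 = 1 := by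
        apply Subtype.ext
        simp only [Matrix.SpecialLinearGroup.coe_mul, hNc, Matrix.mul_fin_two]
        simp [Matrix.one_fin_two]
      rw [this, one_mul]
    rw [this]
    exact hmul _ _ (hN _) h1
  · exact hc g hg

end Forms

/-- Coordinate vectors with entries in `R`. -/
abbrev CoordPoint (R : Type*) {n : ℕ} (d : Fin n → ℕ) := (i : Fin n) → Fin (d i + 1) → R

/-! ### Invariance in coordinates and extension of the base field. -/

section Points

variable {K : Type u} [Field K] {n : ℕ} {d : Fin n → ℕ}

/-- The value of a polynomial function at a coordinate vector. -/
def evalAt {R : Type*} [CommRing R] [Algebra K R] (x : CoordPoint R d) : CoordRing K d →ₐ[K] R :=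
  aeval fun c => x c.1 c.2

theorem evalAt_X {R : Type*} [CommRing R] [Algebra K R] (x : CoordPoint R d) (c : CoordIdx d) :
    evalAt x (X c : CoordRing K d) = x c.1 c.2 := aeval_X _ _

theorem map_evalAt {R S : Type*} [CommRing R] [Algebra K R] [CommRing S] [Algebra K S]
    (φ : R →ₐ[K] S) (x : CoordPoint R d) (p : CoordRing K d) :
    φ (evalAt x p) = evalAt (fun i j => φ (x i j)) p := by
  rw [evalAt, ← AlgHom.comp_apply, comp_aeval]; rfl

theorem map_shear {R S : Type*} [CommRing R] [CommRing S] (φ : R →+* S) (e : ℕ) (t : R)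
    (a : Fin (e + 1) → R) (j : Fin (e + 1)) :
    φ (shear e t a j) = shear e (φ t) (fun i => φ (a i)) j := by
  simp [shear]

theorem map_flip {R S : Type*} [CommRing R] [CommRing S] (φ : R →+* S) (e : ℕ)
    (a : Fin (e + 1) → R) (j : Fin (e + 1)) :
    φ (flip e a j) = flip e (fun i => φ (a i)) j := by
  simp [flip]

/-- The tuple of forms with given coordinates. -/
def ofPoint (x : CoordPoint K d) : FormSpace K d :=
  fun i => ⟨toForm (d i) (x i), toForm_isHomogeneous _ _⟩

theorem value_ofPoint (x : CoordPoint K d) (p : CoordRing K d) :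
    value (ofPoint x) p = evalAt x p := by
  unfold value evalAt
  congr 2
  funext c
  exact coeff_toForm _ _ _

theorem exists_ofPoint (v : FormSpace K d) : ∃ x : CoordPoint K d, v = ofPoint x :=
  ⟨fun i j => coeff (Finsupp.single 0 (d i - (j : ℕ)) + Finsupp.single 1 (j : ℕ))
    (v i : MvPolynomial (Fin 2) K), funext fun i => Subtype.ext (toForm_coeff _ (v i).2).symm⟩

theorem act_mul (g h : SL2 K) (v : FormSpace K d) : act (g * h) v = act g (act h v) := by
  funext i
  simp [act, map_mul]

/-- The action substitutes `g⁻¹`, so it is `g⁻¹` that acts on coefficients through the substitution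
by `g`. -/
theorem act_inv_ofPoint {g : SL2 K} {A : Matrix (Fin 2) (Fin 2) K} (hg : g.1 = A)
    {x : CoordPoint K d} {T : (e : ℕ) → (Fin (e + 1) → K) →
    Fin (e + 1) → K} (h : ∀ e a, subst A (toForm e a) = toForm e (T e a)) :
    act g⁻¹ (ofPoint x) = ofPoint fun i => T (d i) (x i) := by
  funext i
  apply Subtype.ext
  change subst (g⁻¹⁻¹ : SL2 K).1 _ = _
  rw [inv_inv, hg]
  exact h _ _

theorem mem_invariants_iff (p : CoordRing K d) : p ∈ invariants K d ↔
    (∀ t (x : CoordPoint K d), evalAt (fun i => shear (d i) t (x i)) p = evalAt x p) ∧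
    ∀ x : CoordPoint K d, evalAt (fun i => flip (d i) (x i)) p = evalAt x p := by
  constructor
  · intro hp
    constructor
    · intro t x
      obtain ⟨g, hg⟩ : ∃ g : SL2 K, g.1 = !![1, t; 0, 1] := ⟨⟨_, by simp⟩, rfl⟩
      have := hp g⁻¹ (ofPoint x)
      rwa [act_inv_ofPoint hg (T := fun e => shear e t) (fun e a => subst_shear e t a), value_ofPoint, value_ofPoint] at this
    · intro x
      obtain ⟨g, hg⟩ : ∃ g : SL2 K, g.1 = !![0, 1; -1, 0] := ⟨⟨_, by simp⟩, rfl⟩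
      have := hp g⁻¹ (ofPoint x)
      rwa [act_inv_ofPoint hg (T := flip) (fun e a => subst_flip e a), value_ofPoint, value_ofPoint] at this
  · rintro ⟨h1, h2⟩
    have key : ∀ g : SL2 K, ∀ v : FormSpace K d, value (act g⁻¹ v) p = value v p := by
      refine sl2_induction ?_ ?_ ?_
      · intro g h hg hh v
        rw [mul_inv_rev, act_mul, hh, hg]
      · intro g t hg v
        obtain ⟨x, rfl⟩ := exists_ofPoint v
        rw [act_inv_ofPoint hg (T := fun e => shear e t) (fun e a => subst_shear e t a), value_ofPoint,
          value_ofPoint, h1]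
      · intro g hg v
        obtain ⟨x, rfl⟩ := exists_ofPoint v
        rw [act_inv_ofPoint hg (T := flip) (fun e a => subst_flip e a), value_ofPoint,
          value_ofPoint, h2]
    intro g v
    simpa using key g⁻¹ v

variable {L : Type*} [Field L] [Algebra K L]

theorem evalAt_map (x : CoordPoint L d) (p : CoordRing K d) :
    evalAt (K := L) x (map (algebraMap K L) p) = evalAt x p :=
  aeval_map_algebraMap _ _ _

/-- Invariance under the generators is a polynomial identity in the coordinates and the parameter of
the shear. It holds formally because `K` is infinite, and can then be specialized to `L`. -/
theorem map_mem_invariants [Infinite K] {p : CoordRing K d} (hp : p ∈ invariants K d) :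
    map (algebraMap K L) p ∈ invariants L d := by
  rw [mem_invariants_iff] at hp ⊢
  constructor
  · intro t x
    rw [evalAt_map, evalAt_map]
    -- The variable `X none` is the generic parameter of the shear; the others are generic
    -- coordinates.
    let R := MvPolynomial (Option (CoordIdx d)) K
    let x₀ : CoordPoint R d := fun i j => X (some ⟨i, j⟩)
    have key : evalAt (fun i => shear (d i) (X none : R) (x₀ i)) p = evalAt x₀ p := by
      refine MvPolynomial.funext fun y => ?_
      rw [← aeval_eq_eval, map_evalAt, map_evalAt]
      have := hp.1 (y none) fun i j => y (some ⟨i, j⟩)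
      convert this using 2
      · congr 1
        funext i j
        exact (map_shear (aeval y : R →ₐ[K] K).toRingHom (d i) (X none) (x₀ i) j).trans
          (by simp [x₀])
      · congr 1
        funext i j
        simp [x₀]
    let y : Option (CoordIdx d) → L := fun o => o.elim t fun c => x c.1 c.2
    have := congrArg (aeval y : R →ₐ[K] L) key
    rw [map_evalAt, map_evalAt] at this
    convert this using 2
    · congr 1
      funext i j
      exact ((map_shear (aeval y : R →ₐ[K] L).toRingHom (d i) (X none) (x₀ i) j).trans
        (by simp [x₀, y])).symm
    · congr 1
      funext i j
      simp [x₀, y]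
  · intro x
    rw [evalAt_map, evalAt_map]
    let x₀ : CoordPoint (CoordRing K d) d := fun i j => X ⟨i, j⟩
    have key : evalAt (fun i => flip (d i) (x₀ i)) p = evalAt x₀ p := by
      refine MvPolynomial.funext fun y => ?_
      rw [← aeval_eq_eval, map_evalAt, map_evalAt]
      have := hp.2 fun i j => y ⟨i, j⟩
      convert this using 2
      · congr 1
        funext i j
        exact (map_flip (aeval y : CoordRing K d →ₐ[K] K).toRingHom (d i) (x₀ i) j).trans
          (by simp [x₀])
      · congr 1
        funext i j
        simp [x₀]
    let y : CoordIdx d → L := fun c => x c.1 c.2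
    have := congrArg (aeval y : CoordRing K d →ₐ[K] L) key
    rw [map_evalAt, map_evalAt] at this
    convert this using 2
    · congr 1
      funext i j
      exact ((map_flip (aeval y : CoordRing K d →ₐ[K] L).toRingHom (d i) (x₀ i) j).trans
        (by simp [x₀, y])).symm
    · congr 1
      funext i j
      simp [x₀, y]

variable (K) in
/-- All invariants over `K` take the same value at the two points. -/
def SameInvariants (x y : CoordPoint L d) : Prop :=
  ∀ p ∈ invariants K d, evalAt x p = evalAt y p

theorem SameInvariants.trans {x y z : CoordPoint L d} (h : SameInvariants K x y)
    (h' : SameInvariants K y z) : SameInvariants K x z :=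
  fun p hp => (h p hp).trans (h' p hp)

variable [Infinite K]

theorem sameInvariants_shear (t : L) (x : CoordPoint L d) :
    SameInvariants K x fun i => shear (d i) t (x i) := fun p hp => by
  have := ((mem_invariants_iff _).mp (map_mem_invariants (L := L) hp)).1 t x
  rw [evalAt_map, evalAt_map] at this
  exact this.symm

theorem sameInvariants_flip (x : CoordPoint L d) :
    SameInvariants K x fun i => flip (d i) (x i) := fun p hp => by
  have := ((mem_invariants_iff _).mp (map_mem_invariants (L := L) hp)).2 x
  rw [evalAt_map, evalAt_map] at this
  exact this.symm

theorem sameInvariants_torus {s : L} (hs : s ≠ 0) (x : CoordPoint L d) :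
    SameInvariants K x fun i => torus (d i) s (x i) := fun p hp => by
  obtain ⟨g, hg⟩ : ∃ g : SL2 L, g.1 = !![s, 0; 0, s⁻¹] := ⟨⟨_, by simp [hs]⟩, rfl⟩
  have := map_mem_invariants (L := L) hp g⁻¹ (ofPoint x)
  rw [act_inv_ofPoint hg (T := fun e => torus e s) (fun e a => subst_torus e s a), value_ofPoint, value_ofPoint, evalAt_map,
    evalAt_map] at this
  exact this.symm

end Points

/-! ### Generation of the algebra of invariants by localization -/

section Vanishing

variable {K L : Type*} [Field K] [Infinite K] [Field L] [Algebra K L] {σ : Type*}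

theorem eq_zero_of_forall_aeval {p : MvPolynomial σ K} (h : ∀ x : σ → L, aeval x p = 0) : p = 0 := by
  refine MvPolynomial.funext fun x => (algebraMap K L).injective ?_
  rw [map_zero, map_zero, ← aeval_eq_eval]
  exact (aeval_algebraMap_apply L x p).symm.trans (h _)

theorem eq_zero_of_forall_aeval_of_ne {p h : MvPolynomial σ K} (hh : h ≠ 0)
    (H : ∀ x : σ → L, aeval x h ≠ 0 → aeval x p = 0) : p = 0 := by
  have : p * h = 0 := eq_zero_of_forall_aeval (L := L) fun x => by
    rw [map_mul]
    by_cases hx : aeval x h = 0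
    · rw [hx, mul_zero]
    · rw [H x hx, zero_mul]
  exact (mul_eq_zero.mp this).resolve_right hh

/-- Vanishing on the hyperplane makes the polynomial zero after setting `X i` to zero, and this
substitution does not change classes modulo `X i`. -/
theorem X_dvd_of_forall_aeval {p : MvPolynomial σ K} {i : σ}
    (h : ∀ x : σ → L, x i = 0 → aeval x p = 0) : X i ∣ p := by
  classical
  have h0 : aeval (Function.update (X : σ → MvPolynomial σ K) i 0) p = 0 := by
    refine eq_zero_of_forall_aeval (L := L) fun x => ?_
    rw [← AlgHom.comp_apply, comp_aeval]
    exact h _ (by simp)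
  rw [← Ideal.mem_span_singleton, ← Ideal.Quotient.eq_zero_iff_mem]
  have : (Ideal.Quotient.mkₐ K (Ideal.span {(X i : MvPolynomial σ K)})).comp
      (aeval (Function.update (X : σ → MvPolynomial σ K) i 0)) = Ideal.Quotient.mkₐ K _ := by
    ext j
    by_cases hj : j = i
    · subst hj
      simp only [AlgHom.comp_apply, aeval_X, Function.update_self, map_zero]
      exact (Ideal.Quotient.eq_zero_iff_mem.mpr (Ideal.mem_span_singleton_self _)).symm
    · simp [Function.update_of_ne hj]
  have h1 := DFunLike.congr_fun this p
  rw [AlgHom.comp_apply, h0, map_zero] at h1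
  exact h1.symm

end Vanishing

/-! ### Cancelling denominators in the image of a polynomial ring. -/

section Descent

variable {R S : Type*} [CommRing R] [IsDomain R] [WfDvdMonoid R] [CommRing S] [IsDomain S]

/-- An element of the kernel is divisible by `a`, and the quotient is again in the kernel. Thus each
coefficient is divisible by every power of the nonunit `a`. -/
theorem eq_zero_of_descent (ev : Polynomial R →+* S) {n : WithBot ℕ} {a : R}
    (ha : ¬ IsUnit a) (ha0 : ev (Polynomial.C a) ≠ 0)
    (H : ∀ P, P.degree < n → ev (Polynomial.C a) ∣ ev P → Polynomial.C a ∣ P)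
    {P : Polynomial R} (hP : P.degree < n) (h : ev P = 0) : P = 0 := by
  have hane : a ≠ 0 := by
    rintro rfl
    simp at ha0
  have key : ∀ j : ℕ, ∃ Q : Polynomial R, P = Polynomial.C a ^ j * Q ∧ Q.degree < n ∧ ev Q = 0 := by
    intro j
    induction j with
    | zero => exact ⟨P, by simp, hP, h⟩
    | succ j ih =>
      obtain ⟨Q, hQ, hQn, hQ0⟩ := ih
      obtain ⟨Q', rfl⟩ := H Q hQn (hQ0 ▸ dvd_zero _)
      refine ⟨Q', by rw [hQ]; ring, ?_, ?_⟩
      · rwa [Polynomial.degree_C_mul hane] at hQn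
      · rw [map_mul] at hQ0
        exact (mul_eq_zero.mp hQ0).resolve_left ha0
  by_contra hne
  obtain ⟨i, hi⟩ : ∃ i, P.coeff i ≠ 0 := by
    by_contra! hall
    exact hne (Polynomial.ext fun i => by simp [hall i])
  have hfin : FiniteMultiplicity a (P.coeff i) := FiniteMultiplicity.of_not_isUnit ha hi
  obtain ⟨j, hj⟩ := hfin
  apply hj
  obtain ⟨Q, hQ, -, -⟩ := key (j + 1)
  rw [hQ, ← Polynomial.C_pow, Polynomial.coeff_C_mul]
  exact dvd_mul_right _ _

/-- One factor of `a` is cancelled at a time: reduction modulo the monic relation `F` brings the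
degree into the range where `H` applies. -/
theorem exists_of_descent {R S : Type*} [CommRing R] [Nontrivial R] [CommRing S] [IsDomain S]
    (ev : Polynomial R →+* S) {F : Polynomial R} (hF : F.Monic) (hF0 : ev F = 0) {a : R} (ha0 : ev (Polynomial.C a) ≠ 0)
    (H : ∀ P, P.degree < F.degree → ev (Polynomial.C a) ∣ ev P → Polynomial.C a ∣ P)
    {s : S} (N : ℕ) : ∀ P, ev (Polynomial.C a) ^ N * s = ev P → ∃ Q, ev Q = s := by
  induction N with
  | zero => exact fun P hP => ⟨P, by rw [← hP, pow_zero, one_mul]⟩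
  | succ N ih =>
    intro P hP
    have h1 : ev (P %ₘ F) = ev P := by
      conv_rhs => rw [← Polynomial.modByMonic_add_div P F, map_add, map_mul, hF0, zero_mul, add_zero]
    obtain ⟨Q, hQ⟩ := H (P %ₘ F) (Polynomial.degree_modByMonic_lt P hF) (by
      rw [h1, ← hP, pow_succ']
      exact ⟨ev (Polynomial.C a) ^ N * s, by ring⟩)
    refine ih Q (mul_left_cancel₀ ha0 ?_)
    rw [← map_mul, ← hQ, h1, ← hP, pow_succ']
    ring

end Descent

/-! ### Families of invariants given by universal formulas -/

/-- A family of polynomial functions given by formulas over all commutative rings which are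
compatible with ring homomorphisms, invariant, and homogeneous. -/
structure IsInvariantFamily {n : ℕ} {d : Fin n → ℕ} {m : ℕ}
    (Φ : {R : Type u} → [CommRing R] → CoordPoint R d → Fin m → R) (w : Fin m → ℕ) : Prop where
  map_eq : ∀ {R S : Type u} [CommRing R] [CommRing S] (φ : R →+* S) (x : CoordPoint R d) (i : Fin m),
    φ (Φ x i) = Φ (fun i j => φ (x i j)) i
  shear_eq : ∀ {R : Type u} [CommRing R] (t : R) (x : CoordPoint R d) (i : Fin m),
    Φ (fun i => shear (d i) t (x i)) i = Φ x i
  flip_eq : ∀ {R : Type u} [CommRing R] (x : CoordPoint R d) (i : Fin m),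
    Φ (fun i => flip (d i) (x i)) i = Φ x i
  smul_eq : ∀ {R : Type u} [CommRing R] (s : R) (x : CoordPoint R d) (i : Fin m),
    Φ (fun i j => s * x i j) i = s ^ w i * Φ x i

section Family

variable (K : Type u) [Field K] {n : ℕ} {d : Fin n → ℕ} {m : ℕ}
  {Φ : {R : Type u} → [CommRing R] → CoordPoint R d → Fin m → R} {w : Fin m → ℕ}

/-- The invariant is the formula applied to the generic vector, so compatibility with specialization
gives its values. -/
theorem IsInvariantFamily.evalAt_eq (h : IsInvariantFamily Φ w) {R : Type u} [CommRing R]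
    [Algebra K R] (x : CoordPoint R d) (i : Fin m) :
    evalAt x (Φ (R := CoordRing K d) (fun i j => X ⟨i, j⟩) i) = Φ x i := by
  refine (h.map_eq (evalAt x : CoordRing K d →ₐ[K] R).toRingHom _ i).trans ?_
  congr 1
  funext i j
  exact evalAt_X _ _

/-- The invariants given by a family of formulas. -/
def IsInvariantFamily.toInvariants (h : IsInvariantFamily Φ w) (i : Fin m) : invariants K d :=
  ⟨Φ (R := CoordRing K d) (fun i j => X ⟨i, j⟩) i, by
    rw [mem_invariants_iff]
    refine ⟨fun t x => ?_, fun x => ?_⟩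
    · rw [h.evalAt_eq K, h.evalAt_eq K, h.shear_eq]
    · rw [h.evalAt_eq K, h.evalAt_eq K, h.flip_eq]⟩

theorem IsInvariantFamily.evalAt_toInvariants (h : IsInvariantFamily Φ w) {R : Type u} [CommRing R]
    [Algebra K R] (x : CoordPoint R d) (i : Fin m) :
    evalAt x (h.toInvariants K i : CoordRing K d) = Φ x i :=
  h.evalAt_eq K x i

theorem IsInvariantFamily.isHomogeneous [CharZero K] (h : IsInvariantFamily Φ w) (i : Fin m) :
    (h.toInvariants K i : CoordRing K d).IsHomogeneous (w i) :=
  isHomogeneous_of_scaling (L := K) (w i) _ fun x => by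
    have h1 := h.evalAt_toInvariants K (fun i j => 2 * x ⟨i, j⟩) i
    have h2 := h.evalAt_toInvariants K (fun i j => x ⟨i, j⟩) i
    rw [h.smul_eq 2 (fun i j => x ⟨i, j⟩), ← h2] at h1
    exact h1

end Family

/-! ### Slices, and the criterion for a quadratic relation. -/

section Quadratic

variable {K L : Type u} [Field K] [Field L] [Algebra K L] {n : ℕ} {d : Fin n → ℕ}

/-- Every coordinate vector outside a hypersurface can be moved into `S`. -/
def IsSlice (K : Type u) [Field K] [Algebra K L] (S : Set (CoordPoint L d)) : Prop :=
  ∃ h : CoordRing K d, h ≠ 0 ∧ ∀ x : CoordPoint L d, evalAt x h ≠ 0 →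
    ∃ y ∈ S, SameInvariants K x y

theorem evalAt_eq_aeval {R : Type u} [CommRing R] [Algebra K R] (x : CoordIdx d → R)
    (p : CoordRing K d) : aeval x p = evalAt (fun i j => x ⟨i, j⟩) p := rfl

/-- Invariants agreeing on the slice agree off the hypersurface of excluded points, hence as
polynomials. -/
theorem IsSlice.eq [Infinite K] {S : Set (CoordPoint L d)} (hS : IsSlice K S) {p q : CoordRing K d}
    (hp : p ∈ invariants K d) (hq : q ∈ invariants K d)
    (h : ∀ y ∈ S, evalAt y p = evalAt y q) : p = q := by
  obtain ⟨g, hg, H⟩ := hS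
  rw [← sub_eq_zero]
  refine eq_zero_of_forall_aeval_of_ne (L := L) hg fun x hx => ?_
  obtain ⟨y, hy, hxy⟩ := H (fun i j => x ⟨i, j⟩) hx
  rw [evalAt_eq_aeval, map_sub, hxy p hp, hxy q hq, h y hy, sub_self]

theorem IsSlice.nonempty [Infinite K] {S : Set (CoordPoint L d)} (hS : IsSlice K S) : S.Nonempty := by
  by_contra hne
  have := hS.eq (p := 1) (q := 0) (one_mem _) (zero_mem _) fun y hy => (hne ⟨y, hy⟩).elim
  exact one_ne_zero this

theorem aeval_eq_eval₂_finSuccEquiv {A : Type*} [CommRing A] [Algebra K A] {k : ℕ}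
    (f : Fin (k + 1) → A) (p : MvPolynomial (Fin (k + 1)) K) :
    aeval f p = (finSuccEquiv K k p).eval₂ (aeval fun i => f i.succ :
      MvPolynomial (Fin k) K →ₐ[K] A).toRingHom (f 0) := by
  induction p using MvPolynomial.induction_on with
  | C a => simp [finSuccEquiv_apply]
  | add p q hp hq => rw [map_add, map_add, Polynomial.eval₂_add, hp, hq]
  | mul_X p i hp =>
    rw [map_mul, map_mul, Polynomial.eval₂_mul, hp, aeval_X]
    congr 1
    refine Fin.cases ?_ (fun i => ?_) i
    · rw [finSuccEquiv_X_zero, Polynomial.eval₂_X]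
    · rw [finSuccEquiv_X_succ, Polynomial.eval₂_C]; simp

theorem finSuccEquiv_rename_succ {k : ℕ} (p : MvPolynomial (Fin k) K) :
    finSuccEquiv K k (rename Fin.succ p) = Polynomial.C p := by
  induction p using MvPolynomial.induction_on with
  | C a => simp [finSuccEquiv_apply]
  | add p q hp hq => rw [map_add, map_add, map_add, hp, hq]
  | mul_X p i hp => rw [map_mul, map_mul, map_mul, hp, rename_X, finSuccEquiv_X_succ]

/-- A monic relation satisfied by the first of a generating family of invariants, which is
minimal over the polynomial ring in the remaining ones, presents the algebra of invariants. -/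
theorem isHypersurfaceOfDegree_of_monic {k : ℕ} (f : Fin (k + 1) → invariants K d)
    (w : Fin (k + 1) → ℕ) (hf : ∀ i, (f i : CoordRing K d).IsHomogeneous (w i))
    (F : MvPolynomial (Fin (k + 1)) K) {e : ℕ} (hFm : (finSuccEquiv K k F).Monic)
    (hF : presentation f F = 0) (hFe : IsWeightedHomogeneous w F e) (he : 0 < e)
    (hwe : ∀ i, w i < e) (hsurj : Function.Surjective (presentation f))
    (hker : ∀ p, (finSuccEquiv K k p).degree < (finSuccEquiv K k F).degree →
      presentation f p = 0 → p = 0) :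
    IsHypersurfaceOfDegree K d e := by
  refine isHypersurfaceOfDegree_of_presentation f w hf hsurj F ?_ ?_ hFe he hwe
  · refine le_antisymm (fun p hp => ?_) ?_
    · rw [Ideal.mem_span_singleton]
      set r := (finSuccEquiv K k).symm (finSuccEquiv K k p %ₘ finSuccEquiv K k F)
      set q := (finSuccEquiv K k).symm (finSuccEquiv K k p /ₘ finSuccEquiv K k F)
      have h1 : p = r + F * q := by
        apply (finSuccEquiv K k).injective
        rw [map_add, map_mul, AlgEquiv.apply_symm_apply, AlgEquiv.apply_symm_apply,
          Polynomial.modByMonic_add_div]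
      have h2 : r = 0 := by
        refine hker r ?_ ?_
        · rw [AlgEquiv.apply_symm_apply]
          exact Polynomial.degree_modByMonic_lt _ hFm
        · rw [RingHom.mem_ker, h1, map_add, map_mul, hF, zero_mul, add_zero] at hp
          exact hp
      exact ⟨q, by rw [h1, h2, zero_add]⟩
    · rw [Ideal.span_le, Set.singleton_subset_iff]
      exact hF
  · rintro rfl
    rw [map_zero] at hFm
    exact hFm.ne_zero rfl

variable [CharZero K] [IsAlgClosed L]

/-- Here `z = Φ 0`, the remaining `Φ` are `u`, and `u 0 = Φ 1` is the element to be inverted. The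
hypothesis `hloc` gives generation after inversion, while `hpt` provides enough points on `u 0 = 0`
to cancel the inverted element. The point `u₀` certifies that neither `h` nor `G` vanishes
identically on `u 0 = 0`. -/
theorem isHypersurfaceOfDegree_of_quadratic {k : ℕ}
    {Φ : {R : Type u} → [CommRing R] → CoordPoint R d → Fin (k + 2) → R} {w : Fin (k + 2) → ℕ}
    (hΦ : IsInvariantFamily Φ w) (S : Set (CoordPoint L d)) (hS : IsSlice K S)
    (hS0 : ∀ y ∈ S, Φ y 1 ≠ 0) (G : MvPolynomial (Fin (k + 1)) K)
    (hG : ∀ y ∈ S, Φ y 0 ^ 2 = aeval (fun i : Fin (k + 1) => Φ y i.succ) G)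
    (hloc : ∀ p ∈ invariants K d, ∃ (N : ℕ) (Q : MvPolynomial (Fin (k + 2)) K), ∀ y ∈ S,
      Φ y 1 ^ N * evalAt y p = aeval (Φ y) Q)
    (h : MvPolynomial (Fin (k + 1)) K) (u₀ : Fin (k + 1) → K) (hu₀ : u₀ 0 = 0)
    (hh : aeval u₀ h ≠ 0) (hGu₀ : aeval u₀ G ≠ 0)
    (hpt : ∀ (u : Fin (k + 1) → L) (z : L), u 0 = 0 → aeval u h ≠ 0 → z ≠ 0 → z ^ 2 = aeval u G →
      ∃ x : CoordPoint L d, Φ x = Fin.cons z u)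
    {e : ℕ} (hwe : ∀ i, w i < e) (hw0 : 2 * w 0 = e)
    (hGe : ∀ u : Fin (k + 1) → L, aeval (fun i => 2 ^ w i.succ * u i) G = 2 ^ e * aeval u G) :
    IsHypersurfaceOfDegree K d e := by
  set f := hΦ.toInvariants K with hfdef
  have hfΦ : ∀ (x : CoordPoint L d) i, evalAt x (f i : CoordRing K d) = Φ x i :=
    fun x i => hΦ.evalAt_toInvariants K x i
  have hpres : ∀ p (x : CoordPoint L d), evalAt x (presentation f p : CoordRing K d) =
      aeval (Φ x) p := by
    intro p x
    rw [← Subalgebra.coe_val, ← AlgHom.comp_apply, ← AlgHom.comp_apply, presentation, comp_aeval]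
    congr 2
    funext i
    exact hfΦ x i
  let ι := finSuccEquiv K (k + 1)
  set F : MvPolynomial (Fin (k + 2)) K := X 0 ^ 2 - rename Fin.succ G with hF
  have hιF : ι F = Polynomial.X ^ 2 - Polynomial.C G := by
    simp only [hF, map_sub, map_pow, ι, finSuccEquiv_X_zero]
    rw [finSuccEquiv_rename_succ]
  have hFm : (ι F).Monic := by rw [hιF]; exact Polynomial.monic_X_pow_sub_C G two_ne_zero
  have hFdeg : (ι F).degree = 2 := by
    rw [hιF]; exact Polynomial.degree_X_pow_sub_C two_pos G
  have hF0 : presentation f F = 0 := by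
    apply Subtype.ext
    refine hS.eq (presentation f F).2 (zero_mem _) fun y hy => ?_
    rw [hpres, hF, map_sub, map_pow, aeval_X, aeval_rename, hG y hy]
    simp [Function.comp_def]
  let ev : Polynomial (MvPolynomial (Fin (k + 1)) K) →+* CoordRing K d :=
    ((invariants K d).val.comp ((presentation f).comp (ι.symm : _ →ₐ[K] _))).toRingHom
  have hev : ∀ p, ev (ι p) = (presentation f p : CoordRing K d) := fun p => by simp [ev]
  have hevx : ∀ P (x : CoordPoint L d), evalAt x (ev P) =
      P.eval₂ (aeval fun i : Fin (k + 1) => Φ x i.succ :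
        MvPolynomial (Fin (k + 1)) K →ₐ[K] L).toRingHom (Φ x 0) := by
    intro P x
    obtain ⟨p, rfl⟩ := ι.surjective P
    rw [hev, hpres, aeval_eq_eval₂_finSuccEquiv]
  have heva : ev (Polynomial.C (X 0)) = (f 1 : CoordRing K d) := by
    have : Polynomial.C (X 0) = ι (X 1) := (finSuccEquiv_X_succ (j := 0)).symm
    rw [this, hev, presentation, aeval_X]
  have ha0 : ev (Polynomial.C (X 0)) ≠ 0 := by
    obtain ⟨y, hy⟩ := hS.nonempty
    intro h0
    apply hS0 y hy
    rw [← hfΦ, ← heva, h0, map_zero]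
  have hX : Prime (X 0 : MvPolynomial (Fin (k + 1)) K) := X_prime
  have hnd : ∀ q : MvPolynomial (Fin (k + 1)) K, aeval u₀ q ≠ 0 → ¬ X 0 ∣ q := by
    rintro q hq ⟨r, rfl⟩
    rw [map_mul, aeval_X, hu₀, zero_mul] at hq
    exact hq rfl
  have H : ∀ P, P.degree < (ι F).degree → ev (Polynomial.C (X 0)) ∣ ev P →
      Polynomial.C (X 0) ∣ P := by
    rintro P hP ⟨s, hs⟩
    rw [hFdeg] at hP
    have hP1 : P = Polynomial.C (P.coeff 1) * Polynomial.X + Polynomial.C (P.coeff 0) :=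
      Polynomial.eq_X_add_C_of_degree_le_one (Order.le_of_lt_succ hP)
    -- At such `u` both square roots `z` and `-z` of `G(u)` are attained and differ, so an
    -- expression linear in `z` that vanishes at both has zero coefficients.
    have key : ∀ u : Fin (k + 1) → L, u 0 = 0 → aeval u h ≠ 0 → aeval u G ≠ 0 →
        aeval u (P.coeff 1) = 0 ∧ aeval u (P.coeff 0) = 0 := by
      intro u hu huh huG
      obtain ⟨z, hz⟩ := IsAlgClosed.exists_pow_nat_eq (aeval u G) two_pos
      have hz0 : z ≠ 0 := by
        rintro rfl
        exact huG (by rw [← hz]; ring)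
      have h1 : ∀ z, z ≠ 0 → z ^ 2 = aeval u G →
          aeval u (P.coeff 1) * z + aeval u (P.coeff 0) = 0 := by
        intro z hz0 hz
        obtain ⟨x, hx⟩ := hpt u z hu huh hz0 hz
        have h2 := hevx P x
        have h3 : evalAt x (f 1 : CoordRing K d) = 0 := by
          rw [hfΦ, hx, show (1 : Fin (k + 2)) = Fin.succ 0 from rfl, Fin.cons_succ, hu]
        rw [hs, heva, map_mul, h3, zero_mul, hP1, hx] at h2
        simpa using h2.symm
      have h2 := h1 z hz0 hz
      have h3 := h1 (-z) (neg_ne_zero.mpr hz0) (by rw [neg_sq, hz])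
      have h4 : (2 * z) * aeval u (P.coeff 1) = 0 := by linear_combination h2 - h3
      have : CharZero L := charZero_of_injective_algebraMap (algebraMap K L).injective
      have h5 := (mul_eq_zero.mp h4).resolve_left (mul_ne_zero two_ne_zero hz0)
      refine ⟨h5, ?_⟩
      rw [h5, zero_mul, zero_add] at h2
      exact h2
    -- The restriction to `h ≠ 0` and `G ≠ 0` is absorbed by multiplying with `h * G`; the prime `X
    -- 0` divides neither factor.
    have hdvd : ∀ q : MvPolynomial (Fin (k + 1)) K, (∀ u : Fin (k + 1) → L, u 0 = 0 →
        aeval u h ≠ 0 → aeval u G ≠ 0 → aeval u q = 0) → X 0 ∣ q := by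
      intro q hq
      have : X 0 ∣ q * h * G := by
        refine X_dvd_of_forall_aeval (L := L) fun u hu => ?_
        rw [map_mul, map_mul]
        by_cases h1 : aeval u h = 0
        · rw [h1, mul_zero, zero_mul]
        by_cases h2 : aeval u G = 0
        · rw [h2, mul_zero]
        rw [hq u hu h1 h2, zero_mul, zero_mul]
      rcases hX.dvd_or_dvd this with h1 | h1
      · exact (hX.dvd_or_dvd h1).resolve_right (hnd h hh)
      · exact absurd h1 (hnd G hGu₀)
    rw [hP1]
    exact dvd_add (dvd_mul_of_dvd_left (map_dvd Polynomial.C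
      (hdvd _ fun u h1 h2 h3 => (key u h1 h2 h3).1)) _) (map_dvd Polynomial.C
      (hdvd _ fun u h1 h2 h3 => (key u h1 h2 h3).2))
  refine isHypersurfaceOfDegree_of_monic f w (fun i => hΦ.isHomogeneous K i) F hFm hF0 ?_
    (Nat.zero_lt_of_lt (hwe 0)) hwe ?_ ?_
  · refine isWeightedHomogeneous_of_scaling (L := L) w e F fun x => ?_
    rw [hF, map_sub, map_sub, map_pow, map_pow, aeval_X, aeval_X, aeval_rename, aeval_rename]
    have := hGe (x ∘ Fin.succ)
    rw [mul_sub, ← this, mul_pow, ← pow_mul, mul_comm (w 0), hw0]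
    rfl
  · rintro ⟨p, hp⟩
    obtain ⟨N, Q, hQ⟩ := hloc p hp
    -- The formula for `p` with denominator holds on the slice, hence identically.
    have h1 : (f 1 : CoordRing K d) ^ N * p = (presentation f Q : CoordRing K d) := by
      refine hS.eq (mul_mem (pow_mem (f 1).2 N) hp) (presentation f Q).2 fun y hy => ?_
      rw [map_mul, map_pow, hfΦ, hpres, hQ y hy]
    rw [← heva, ← hev] at h1
    obtain ⟨P, hP⟩ := exists_of_descent ev hFm (by rw [hev, hF0]; rfl) ha0 H N _ h1
    obtain ⟨q, rfl⟩ := ι.surjective P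
    refine ⟨q, Subtype.ext ?_⟩
    rw [← hev, hP]
  · intro p hp hp0
    apply ι.injective
    rw [map_zero]
    exact eq_zero_of_descent ev hX.not_isUnit ha0 H hp (by rw [hev, hp0]; rfl)

end Quadratic

/-! ### Covariants of binary forms of small degree -/

section Covariants

variable {R S : Type*} [CommRing R] [CommRing S]

theorem shear_one (t : R) (l : Fin 2 → R) : shear 1 t l = ![l 0, l 1 + t * l 0] := by
  ext j; fin_cases j <;> simp [shear, Fin.sum_univ_succ]; ring

theorem shear_two (t : R) (q : Fin 3 → R) :
    shear 2 t q = ![q 0, q 1 + 2 * t * q 0, q 2 + t * q 1 + t ^ 2 * q 0] := by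
  ext j; fin_cases j <;> simp [shear, Fin.sum_univ_succ] <;> ring

theorem shear_three (t : R) (f : Fin 4 → R) :
    shear 3 t f = ![f 0, f 1 + 3 * t * f 0, f 2 + 2 * t * f 1 + 3 * t ^ 2 * f 0,
      f 3 + t * f 2 + t ^ 2 * f 1 + t ^ 3 * f 0] := by
  ext j
  fin_cases j <;> simp [shear, Fin.sum_univ_succ, Nat.choose] <;> ring

theorem shear_four (t : R) (f : Fin 5 → R) :
    shear 4 t f = ![f 0, f 1 + 4 * t * f 0, f 2 + 3 * t * f 1 + 6 * t ^ 2 * f 0,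
      f 3 + 2 * t * f 2 + 3 * t ^ 2 * f 1 + 4 * t ^ 3 * f 0,
      f 4 + t * f 3 + t ^ 2 * f 2 + t ^ 3 * f 1 + t ^ 4 * f 0] := by
  ext j
  fin_cases j <;> simp [shear, Fin.sum_univ_succ, Nat.choose] <;> ring

theorem flip_one (l : Fin 2 → R) : flip 1 l = ![- l 1, l 0] := by
  ext j; fin_cases j <;> simp [flip]

theorem flip_two (q : Fin 3 → R) : flip 2 q = ![q 2, - q 1, q 0] := by
  ext j; fin_cases j <;> simp [flip, Fin.rev]

theorem flip_three (f : Fin 4 → R) : flip 3 f = ![- f 3, f 2, - f 1, f 0] := by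
  ext j; fin_cases j <;> simp [flip, Fin.rev, pow_succ]

theorem flip_four (f : Fin 5 → R) : flip 4 f = ![f 4, - f 3, f 2, - f 1, f 0] := by
  ext j; fin_cases j <;> simp [flip, Fin.rev, pow_succ]

/-- The bracket of two linear forms. -/
def bracket (l m : Fin 2 → R) : R := l 0 * m 1 - l 1 * m 0

/-- The value of a quadratic form at the zero `(l₁, -l₀)` of a linear form. -/
def evalQuadratic (q : Fin 3 → R) (l : Fin 2 → R) : R :=
  q 0 * l 1 ^ 2 - q 1 * l 1 * l 0 + q 2 * l 0 ^ 2

/-- The value of a cubic form at the zero of a linear form. -/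
def evalCubic (f : Fin 4 → R) (l : Fin 2 → R) : R :=
  f 0 * l 1 ^ 3 - f 1 * l 1 ^ 2 * l 0 + f 2 * l 1 * l 0 ^ 2 - f 3 * l 0 ^ 3

/-- The value of a quartic form at the zero of a linear form. -/
def evalQuartic (f : Fin 5 → R) (l : Fin 2 → R) : R :=
  f 0 * l 1 ^ 4 - f 1 * l 1 ^ 3 * l 0 + f 2 * l 1 ^ 2 * l 0 ^ 2 - f 3 * l 1 * l 0 ^ 3 + f 4 * l 0 ^ 4

/-- The gradient of a quadratic form at the zero of a linear form. -/
def gradQuadratic (q : Fin 3 → R) (l : Fin 2 → R) : Fin 2 → R :=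
  ![2 * q 0 * l 1 - q 1 * l 0, q 1 * l 1 - 2 * q 2 * l 0]

/-- The gradient of a cubic form at the zero of a linear form. -/
def gradCubic (f : Fin 4 → R) (l : Fin 2 → R) : Fin 2 → R :=
  ![3 * f 0 * l 1 ^ 2 - 2 * f 1 * l 1 * l 0 + f 2 * l 0 ^ 2,
    f 1 * l 1 ^ 2 - 2 * f 2 * l 1 * l 0 + 3 * f 3 * l 0 ^ 2]

/-- The gradient of a quartic form at the zero of a linear form. -/
def gradQuartic (f : Fin 5 → R) (l : Fin 2 → R) : Fin 2 → R :=
  ![4 * f 0 * l 1 ^ 3 - 3 * f 1 * l 1 ^ 2 * l 0 + 2 * f 2 * l 1 * l 0 ^ 2 - f 3 * l 0 ^ 3,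
    f 1 * l 1 ^ 3 - 2 * f 2 * l 1 ^ 2 * l 0 + 3 * f 3 * l 1 * l 0 ^ 2 - 4 * f 4 * l 0 ^ 3]

/-- The polarization of the discriminant of quadratic forms. -/
def polarDisc (q r : Fin 3 → R) : R := q 1 * r 1 - 2 * q 0 * r 2 - 2 * q 2 * r 0

/-- Half the Jacobian of two quadratic forms. -/
def jacobian (q r : Fin 3 → R) : Fin 3 → R :=
  ![q 0 * r 1 - q 1 * r 0, 2 * (q 0 * r 2 - q 2 * r 0), q 1 * r 2 - q 2 * r 1]

/-- A quarter of the Hessian of a cubic form. -/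
def hessianCubic (f : Fin 4 → R) : Fin 3 → R :=
  ![3 * f 0 * f 2 - f 1 ^ 2, 9 * f 0 * f 3 - f 1 * f 2, 3 * f 1 * f 3 - f 2 ^ 2]

/-- The second transvectant of a cubic and a quadratic form, up to a factor. -/
def transvectCubic (f : Fin 4 → R) (q : Fin 3 → R) : Fin 2 → R :=
  ![3 * f 0 * q 2 - f 1 * q 1 + f 2 * q 0, f 1 * q 2 - f 2 * q 1 + 3 * f 3 * q 0]

/-- The second transvectant of a quartic and a quadratic form, up to a factor. -/
def transvectQuartic (f : Fin 5 → R) (q : Fin 3 → R) : Fin 3 → R :=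
  ![12 * f 0 * q 2 - 3 * f 1 * q 1 + 2 * f 2 * q 0, 6 * f 1 * q 2 - 4 * f 2 * q 1 + 6 * f 3 * q 0,
    2 * f 2 * q 2 - 3 * f 3 * q 1 + 12 * f 4 * q 0]

/-- A third of the Hessian of a quartic form. -/
def hessianQuartic (f : Fin 5 → R) : Fin 5 → R :=
  ![8 * f 0 * f 2 - 3 * f 1 ^ 2, 24 * f 0 * f 3 - 4 * f 1 * f 2,
    48 * f 0 * f 4 + 6 * f 1 * f 3 - 4 * f 2 ^ 2, 24 * f 1 * f 4 - 4 * f 2 * f 3,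
    8 * f 2 * f 4 - 3 * f 3 ^ 2]

/-- The quadratic invariant of a quartic form. -/
def quarticI (f : Fin 5 → R) : R := 12 * f 0 * f 4 - 3 * f 1 * f 3 + f 2 ^ 2

/-- The cubic invariant of a quartic form. -/
def quarticJ (f : Fin 5 → R) : R :=
  72 * f 0 * f 2 * f 4 + 9 * f 1 * f 2 * f 3 - 27 * f 0 * f 3 ^ 2 - 27 * f 4 * f 1 ^ 2 - 2 * f 2 ^ 3

/-- The polarization of the quadratic invariant of quartic forms. -/
def polarQuartic (f g : Fin 5 → R) : R :=
  12 * (f 0 * g 4 + f 4 * g 0) - 3 * (f 1 * g 3 + f 3 * g 1) + 2 * f 2 * g 2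

variable (t : R) (l m : Fin 2 → R) (q r : Fin 3 → R) (f : Fin 4 → R) (g g' : Fin 5 → R)

theorem bracket_shear : bracket (shear 1 t l) (shear 1 t m) = bracket l m := by
  simp [shear_one, bracket]; ring

theorem bracket_flip : bracket (flip 1 l) (flip 1 m) = bracket l m := by
  simp [flip_one, bracket]; ring

theorem evalQuadratic_shear :
    evalQuadratic (shear 2 t q) (shear 1 t l) = evalQuadratic q l := by
  simp [shear_one, shear_two, evalQuadratic]; ring

theorem evalQuadratic_flip : evalQuadratic (flip 2 q) (flip 1 l) = evalQuadratic q l := by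
  simp [flip_one, flip_two, evalQuadratic]; ring

theorem evalCubic_shear : evalCubic (shear 3 t f) (shear 1 t l) = evalCubic f l := by
  simp [shear_one, shear_three, evalCubic]; ring

theorem evalCubic_flip : evalCubic (flip 3 f) (flip 1 l) = evalCubic f l := by
  simp [flip_one, flip_three, evalCubic]; ring

theorem evalQuartic_shear : evalQuartic (shear 4 t g) (shear 1 t l) = evalQuartic g l := by
  simp [shear_one, shear_four, evalQuartic]; ring

theorem evalQuartic_flip : evalQuartic (flip 4 g) (flip 1 l) = evalQuartic g l := by
  simp [flip_one, flip_four, evalQuartic]; ring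

theorem gradQuadratic_shear :
    gradQuadratic (shear 2 t q) (shear 1 t l) = shear 1 t (gradQuadratic q l) := by
  ext j; fin_cases j <;> simp [shear_one, shear_two, gradQuadratic] <;> ring

theorem gradQuadratic_flip :
    gradQuadratic (flip 2 q) (flip 1 l) = flip 1 (gradQuadratic q l) := by
  ext j; fin_cases j <;> simp [flip_one, flip_two, gradQuadratic]; ring

theorem gradCubic_shear :
    gradCubic (shear 3 t f) (shear 1 t l) = shear 1 t (gradCubic f l) := by
  ext j; fin_cases j <;> simp [shear_one, shear_three, gradCubic] <;> ring

theorem gradCubic_flip : gradCubic (flip 3 f) (flip 1 l) = flip 1 (gradCubic f l) := by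
  ext j; fin_cases j <;> simp [flip_one, flip_three, gradCubic] <;> ring

theorem gradQuartic_shear :
    gradQuartic (shear 4 t g) (shear 1 t l) = shear 1 t (gradQuartic g l) := by
  ext j; fin_cases j <;> simp [shear_one, shear_four, gradQuartic] <;> ring

theorem gradQuartic_flip : gradQuartic (flip 4 g) (flip 1 l) = flip 1 (gradQuartic g l) := by
  ext j; fin_cases j <;> simp [flip_one, flip_four, gradQuartic] <;> ring

theorem polarDisc_shear : polarDisc (shear 2 t q) (shear 2 t r) = polarDisc q r := by
  simp [shear_two, polarDisc]; ring

theorem polarDisc_flip : polarDisc (flip 2 q) (flip 2 r) = polarDisc q r := by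
  simp [flip_two, polarDisc]; ring

theorem jacobian_shear : jacobian (shear 2 t q) (shear 2 t r) = shear 2 t (jacobian q r) := by
  ext j; fin_cases j <;> simp [shear_two, jacobian] <;> ring

theorem jacobian_flip : jacobian (flip 2 q) (flip 2 r) = flip 2 (jacobian q r) := by
  ext j; fin_cases j <;> simp [flip_two, jacobian] <;> ring

theorem hessianCubic_shear : hessianCubic (shear 3 t f) = shear 2 t (hessianCubic f) := by
  ext j; fin_cases j <;> simp [shear_two, shear_three, hessianCubic] <;> ring

theorem hessianCubic_flip : hessianCubic (flip 3 f) = flip 2 (hessianCubic f) := by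
  ext j; fin_cases j <;> simp [flip_two, flip_three, hessianCubic] <;> ring

theorem transvectCubic_shear :
    transvectCubic (shear 3 t f) (shear 2 t q) = shear 1 t (transvectCubic f q) := by
  ext j; fin_cases j <;> simp [shear_one, shear_two, shear_three, transvectCubic] <;> ring

theorem transvectCubic_flip :
    transvectCubic (flip 3 f) (flip 2 q) = flip 1 (transvectCubic f q) := by
  ext j; fin_cases j <;> simp [flip_one, flip_two, flip_three, transvectCubic] <;> ring

theorem transvectQuartic_shear :
    transvectQuartic (shear 4 t g) (shear 2 t q) = shear 2 t (transvectQuartic g q) := by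
  ext j; fin_cases j <;> simp [shear_two, shear_four, transvectQuartic] <;> ring

theorem transvectQuartic_flip :
    transvectQuartic (flip 4 g) (flip 2 q) = flip 2 (transvectQuartic g q) := by
  ext j; fin_cases j <;> simp [flip_two, flip_four, transvectQuartic] <;> ring

theorem hessianQuartic_shear : hessianQuartic (shear 4 t g) = shear 4 t (hessianQuartic g) := by
  ext j; fin_cases j <;> simp [shear_four, hessianQuartic] <;> ring

theorem hessianQuartic_flip : hessianQuartic (flip 4 g) = flip 4 (hessianQuartic g) := by
  ext j; fin_cases j <;> simp [flip_four, hessianQuartic] <;> ring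

theorem quarticI_shear : quarticI (shear 4 t g) = quarticI g := by
  simp [shear_four, quarticI]; ring

theorem quarticI_flip : quarticI (flip 4 g) = quarticI g := by
  simp [flip_four, quarticI]; ring

theorem quarticJ_shear : quarticJ (shear 4 t g) = quarticJ g := by
  simp [shear_four, quarticJ]; ring

theorem quarticJ_flip : quarticJ (flip 4 g) = quarticJ g := by
  simp [flip_four, quarticJ]; ring

theorem polarQuartic_shear : polarQuartic (shear 4 t g) (shear 4 t g') = polarQuartic g g' := by
  simp [shear_four, polarQuartic]; ring

theorem polarQuartic_flip : polarQuartic (flip 4 g) (flip 4 g') = polarQuartic g g' := by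
  simp [flip_four, polarQuartic]; ring

end Covariants

/-! ### Coordinate vectors with few components, and moves -/

section Moves

/-- The coordinate vector of a pair of forms. -/
def point₂ {R : Type*} {e₀ e₁ : ℕ} (a : Fin (e₀ + 1) → R) (b : Fin (e₁ + 1) → R) :
    CoordPoint R ![e₀, e₁] :=
  Fin.cons a (Fin.cons b finZeroElim)

/-- The coordinate vector of a triple of forms. -/
def point₃ {R : Type*} {e₀ e₁ e₂ : ℕ} (a : Fin (e₀ + 1) → R) (b : Fin (e₁ + 1) → R)
    (c : Fin (e₂ + 1) → R) : CoordPoint R ![e₀, e₁, e₂] :=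
  Fin.cons a (Fin.cons b (Fin.cons c finZeroElim))

/-- The coordinate vector of a quadruple of forms. -/
def point₄ {R : Type*} {e₀ e₁ e₂ e₃ : ℕ} (a : Fin (e₀ + 1) → R) (b : Fin (e₁ + 1) → R)
    (c : Fin (e₂ + 1) → R) (d : Fin (e₃ + 1) → R) : CoordPoint R ![e₀, e₁, e₂, e₃] :=
  Fin.cons a (Fin.cons b (Fin.cons c (Fin.cons d finZeroElim)))

variable (K : Type u) [Field K] {L : Type u} [Field L] [Algebra K L]

/-- A simultaneous transformation of forms of all degrees that does not change invariants, and
preserves the eigenvectors of the transvection with a quartic form. -/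
structure IsMove (τ : (e : ℕ) → (Fin (e + 1) → L) → Fin (e + 1) → L) : Prop where
  sameInvariants : ∀ {n : ℕ} {d : Fin n → ℕ} (x : CoordPoint L d),
    SameInvariants K x fun i => τ (d i) (x i)
  transvectQuartic_eq : ∀ {f : Fin 5 → L} {q : Fin 3 → L} {k : L},
    transvectQuartic f q = k • q → transvectQuartic (τ 4 f) (τ 2 q) = k • τ 2 q

variable {K}

theorem IsMove.comp {τ τ' : (e : ℕ) → (Fin (e + 1) → L) → Fin (e + 1) → L} (h : IsMove K τ)
    (h' : IsMove K τ') : IsMove K fun e a => τ e (τ' e a) :=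
  ⟨fun x => (h'.sameInvariants x).trans (h.sameInvariants _),
    fun hq => h.transvectQuartic_eq (h'.transvectQuartic_eq hq)⟩

variable [Infinite K]

theorem isMove_shear (t : L) : IsMove K fun e => shear e t :=
  ⟨sameInvariants_shear t, fun {f q k} hq => by
    rw [transvectQuartic_shear, hq]
    ext j; fin_cases j <;> simp [shear_two] <;> ring⟩

theorem isMove_flip : IsMove K (L := L) flip :=
  ⟨sameInvariants_flip, fun {f q k} hq => by
    rw [transvectQuartic_flip, hq]
    ext j; fin_cases j <;> simp [flip_two]⟩

theorem torus_two (s : L) (q : Fin 3 → L) : torus 2 s q = ![s ^ 2 * q 0, s * s⁻¹ * q 1, s⁻¹ ^ 2 * q 2] := by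
  ext j; fin_cases j <;> simp [torus]

theorem torus_four (s : L) (f : Fin 5 → L) : torus 4 s f =
    ![s ^ 4 * f 0, s ^ 3 * s⁻¹ * f 1, s ^ 2 * s⁻¹ ^ 2 * f 2, s * s⁻¹ ^ 3 * f 3, s⁻¹ ^ 4 * f 4] := by
  ext j; fin_cases j <;> simp [torus]

theorem isMove_torus {s : L} (hs : s ≠ 0) : IsMove K fun e => torus e s :=
  ⟨sameInvariants_torus hs, fun {f q k} hq => by
    have h0 := congrFun hq 0
    have h1 := congrFun hq 1
    have h2 := congrFun hq 2
    simp [transvectQuartic] at h0 h1 h2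
    ext j; fin_cases j <;> simp [torus_two, torus_four, transvectQuartic] <;> field_simp
    · linear_combination h0
    · linear_combination h1
    · linear_combination h2⟩

theorem torus_one (s : L) (l : Fin 2 → L) : torus 1 s l = ![s * l 0, s⁻¹ * l 1] := by
  ext j; fin_cases j <;> simp [torus]

/-- A shear turns `l` into a multiple of `x`, the flip into the same multiple of `y`, and the torus
removes the scalar. -/
theorem exists_isMove_linear {l : Fin 2 → L} (hl : l 0 ≠ 0) :
    ∃ τ, IsMove K τ ∧ τ 1 l = ![0, 1] := by
  refine ⟨_, ((isMove_torus hl).comp isMove_flip).comp (isMove_shear (-l 1 / l 0)), ?_⟩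
  simp [torus_one, flip_one, shear_one, hl]

/-- Nonzero discriminant means two distinct roots, which can be moved to the two coordinate points.
-/
theorem exists_isMove_quadratic [IsAlgClosed L] [CharZero L] {q : Fin 3 → L}
    (hq : polarDisc q q ≠ 0) : ∃ τ t, IsMove K τ ∧ t ≠ 0 ∧ τ 2 q = ![0, t, 0] := by
  obtain ⟨τ, r, hτ, hr2, hr1, hr⟩ : ∃ τ, ∃ r : Fin 3 → L, IsMove K τ ∧ r 2 = 0 ∧
      polarDisc r r ≠ 0 ∧ τ 2 q = r := by
    by_cases h0 : q 0 = 0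
    · exact ⟨flip, _, isMove_flip, by simp [flip_two, h0], by rwa [polarDisc_flip], rfl⟩
    -- The shear parameter is a root of `q 0 * t ^ 2 + q 1 * t + q 2`, by the quadratic formula.
    · obtain ⟨w, hw⟩ := IsAlgClosed.exists_pow_nat_eq (polarDisc q q) two_pos
      refine ⟨_, _, isMove_shear ((w - q 1) / (2 * q 0)), ?_, by rwa [polarDisc_shear], rfl⟩
      simp only [shear_two, Matrix.cons_val]
      field_simp
      rw [polarDisc] at hw
      linear_combination hw
  have h1 : r 1 ≠ 0 := by
    intro h1
    apply hr1
    rw [polarDisc, h1, hr2]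
    ring
  refine ⟨_, - r 1, ((isMove_shear (r 0 / r 1)).comp isMove_flip).comp hτ, neg_ne_zero.mpr h1, ?_⟩
  ext j
  fin_cases j <;> simp [hr, flip_two, shear_two, hr2]
  field_simp
  ring

/-- A nonzero quadratic form with zero discriminant has a double root, and is moved to a multiple of
`y²`. -/
theorem exists_isMove_of_polarDisc_eq_zero [CharZero L] {q : Fin 3 → L} (hq : polarDisc q q = 0)
    (hq0 : q ≠ 0) : ∃ τ t, IsMove K τ ∧ t ≠ 0 ∧ τ 2 q = ![0, 0, t] := by
  rw [polarDisc] at hq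
  by_cases h0 : q 0 = 0
  · have h1 : q 1 = 0 := by
      rw [h0] at hq
      simpa using hq
    refine ⟨_, q 2, isMove_shear 0, fun h2 => hq0 ?_, ?_⟩
    · ext j; fin_cases j <;> simp [h0, h1, h2]
    · ext j; fin_cases j <;> simp [shear_two, h0, h1]
  · refine ⟨_, q 0, isMove_flip.comp (isMove_shear (- q 1 / (2 * q 0))), h0, ?_⟩
    ext j; fin_cases j <;> simp [shear_two, flip_two] <;> field_simp
    · linear_combination - hq
    · ring

end Moves

/-! ### Families and moves for pairs, triples and quadruples. -/

section Tuples

variable {e₀ e₁ e₂ e₃ m : ℕ}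

theorem exists_eq_point₂ {R : Type*} (x : CoordPoint R ![e₀, e₁]) : ∃ a b, x = point₂ a b :=
  ⟨x 0, x 1, by funext i; fin_cases i <;> rfl⟩

theorem exists_eq_point₃ {R : Type*} (x : CoordPoint R ![e₀, e₁, e₂]) :
    ∃ a b c, x = point₃ a b c :=
  ⟨x 0, x 1, x 2, by funext i; fin_cases i <;> rfl⟩

theorem exists_eq_point₄ {R : Type*} (x : CoordPoint R ![e₀, e₁, e₂, e₃]) :
    ∃ a b c d, x = point₄ a b c d :=
  ⟨x 0, x 1, x 2, x 3, by funext i; fin_cases i <;> rfl⟩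

theorem IsInvariantFamily.of_pair
    {Ψ : {R : Type u} → [CommRing R] → (Fin (e₀ + 1) → R) → (Fin (e₁ + 1) → R) → Fin m → R}
    {w : Fin m → ℕ}
    (map : ∀ {R S : Type u} [CommRing R] [CommRing S] (φ : R →+* S) (a : Fin (e₀ + 1) → R)
      (b : Fin (e₁ + 1) → R) (i : Fin m),
      φ (Ψ a b i) = Ψ (fun j => φ (a j)) (fun j => φ (b j)) i)
    (hshear : ∀ {R : Type u} [CommRing R] (t : R) (a : Fin (e₀ + 1) → R) (b : Fin (e₁ + 1) → R),
      Ψ (shear e₀ t a) (shear e₁ t b) = Ψ a b)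
    (hflip : ∀ {R : Type u} [CommRing R] (a : Fin (e₀ + 1) → R) (b : Fin (e₁ + 1) → R),
      Ψ (flip e₀ a) (flip e₁ b) = Ψ a b)
    (smul : ∀ {R : Type u} [CommRing R] (s : R) (a : Fin (e₀ + 1) → R) (b : Fin (e₁ + 1) → R)
      (i : Fin m), Ψ (fun j => s * a j) (fun j => s * b j) i = s ^ w i * Ψ a b i) :
    IsInvariantFamily (d := ![e₀, e₁]) (fun {R} [CommRing R] x => Ψ (x 0) (x 1)) w where
  map_eq φ x i := map φ (x 0) (x 1) i
  shear_eq t x i := congrFun (hshear t (x 0) (x 1)) i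
  flip_eq x i := congrFun (hflip (x 0) (x 1)) i
  smul_eq s x i := smul s (x 0) (x 1) i

theorem IsInvariantFamily.of_triple
    {Ψ : {R : Type u} → [CommRing R] → (Fin (e₀ + 1) → R) → (Fin (e₁ + 1) → R) →
      (Fin (e₂ + 1) → R) → Fin m → R} {w : Fin m → ℕ}
    (map : ∀ {R S : Type u} [CommRing R] [CommRing S] (φ : R →+* S) (a : Fin (e₀ + 1) → R)
      (b : Fin (e₁ + 1) → R) (c : Fin (e₂ + 1) → R) (i : Fin m),
      φ (Ψ a b c i) = Ψ (fun j => φ (a j)) (fun j => φ (b j)) (fun j => φ (c j)) i)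
    (hshear : ∀ {R : Type u} [CommRing R] (t : R) (a : Fin (e₀ + 1) → R) (b : Fin (e₁ + 1) → R)
      (c : Fin (e₂ + 1) → R), Ψ (shear e₀ t a) (shear e₁ t b) (shear e₂ t c) = Ψ a b c)
    (hflip : ∀ {R : Type u} [CommRing R] (a : Fin (e₀ + 1) → R) (b : Fin (e₁ + 1) → R)
      (c : Fin (e₂ + 1) → R), Ψ (flip e₀ a) (flip e₁ b) (flip e₂ c) = Ψ a b c)
    (smul : ∀ {R : Type u} [CommRing R] (s : R) (a : Fin (e₀ + 1) → R) (b : Fin (e₁ + 1) → R)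
      (c : Fin (e₂ + 1) → R) (i : Fin m),
      Ψ (fun j => s * a j) (fun j => s * b j) (fun j => s * c j) i = s ^ w i * Ψ a b c i) :
    IsInvariantFamily (d := ![e₀, e₁, e₂]) (fun {R} [CommRing R] x => Ψ (x 0) (x 1) (x 2)) w where
  map_eq φ x i := map φ (x 0) (x 1) (x 2) i
  shear_eq t x i := congrFun (hshear t (x 0) (x 1) (x 2)) i
  flip_eq x i := congrFun (hflip (x 0) (x 1) (x 2)) i
  smul_eq s x i := smul s (x 0) (x 1) (x 2) i

theorem IsInvariantFamily.of_quadruple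
    {Ψ : {R : Type u} → [CommRing R] → (Fin (e₀ + 1) → R) → (Fin (e₁ + 1) → R) →
      (Fin (e₂ + 1) → R) → (Fin (e₃ + 1) → R) → Fin m → R} {w : Fin m → ℕ}
    (map : ∀ {R S : Type u} [CommRing R] [CommRing S] (φ : R →+* S) (a : Fin (e₀ + 1) → R)
      (b : Fin (e₁ + 1) → R) (c : Fin (e₂ + 1) → R) (d : Fin (e₃ + 1) → R) (i : Fin m),
      φ (Ψ a b c d i) =
        Ψ (fun j => φ (a j)) (fun j => φ (b j)) (fun j => φ (c j)) (fun j => φ (d j)) i)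
    (hshear : ∀ {R : Type u} [CommRing R] (t : R) (a : Fin (e₀ + 1) → R) (b : Fin (e₁ + 1) → R)
      (c : Fin (e₂ + 1) → R) (d : Fin (e₃ + 1) → R),
      Ψ (shear e₀ t a) (shear e₁ t b) (shear e₂ t c) (shear e₃ t d) = Ψ a b c d)
    (hflip : ∀ {R : Type u} [CommRing R] (a : Fin (e₀ + 1) → R) (b : Fin (e₁ + 1) → R)
      (c : Fin (e₂ + 1) → R) (d : Fin (e₃ + 1) → R),
      Ψ (flip e₀ a) (flip e₁ b) (flip e₂ c) (flip e₃ d) = Ψ a b c d)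
    (smul : ∀ {R : Type u} [CommRing R] (s : R) (a : Fin (e₀ + 1) → R) (b : Fin (e₁ + 1) → R)
      (c : Fin (e₂ + 1) → R) (d : Fin (e₃ + 1) → R) (i : Fin m),
      Ψ (fun j => s * a j) (fun j => s * b j) (fun j => s * c j) (fun j => s * d j) i =
        s ^ w i * Ψ a b c d i) :
    IsInvariantFamily (d := ![e₀, e₁, e₂, e₃])
      (fun {R} [CommRing R] x => Ψ (x 0) (x 1) (x 2) (x 3)) w where
  map_eq φ x i := map φ (x 0) (x 1) (x 2) (x 3) i
  shear_eq t x i := congrFun (hshear t (x 0) (x 1) (x 2) (x 3)) i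
  flip_eq x i := congrFun (hflip (x 0) (x 1) (x 2) (x 3)) i
  smul_eq s x i := smul s (x 0) (x 1) (x 2) (x 3) i

variable {K : Type u} [Field K] {L : Type u} [Field L] [Algebra K L]

theorem IsMove.pair {τ : (e : ℕ) → (Fin (e + 1) → L) → Fin (e + 1) → L} (h : IsMove K τ)
    (a : Fin (e₀ + 1) → L) (b : Fin (e₁ + 1) → L) :
    SameInvariants K (point₂ a b) (point₂ (τ e₀ a) (τ e₁ b)) := by
  convert h.sameInvariants (point₂ a b) using 1
  funext i; fin_cases i <;> rfl

theorem IsMove.triple {τ : (e : ℕ) → (Fin (e + 1) → L) → Fin (e + 1) → L} (h : IsMove K τ)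
    (a : Fin (e₀ + 1) → L) (b : Fin (e₁ + 1) → L) (c : Fin (e₂ + 1) → L) :
    SameInvariants K (point₃ a b c) (point₃ (τ e₀ a) (τ e₁ b) (τ e₂ c)) := by
  convert h.sameInvariants (point₃ a b c) using 1
  funext i; fin_cases i <;> rfl

theorem IsMove.quadruple {τ : (e : ℕ) → (Fin (e + 1) → L) → Fin (e + 1) → L} (h : IsMove K τ)
    (a : Fin (e₀ + 1) → L) (b : Fin (e₁ + 1) → L) (c : Fin (e₂ + 1) → L) (d : Fin (e₃ + 1) → L) :
    SameInvariants K (point₄ a b c d) (point₄ (τ e₀ a) (τ e₁ b) (τ e₂ c) (τ e₃ d)) := by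
  convert h.sameInvariants (point₄ a b c d) using 1
  funext i; fin_cases i <;> rfl

end Tuples

/-! ### Functions which become polynomials in the invariants after multiplication by a power -/

section Localized

variable {K L : Type*} [Field K] [Field L] [Algebra K L] {Y : Type*} {m : ℕ}

/-- Functions `g` on `S` such that `a ^ N * g` is a polynomial in the functions `Φ`. -/
def localized (S : Set Y) (Φ : Y → Fin m → L) (a : MvPolynomial (Fin m) K) :
    Subalgebra K (Y → L) where
  carrier := {g | ∃ (N : ℕ) (Q : MvPolynomial (Fin m) K), ∀ y ∈ S,
    aeval (Φ y) a ^ N * g y = aeval (Φ y) Q}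
  mul_mem' := by
    rintro g g' ⟨N, Q, h⟩ ⟨N', Q', h'⟩
    refine ⟨N + N', Q * Q', fun y hy => ?_⟩
    rw [map_mul, ← h y hy, ← h' y hy, Pi.mul_apply]
    ring
  add_mem' := by
    rintro g g' ⟨N, Q, h⟩ ⟨N', Q', h'⟩
    refine ⟨N + N', a ^ N' * Q + a ^ N * Q', fun y hy => ?_⟩
    rw [map_add, map_mul, map_mul, map_pow, map_pow, ← h y hy, ← h' y hy, Pi.add_apply]
    ring
  algebraMap_mem' r := ⟨0, C r, fun y _ => by simp⟩

variable {S : Set Y} {Φ : Y → Fin m → L} {a : MvPolynomial (Fin m) K}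

theorem apply_mem_localized (i : Fin m) : (fun y => Φ y i) ∈ localized S Φ a :=
  ⟨0, X i, fun y _ => by rw [pow_zero, one_mul, aeval_X]⟩

theorem mem_localized_of_mul {g g' : Y → L} (N : ℕ) (hg' : g' ∈ localized S Φ a)
    (h : ∀ y ∈ S, aeval (Φ y) a ^ N * g y = g' y) : g ∈ localized S Φ a := by
  obtain ⟨N', Q, hQ⟩ := hg'
  refine ⟨N' + N, Q, fun y hy => ?_⟩
  rw [← hQ y hy, ← h y hy, pow_add, mul_assoc]

theorem mem_localized_of_eq {g g' : Y → L} (hg' : g' ∈ localized S Φ a)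
    (h : ∀ y ∈ S, g y = g' y) : g ∈ localized S Φ a :=
  mem_localized_of_mul 0 hg' fun y hy => by rw [pow_zero, one_mul, h y hy]

theorem mem_localized {g : Y → L} (N : ℕ) (Q : MvPolynomial (Fin m) K)
    (h : ∀ y ∈ S, aeval (Φ y) a ^ N * g y = aeval (Φ y) Q) : g ∈ localized S Φ a :=
  ⟨N, Q, h⟩

theorem aeval_mem_of_forall_mem (B : Subalgebra K (Y → L)) {σ : Type*} {v : Y → σ → L}
    (h : ∀ i, (fun y => v y i) ∈ B) (p : MvPolynomial σ K) : (fun y => aeval (v y) p) ∈ B := by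
  have : (fun y => aeval (v y) p) = aeval (fun i y => v y i) p := by
    funext y
    have : aeval (v y) = (Pi.evalAlgHom K (fun _ : Y => L) y).comp (aeval fun i y => v y i) := by
      ext i; simp
    rw [this]
    rfl
  rw [this]
  have h1 : aeval (fun i y => v y i) p ∈ (aeval (R := K) fun i y => v y i).range := ⟨p, rfl⟩
  rw [← Algebra.adjoin_range_eq_range_aeval] at h1
  refine Algebra.adjoin_le ?_ h1
  rintro _ ⟨i, rfl⟩
  exact h i

/-- The functions with such denominators form an algebra, so only the coordinate functions need
checking. This is enough when every coordinate of the slice is itself rational in the invariants. -/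
theorem exists_of_forall_mem_localized {n : ℕ} {d : Fin n → ℕ} {S : Set (CoordPoint L d)}
    {Φ : CoordPoint L d → Fin m → L} {i : Fin m}
    (h : ∀ c : CoordIdx d, (fun y : CoordPoint L d => y c.1 c.2) ∈
      localized (K := K) S Φ (X i)) (p : CoordRing K d) :
    ∃ (N : ℕ) (Q : MvPolynomial (Fin m) K), ∀ y ∈ S, Φ y i ^ N * evalAt y p = aeval (Φ y) Q := by
  obtain ⟨N, Q, hQ⟩ := aeval_mem_of_forall_mem (localized (K := K) S Φ (X i))
    (v := fun (y : CoordPoint L d) (c : CoordIdx d) => y c.1 c.2) h p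
  refine ⟨N, Q, fun y hy => ?_⟩
  rw [← hQ y hy, aeval_X]
  rfl

end Localized

theorem forall_coordIdx₂ {e₀ e₁ : ℕ} {P : CoordIdx ![e₀, e₁] → Prop}
    (h₀ : ∀ j : Fin (e₀ + 1), P ⟨0, j⟩) (h₁ : ∀ j : Fin (e₁ + 1), P ⟨1, j⟩) : ∀ c, P c := by
  rintro ⟨i, j⟩
  fin_cases i
  exacts [h₀ j, h₁ j]

theorem forall_coordIdx₃ {e₀ e₁ e₂ : ℕ} {P : CoordIdx ![e₀, e₁, e₂] → Prop}
    (h₀ : ∀ j : Fin (e₀ + 1), P ⟨0, j⟩) (h₁ : ∀ j : Fin (e₁ + 1), P ⟨1, j⟩)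
    (h₂ : ∀ j : Fin (e₂ + 1), P ⟨2, j⟩) : ∀ c, P c := by
  rintro ⟨i, j⟩
  fin_cases i
  exacts [h₀ j, h₁ j, h₂ j]

theorem forall_coordIdx₄ {e₀ e₁ e₂ e₃ : ℕ} {P : CoordIdx ![e₀, e₁, e₂, e₃] → Prop}
    (h₀ : ∀ j : Fin (e₀ + 1), P ⟨0, j⟩) (h₁ : ∀ j : Fin (e₁ + 1), P ⟨1, j⟩)
    (h₂ : ∀ j : Fin (e₂ + 1), P ⟨2, j⟩) (h₃ : ∀ j : Fin (e₃ + 1), P ⟨3, j⟩) : ∀ c, P c := by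
  rintro ⟨i, j⟩
  fin_cases i
  exacts [h₀ j, h₁ j, h₂ j, h₃ j]

/-! ### A linear form and a cubic form -/

/-- Generating invariants of a linear form and a cubic form. -/
def linearCubic {R : Type*} [CommRing R] (l : Fin 2 → R) (f : Fin 4 → R) : Fin 4 → R :=
  ![bracket (gradCubic f l) (gradQuadratic (hessianCubic f) l), evalCubic f l,
    evalQuadratic (hessianCubic f) l, polarDisc (hessianCubic f) (hessianCubic f)]

theorem isInvariantFamily_linearCubic :
    IsInvariantFamily.{u} (d := ![1, 3]) (fun x => linearCubic (x 0) (x 1)) ![6, 4, 4, 4] :=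
  .of_pair
    (fun φ l f i => by
      fin_cases i <;> simp [linearCubic, bracket, gradCubic, gradQuadratic, hessianCubic,
        evalCubic, evalQuadratic, polarDisc, map_ofNat])
    (fun t l f => by
      simp only [linearCubic, gradCubic_shear, hessianCubic_shear, gradQuadratic_shear,
        bracket_shear, evalCubic_shear, evalQuadratic_shear, polarDisc_shear])
    (fun l f => by
      simp only [linearCubic, gradCubic_flip, hessianCubic_flip, gradQuadratic_flip,
        bracket_flip, evalCubic_flip, evalQuadratic_flip, polarDisc_flip])
    (fun s l f i => by
      fin_cases i <;> simp [linearCubic, bracket, gradCubic, gradQuadratic, hessianCubic,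
        evalCubic, evalQuadratic, polarDisc] <;> ring)

section LinearCubic

variable (K : Type u) [Field K] [CharZero K]

/-- Normal forms of a linear form and a cubic form. -/
def sliceLinearCubic (L : Type u) [Field L] : Set (CoordPoint L ![1, 3]) :=
  {y | ∃ a c d : L, a ≠ 0 ∧ y = point₂ ![0, 1] ![a, 0, c, d]}

theorem linearCubic_slice {R : Type*} [CommRing R] (a c d : R) :
    linearCubic ![0, 1] ![a, 0, c, d] =
      ![27 * a ^ 2 * d, a, 3 * a * c, 81 * a ^ 2 * d ^ 2 + 12 * a * c ^ 3] := by
  ext i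
  fin_cases i <;> simp [linearCubic, bracket, gradCubic, gradQuadratic, hessianCubic,
      evalCubic, evalQuadratic, polarDisc] <;> ring

theorem isSlice_linearCubic {L : Type u} [Field L] [CharZero L] [Algebra K L] :
    IsSlice K (sliceLinearCubic L) := by
  have hΦ := isInvariantFamily_linearCubic.{u}
  -- The first factor allows moving the linear form to `y`. The second is then the leading
  -- coefficient of the cubic, which must be invertible for a shear to remove the coefficient of `x²
  -- y`.
  refine ⟨X ⟨0, 0⟩ * (hΦ.toInvariants K 1).1, ?_, ?_⟩
  · intro h0
    have := congrArg (evalAt (point₂ ![1, 1] ![1, 0, 0, 0] : CoordPoint K ![1, 3])) h0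
    rw [map_mul, hΦ.evalAt_toInvariants K, evalAt_X] at this
    change (1 : K) * linearCubic ![1, 1] ![1, 0, 0, 0] 1 = _ at this
    simp [linearCubic, evalCubic] at this
  · intro x hx
    obtain ⟨l, f, rfl⟩ := exists_eq_point₂ x
    rw [map_mul, evalAt_X] at hx
    obtain ⟨τ, hτ, hτl⟩ := exists_isMove_linear (K := K) (l := l) (left_ne_zero_of_mul hx)
    have h1 := hτ.pair l f
    rw [h1 _ (Subtype.property _), hΦ.evalAt_toInvariants K] at hx
    have h2 : evalCubic (τ 3 f) (τ 1 l) ≠ 0 := right_ne_zero_of_mul hx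
    rw [hτl] at h1 h2
    set g := τ 3 f
    replace h2 : g 0 ≠ 0 := by simpa [evalCubic] using h2
    refine ⟨_, ⟨g 0, shear 3 (-g 1 / (3 * g 0)) g 2, shear 3 (-g 1 / (3 * g 0)) g 3, h2, rfl⟩,
      h1.trans ?_⟩
    convert (isMove_shear (K := K) (-g 1 / (3 * g 0))).pair ![0, 1] g using 2
    · simp [shear_one]
    · have : g 1 + 3 * (-g 1 / (3 * g 0)) * g 0 = 0 := by
        field_simp
        ring
      simp [shear_three, this]


theorem isHypersurfaceOfDegree_linearCubic_of_isAlgClosed (L : Type u) [Field L] [CharZero L]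
    [IsAlgClosed L] [Algebra K L] : IsHypersurfaceOfDegree K ![1, 3] 12 := by
  have hS : ∀ y ∈ sliceLinearCubic L, ∃ a c d : L, a ≠ 0 ∧ y = point₂ ![0, 1] ![a, 0, c, d] ∧
      linearCubic (y 0) (y 1) = 
        ![27 * a ^ 2 * d, a, 3 * a * c, 81 * a ^ 2 * d ^ 2 + 12 * a * c ^ 3] := by
    rintro _ ⟨a, c, d, ha, rfl⟩
    exact ⟨a, c, d, ha, rfl, linearCubic_slice a c d⟩
  -- In `G` the variables are shifted by one against `Φ`: `X 0` stands for `Φ 1`. The equation is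
  -- the syzygy of the covariants of a cubic.
  refine isHypersurfaceOfDegree_of_quadratic (L := L) isInvariantFamily_linearCubic
    (sliceLinearCubic L) (isSlice_linearCubic K) ?_ (9 * X 2 * X 0 ^ 2 - 4 * X 1 ^ 3) ?_
    (fun p _ => exists_of_forall_mem_localized ?_ p)
    (X 1) ![0, -1, 0] rfl ?_ ?_ ?_ ?_ rfl ?_
  · intro y hy
    obtain ⟨a, c, d, ha, -, h⟩ := hS y hy
    rw [h]
    exact ha
  · intro y hy
    obtain ⟨a, c, d, ha, -, h⟩ := hS y hy
    rw [h]
    simp [Fin.succ, map_ofNat]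
    ring
  · have key : ∀ (g : CoordPoint L ![1, 3] → L) (v : L → L → L → L) (N : ℕ)
        (Q : MvPolynomial (Fin 4) K), (∀ a c d : L, g (point₂ ![0, 1] ![a, 0, c, d]) = v a c d) →
        (∀ a c d : L, a ^ N * v a c d =
          aeval (![27 * a ^ 2 * d, a, 3 * a * c, 81 * a ^ 2 * d ^ 2 + 12 * a * c ^ 3] :
            Fin 4 → L) Q) →
        g ∈ localized (sliceLinearCubic L) (fun x => linearCubic (x 0) (x 1))
          (X 1 : MvPolynomial (Fin 4) K) := by
      intro g v N Q hv hQ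
      refine mem_localized N Q fun y hy => ?_
      obtain ⟨a, c, d, ha, rfl, h⟩ := hS y hy
      rw [h, ← hQ, ← hv, aeval_X]
      rfl
    refine forall_coordIdx₂ (fun j => ?_) (fun j => ?_) <;> fin_cases j
    · exact key _ (fun _ _ _ => 0) 0 0 (fun _ _ _ => rfl) fun a c d => by simp
    · exact key _ (fun _ _ _ => 1) 0 1 (fun _ _ _ => rfl) fun a c d => by simp
    · exact key _ (fun a _ _ => a) 0 (X 1) (fun _ _ _ => rfl) fun a c d => by simp
    · exact key _ (fun _ _ _ => 0) 0 0 (fun _ _ _ => rfl) fun a c d => by simp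
    · exact key _ (fun _ c _ => c) 1 (C (1 / 3) * X 2) (fun _ _ _ => rfl) fun a c d => by
        simp [map_ofNat]; ring
    · exact key _ (fun _ _ d => d) 2 (C (1 / 27) * X 0) (fun _ _ _ => rfl) fun a c d => by
        simp [map_ofNat]; ring
  · simp
  · simp
  · intro u z h0 hu hz0 hz
    simp only [aeval_X] at hu
    simp [h0, map_ofNat] at hz
    suffices h : ∃ l f, linearCubic l f = ![z, 0, u 1, u 2] by
      obtain ⟨l, f, h⟩ := h
      exact ⟨point₂ l f, h.trans (by ext i; fin_cases i <;> first | rfl | exact h0.symm)⟩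
    -- For `l = y` and coefficients `(0, b, 0, d)` the invariants are `z = 2 b³`, `u 1 = -b²` and `u
    -- 2 = 12 b³ d`, which determines `b` and `d`.
    refine ⟨![0, 1], ![0, - z / (2 * u 1), 0, u 2 / (12 * (- z / (2 * u 1)) ^ 3)], ?_⟩
    ext i
    fin_cases i <;> simp [linearCubic, bracket, gradCubic, gradQuadratic, hessianCubic, evalCubic,
      evalQuadratic, polarDisc] <;> field_simp
    · linear_combination - hz
    · linear_combination - hz
    · ring
  · intro i; fin_cases i <;> simp
  · intro u
    simp [Fin.succ, map_ofNat]
    ring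

theorem isHypersurfaceOfDegree_linearCubic : IsHypersurfaceOfDegree K ![1, 3] 12 :=
  isHypersurfaceOfDegree_linearCubic_of_isAlgClosed K (AlgebraicClosure K)

end LinearCubic

/-! ### A linear form and a quartic form -/

/-- Generating invariants of a linear form and a quartic form. -/
def linearQuartic {R : Type*} [CommRing R] (l : Fin 2 → R) (f : Fin 5 → R) : Fin 5 → R :=
  ![3 * bracket (gradQuartic f l) (gradQuartic (hessianQuartic f) l), evalQuartic f l,
    evalQuartic (hessianQuartic f) l, quarticI f, quarticJ f]

theorem isInvariantFamily_linearQuartic :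
    IsInvariantFamily.{u} (d := ![1, 4]) (fun x => linearQuartic (x 0) (x 1)) ![9, 5, 6, 2, 3] :=
  .of_pair
    (fun φ l f i => by
      fin_cases i <;> simp [linearQuartic, bracket, gradQuartic, hessianQuartic, evalQuartic,
        quarticI, quarticJ, map_ofNat])
    (fun t l f => by
      simp only [linearQuartic, gradQuartic_shear, hessianQuartic_shear, bracket_shear,
        evalQuartic_shear, quarticI_shear, quarticJ_shear])
    (fun l f => by
      simp only [linearQuartic, gradQuartic_flip, hessianQuartic_flip, bracket_flip,
        evalQuartic_flip, quarticI_flip, quarticJ_flip])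
    (fun s l f i => by
      fin_cases i <;> simp [linearQuartic, bracket, gradQuartic, hessianQuartic, evalQuartic,
        quarticI, quarticJ] <;> ring)

section LinearQuartic

variable (K : Type u) [Field K] [CharZero K]

/-- Normal forms of a linear form and a quartic form. -/
def sliceLinearQuartic (L : Type u) [Field L] : Set (CoordPoint L ![1, 4]) :=
  {y | ∃ a c d e : L, a ≠ 0 ∧ y = point₂ ![0, 1] ![a, 0, c, d, e]}

theorem linearQuartic_slice {R : Type*} [CommRing R] (a c d e : R) :
    linearQuartic ![0, 1] ![a, 0, c, d, e] =
      ![288 * a ^ 2 * d, a, 8 * a * c, 12 * a * e + c ^ 2,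
        72 * a * c * e - 27 * a * d ^ 2 - 2 * c ^ 3] := by
  ext i
  fin_cases i <;> simp [linearQuartic, bracket, gradQuartic, hessianQuartic, evalQuartic,
      quarticI, quarticJ]
  ring

theorem isSlice_linearQuartic {L : Type u} [Field L] [CharZero L] [Algebra K L] :
    IsSlice K (sliceLinearQuartic L) := by
  have hΦ := isInvariantFamily_linearQuartic.{u}
  refine ⟨X ⟨0, 0⟩ * (hΦ.toInvariants K 1).1, ?_, ?_⟩
  · intro h0
    have := congrArg (evalAt (point₂ ![1, 1] ![1, 0, 0, 0, 0] : CoordPoint K ![1, 4])) h0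
    rw [map_mul, hΦ.evalAt_toInvariants K, evalAt_X] at this
    change (1 : K) * linearQuartic ![1, 1] ![1, 0, 0, 0, 0] 1 = _ at this
    simp [linearQuartic, evalQuartic] at this
  · intro x hx
    obtain ⟨l, f, rfl⟩ := exists_eq_point₂ x
    rw [map_mul, evalAt_X] at hx
    obtain ⟨τ, hτ, hτl⟩ := exists_isMove_linear (K := K) (l := l) (left_ne_zero_of_mul hx)
    have h1 := hτ.pair l f
    rw [h1 _ (Subtype.property _), hΦ.evalAt_toInvariants K] at hx
    have h2 : evalQuartic (τ 4 f) (τ 1 l) ≠ 0 := right_ne_zero_of_mul hx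
    rw [hτl] at h1 h2
    set g := τ 4 f
    replace h2 : g 0 ≠ 0 := by simpa [evalQuartic] using h2
    have hs := (isMove_shear (K := K) (-g 1 / (4 * g 0))).pair ![0, 1] g
    set g' := shear 4 (-g 1 / (4 * g 0)) g with hg'
    refine ⟨_, ⟨g' 0, g' 2, g' 3, g' 4, ?_, rfl⟩, h1.trans ?_⟩
    · simpa [hg', shear_four] using h2
    · convert hs using 2
      · simp [shear_one]
      · have : g' 1 = 0 := by
          simp [hg', shear_four]
          field_simp
          ring
        ext j
        fin_cases j <;> simp [this]

theorem isHypersurfaceOfDegree_linearQuartic_of_isAlgClosed (L : Type u) [Field L] [CharZero L]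
    [IsAlgClosed L] [Algebra K L] : IsHypersurfaceOfDegree K ![1, 4] 18 := by
  have hS : ∀ y ∈ sliceLinearQuartic L, ∃ a c d e : L, a ≠ 0 ∧
      y = point₂ ![0, 1] ![a, 0, c, d, e] ∧ linearQuartic (y 0) (y 1) =
        ![288 * a ^ 2 * d, a, 8 * a * c, 12 * a * e + c ^ 2,
          72 * a * c * e - 27 * a * d ^ 2 - 2 * c ^ 3] := by
    rintro _ ⟨a, c, d, e, ha, rfl⟩
    exact ⟨a, c, d, e, ha, rfl, linearQuartic_slice a c d e⟩
  refine isHypersurfaceOfDegree_of_quadratic (L := L) isInvariantFamily_linearQuartic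
    -- The next line is the syzygy between a quartic, its Hessian, its covariant of degree three and
    -- its two invariants.
    (sliceLinearQuartic L) (isSlice_linearQuartic K) ?_
    (2304 * X 0 ^ 2 * X 2 * X 1 - 3072 * X 0 ^ 3 * X 3 - 48 * X 1 ^ 3) ?_
    (fun p _ => exists_of_forall_mem_localized ?_ p)
    (X 1) ![0, -1, 0, 0] rfl ?_ ?_ ?_ ?_ rfl ?_
  · intro y hy
    obtain ⟨a, c, d, e, ha, -, h⟩ := hS y hy
    rw [h]
    exact ha
  · intro y hy
    obtain ⟨a, c, d, e, ha, -, h⟩ := hS y hy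
    rw [h]
    simp [Fin.succ, map_ofNat]
    ring
  · have key : ∀ (g : CoordPoint L ![1, 4] → L) (v : L → L → L → L → L) (N : ℕ)
        (Q : MvPolynomial (Fin 5) K),
        (∀ a c d e : L, g (point₂ ![0, 1] ![a, 0, c, d, e]) = v a c d e) →
        (∀ a c d e : L, a ^ N * v a c d e =
          aeval (![288 * a ^ 2 * d, a, 8 * a * c, 12 * a * e + c ^ 2,
            72 * a * c * e - 27 * a * d ^ 2 - 2 * c ^ 3] : Fin 5 → L) Q) →
        g ∈ localized (sliceLinearQuartic L) (fun x => linearQuartic (x 0) (x 1))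
          (X 1 : MvPolynomial (Fin 5) K) := by
      intro g v N Q hv hQ
      refine mem_localized N Q fun y hy => ?_
      obtain ⟨a, c, d, e, ha, rfl, h⟩ := hS y hy
      rw [h, ← hQ, ← hv, aeval_X]
      rfl
    refine forall_coordIdx₂ (fun j => ?_) (fun j => ?_) <;> fin_cases j
    · exact key _ (fun _ _ _ _ => 0) 0 0 (fun _ _ _ _ => rfl) fun a c d e => by simp
    · exact key _ (fun _ _ _ _ => 1) 0 1 (fun _ _ _ _ => rfl) fun a c d e => by simp
    · exact key _ (fun a _ _ _ => a) 0 (X 1) (fun _ _ _ _ => rfl) fun a c d e => by simp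
    · exact key _ (fun _ _ _ _ => 0) 0 0 (fun _ _ _ _ => rfl) fun a c d e => by simp
    · exact key _ (fun _ c _ _ => c) 1 (C (1 / 8) * X 2) (fun _ _ _ _ => rfl) fun a c d e => by
        simp [map_ofNat]; ring
    · exact key _ (fun _ _ d _ => d) 2 (C (1 / 288) * X 0) (fun _ _ _ _ => rfl)
        fun a c d e => by simp [map_ofNat]; ring
    · exact key _ (fun _ _ _ e => e) 3 (C (1 / 12) * (X 1 ^ 2 * X 3 - C (1 / 64) * X 2 ^ 2))
        (fun _ _ _ _ => rfl) fun a c d e => by simp [map_ofNat]; ring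
  · simp
  · simp
  · intro u z h0 hu hz0 hz
    simp only [aeval_X] at hu
    simp [h0, map_ofNat] at hz
    suffices h : ∃ l f, linearQuartic l f = ![z, 0, u 1, u 2, u 3] by
      obtain ⟨l, f, h⟩ := h
      exact ⟨point₂ l f, h.trans (by ext i; fin_cases i <;> first | rfl | exact h0.symm)⟩
    -- For `l = y` and coefficients `(0, b, 0, d, e)` the invariants are `z = 36 b³`, `u 1 = -3 b²`,
    -- `u 2 = -3 b d`, `u 3 = -27 b² e`.
    obtain ⟨b, hb⟩ : ∃ b, b = - z / (12 * u 1) := ⟨_, rfl⟩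
    have hb0 : b ≠ 0 := by
      rw [hb]
      exact div_ne_zero (neg_ne_zero.mpr hz0) (mul_ne_zero (by norm_num) hu)
    have hb2 : 3 * b ^ 2 = - u 1 := by
      rw [hb]
      field_simp
      linear_combination 3 * hz
    have hb1 : z = 36 * b ^ 3 := by
      have : z = - 12 * u 1 * b := by
        rw [hb]
        field_simp
      linear_combination this - 12 * b * hb2
    refine ⟨![0, 1], ![0, b, 0, - u 2 / (3 * b), - u 3 / (27 * b ^ 2)], ?_⟩
    ext i
    fin_cases i <;> simp [linearQuartic, bracket, gradQuartic, hessianQuartic, evalQuartic,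
      quarticI, quarticJ]
    · linear_combination - hb1
    · linear_combination - hb2
    · field_simp
    · field_simp
  · intro i; fin_cases i <;> simp
  · intro u
    simp [Fin.succ, map_ofNat]
    ring

theorem isHypersurfaceOfDegree_linearQuartic : IsHypersurfaceOfDegree K ![1, 4] 18 :=
  isHypersurfaceOfDegree_linearQuartic_of_isAlgClosed K (AlgebraicClosure K)

end LinearQuartic

/-! ### Two linear forms and a quadratic form -/

/-- Generating invariants of two linear forms and a quadratic form. -/
def linearLinearQuadratic {R : Type*} [CommRing R] (l m : Fin 2 → R) (q : Fin 3 → R) : Fin 5 → R :=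
  ![bracket (gradQuadratic q l) m, bracket l m, evalQuadratic q l, evalQuadratic q m, polarDisc q q]

theorem isInvariantFamily_linearLinearQuadratic :
    IsInvariantFamily.{u} (d := ![1, 1, 2]) (fun x => linearLinearQuadratic (x 0) (x 1) (x 2))
      ![3, 2, 3, 3, 2] :=
  .of_triple
    (fun φ l m q i => by
      fin_cases i <;> simp [linearLinearQuadratic, bracket, gradQuadratic, evalQuadratic,
        polarDisc, map_ofNat])
    (fun t l m q => by
      simp only [linearLinearQuadratic, gradQuadratic_shear, bracket_shear, evalQuadratic_shear,
        polarDisc_shear])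
    (fun l m q => by
      simp only [linearLinearQuadratic, gradQuadratic_flip, bracket_flip, evalQuadratic_flip,
        polarDisc_flip])
    (fun s l m q i => by
      fin_cases i <;> simp [linearLinearQuadratic, bracket, gradQuadratic, evalQuadratic,
        polarDisc] <;> ring)

section LinearLinearQuadratic

variable (K : Type u) [Field K] [CharZero K]

/-- Normal forms of two linear forms and a quadratic form. -/
def sliceLinearLinearQuadratic (L : Type u) [Field L] : Set (CoordPoint L ![1, 1, 2]) :=
  {y | ∃ m a b c : L, m ≠ 0 ∧ y = point₃ ![0, 1] ![m, 0] ![a, b, c]}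

theorem linearLinearQuadratic_slice {R : Type*} [CommRing R] (m a b c : R) :
    linearLinearQuadratic ![0, 1] ![m, 0] ![a, b, c] =
      ![- (b * m), - m, a, c * m ^ 2, b ^ 2 - 4 * a * c] := by
  ext i
  fin_cases i <;> simp [linearLinearQuadratic, bracket, gradQuadratic, evalQuadratic,
    polarDisc]
  ring

theorem isSlice_linearLinearQuadratic {L : Type u} [Field L] [CharZero L] [Algebra K L] :
    IsSlice K (sliceLinearLinearQuadratic L) := by
  have hΦ := isInvariantFamily_linearLinearQuadratic.{u}
  refine ⟨X ⟨0, 0⟩ * (hΦ.toInvariants K 1).1, ?_, ?_⟩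
  · intro h0
    have := congrArg (evalAt (point₃ ![1, 0] ![0, 1] ![0, 0, 0] : CoordPoint K ![1, 1, 2])) h0
    rw [map_mul, hΦ.evalAt_toInvariants K, evalAt_X] at this
    change (1 : K) * linearLinearQuadratic ![1, 0] ![0, 1] ![0, 0, 0] 1 = _ at this
    simp [linearLinearQuadratic, bracket] at this
  · intro x hx
    obtain ⟨l, m, q, rfl⟩ := exists_eq_point₃ x
    rw [map_mul, evalAt_X] at hx
    obtain ⟨τ, hτ, hτl⟩ := exists_isMove_linear (K := K) (l := l) (left_ne_zero_of_mul hx)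
    have h1 := hτ.triple l m q
    rw [h1 _ (Subtype.property _), hΦ.evalAt_toInvariants K] at hx
    have h2 : bracket (τ 1 l) (τ 1 m) ≠ 0 := right_ne_zero_of_mul hx
    rw [hτl] at h1 h2
    set m' := τ 1 m
    replace h2 : m' 0 ≠ 0 := by simpa [bracket] using h2
    have hs := (isMove_shear (K := K) (-m' 1 / m' 0)).triple ![0, 1] m' (τ 2 q)
    set q' := shear 2 (-m' 1 / m' 0) (τ 2 q) with hq'
    refine ⟨_, ⟨m' 0, q' 0, q' 1, q' 2, h2, rfl⟩, h1.trans ?_⟩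
    convert hs using 2
    · simp [shear_one]
    · simp [shear_one, h2]
    · ext j
      fin_cases j <;> rfl

theorem isHypersurfaceOfDegree_linearLinearQuadratic_of_isAlgClosed (L : Type u) [Field L]
    [CharZero L] [IsAlgClosed L] [Algebra K L] : IsHypersurfaceOfDegree K ![1, 1, 2] 6 := by
  have hS : ∀ y ∈ sliceLinearLinearQuadratic L, ∃ m a b c : L, m ≠ 0 ∧
      y = point₃ ![0, 1] ![m, 0] ![a, b, c] ∧ linearLinearQuadratic (y 0) (y 1) (y 2) =
        ![- (b * m), - m, a, c * m ^ 2, b ^ 2 - 4 * a * c] := by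
    rintro _ ⟨m, a, b, c, hm, rfl⟩
    exact ⟨m, a, b, c, hm, rfl, linearLinearQuadratic_slice m a b c⟩
  refine isHypersurfaceOfDegree_of_quadratic (L := L) isInvariantFamily_linearLinearQuadratic
    (sliceLinearLinearQuadratic L) (isSlice_linearLinearQuadratic K) ?_
    (4 * X 1 * X 2 + X 3 * X 0 ^ 2) ?_
    (fun p _ => exists_of_forall_mem_localized ?_ p)
    (X 1) ![0, 1, 1, 0] rfl ?_ ?_ ?_ ?_ rfl ?_
  · intro y hy
    obtain ⟨m, a, b, c, hm, -, h⟩ := hS y hy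
    rw [h]
    exact neg_ne_zero.mpr hm
  · intro y hy
    obtain ⟨m, a, b, c, hm, -, h⟩ := hS y hy
    rw [h]
    simp [Fin.succ, map_ofNat]
    ring
  · have key : ∀ (g : CoordPoint L ![1, 1, 2] → L) (v : L → L → L → L → L) (N : ℕ)
        (Q : MvPolynomial (Fin 5) K),
        (∀ m a b c : L, g (point₃ ![0, 1] ![m, 0] ![a, b, c]) = v m a b c) →
        (∀ m a b c : L, (- m) ^ N * v m a b c =
          aeval (![- (b * m), - m, a, c * m ^ 2, b ^ 2 - 4 * a * c] : Fin 5 → L) Q) →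
        g ∈ localized (sliceLinearLinearQuadratic L)
          (fun x => linearLinearQuadratic (x 0) (x 1) (x 2)) (X 1 : MvPolynomial (Fin 5) K) := by
      intro g v N Q hv hQ
      refine mem_localized N Q fun y hy => ?_
      obtain ⟨m, a, b, c, hm, rfl, h⟩ := hS y hy
      rw [h, ← hQ, ← hv, aeval_X]
      rfl
    refine forall_coordIdx₃ (fun j => ?_) (fun j => ?_) (fun j => ?_) <;> fin_cases j
    · exact key _ (fun _ _ _ _ => 0) 0 0 (fun _ _ _ _ => rfl) fun m a b c => by simp
    · exact key _ (fun _ _ _ _ => 1) 0 1 (fun _ _ _ _ => rfl) fun m a b c => by simp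
    · exact key _ (fun m _ _ _ => m) 0 (- X 1) (fun _ _ _ _ => rfl) fun m a b c => by simp
    · exact key _ (fun _ _ _ _ => 0) 0 0 (fun _ _ _ _ => rfl) fun m a b c => by simp
    · exact key _ (fun _ a _ _ => a) 0 (X 2) (fun _ _ _ _ => rfl) fun m a b c => by simp
    · exact key _ (fun _ _ b _ => b) 1 (X 0) (fun _ _ _ _ => rfl) fun m a b c => by simp; ring
    · exact key _ (fun _ _ _ c => c) 2 (X 3) (fun _ _ _ _ => rfl) fun m a b c => by simp; ring
  · simp
  · simp
  · intro u z h0 hu hz0 hz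
    simp only [aeval_X] at hu
    simp [h0, map_ofNat] at hz
    suffices h : ∃ l m q, linearLinearQuadratic l m q = ![z, 0, u 1, u 2, u 3] by
      obtain ⟨l, m, q, h⟩ := h
      exact ⟨point₃ l m q, h.trans (by ext i; fin_cases i <;> first | rfl | exact h0.symm)⟩
    -- The second linear form is a multiple of the first, so their bracket vanishes. The equation
    -- `z² = 4 * u 1 * u 2` then supplies the value at the second form.
    refine ⟨![0, 1], ![0, z / (2 * u 1)], ![u 1, 0, - u 3 / (4 * u 1)], ?_⟩
    ext i
    fin_cases i <;> simp [linearLinearQuadratic, bracket, gradQuadratic, evalQuadratic,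
      polarDisc] <;> field_simp
    · linear_combination hz
    · ring
  · intro i; fin_cases i <;> simp
  · intro u
    simp [Fin.succ, map_ofNat]
    ring

theorem isHypersurfaceOfDegree_linearLinearQuadratic : IsHypersurfaceOfDegree K ![1, 1, 2] 6 :=
  isHypersurfaceOfDegree_linearLinearQuadratic_of_isAlgClosed K (AlgebraicClosure K)

end LinearLinearQuadratic

/-! ### A linear form and two quadratic forms -/

/-- Generating invariants of a linear form and two quadratic forms. -/
def linearQuadraticQuadratic {R : Type*} [CommRing R] (l : Fin 2 → R) (q r : Fin 3 → R) :
    Fin 6 → R :=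
  ![evalQuadratic (jacobian q r) l, evalQuadratic q l, evalQuadratic r l, polarDisc q q,
    polarDisc q r, polarDisc r r]

theorem isInvariantFamily_linearQuadraticQuadratic :
    IsInvariantFamily.{u} (d := ![1, 2, 2])
      (fun x => linearQuadraticQuadratic (x 0) (x 1) (x 2)) ![4, 3, 3, 2, 2, 2] :=
  .of_triple
    (fun φ l q r i => by
      fin_cases i <;> simp [linearQuadraticQuadratic, jacobian, evalQuadratic, polarDisc,
        map_ofNat])
    (fun t l q r => by
      simp only [linearQuadraticQuadratic, jacobian_shear, evalQuadratic_shear, polarDisc_shear])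
    (fun l q r => by
      simp only [linearQuadraticQuadratic, jacobian_flip, evalQuadratic_flip, polarDisc_flip])
    (fun s l q r i => by
      fin_cases i <;> simp [linearQuadraticQuadratic, jacobian, evalQuadratic, polarDisc] <;> ring)

section LinearQuadraticQuadratic

variable (K : Type u) [Field K] [CharZero K]

/-- Normal forms of a linear form and two quadratic forms. -/
def sliceLinearQuadraticQuadratic (L : Type u) [Field L] : Set (CoordPoint L ![1, 2, 2]) :=
  {y | ∃ a c r s t : L, a ≠ 0 ∧ y = point₃ ![0, 1] ![a, 0, c] ![r, s, t]}

theorem linearQuadraticQuadratic_slice {R : Type*} [CommRing R] (a c r s t : R) :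
    linearQuadraticQuadratic ![0, 1] ![a, 0, c] ![r, s, t] =
      ![a * s, a, r, - 4 * a * c, - 2 * a * t - 2 * c * r, s ^ 2 - 4 * r * t] := by
  ext i
  fin_cases i <;> simp [linearQuadraticQuadratic, jacobian, evalQuadratic, polarDisc] <;> ring

theorem isSlice_linearQuadraticQuadratic {L : Type u} [Field L] [CharZero L] [Algebra K L] :
    IsSlice K (sliceLinearQuadraticQuadratic L) := by
  have hΦ := isInvariantFamily_linearQuadraticQuadratic.{u}
  refine ⟨X ⟨0, 0⟩ * (hΦ.toInvariants K 1).1, ?_, ?_⟩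
  · intro h0
    have := congrArg (evalAt (point₃ ![1, 0] ![0, 0, 1] ![0, 0, 0] : CoordPoint K ![1, 2, 2])) h0
    rw [map_mul, hΦ.evalAt_toInvariants K, evalAt_X] at this
    change (1 : K) * linearQuadraticQuadratic ![1, 0] ![0, 0, 1] ![0, 0, 0] 1 = _ at this
    simp [linearQuadraticQuadratic, evalQuadratic] at this
  · intro x hx
    obtain ⟨l, q, r, rfl⟩ := exists_eq_point₃ x
    rw [map_mul, evalAt_X] at hx
    obtain ⟨τ, hτ, hτl⟩ := exists_isMove_linear (K := K) (l := l) (left_ne_zero_of_mul hx)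
    have h1 := hτ.triple l q r
    rw [h1 _ (Subtype.property _), hΦ.evalAt_toInvariants K] at hx
    have h2 : evalQuadratic (τ 2 q) (τ 1 l) ≠ 0 := right_ne_zero_of_mul hx
    rw [hτl] at h1 h2
    set q' := τ 2 q
    replace h2 : q' 0 ≠ 0 := by simpa [evalQuadratic] using h2
    have hs := (isMove_shear (K := K) (-q' 1 / (2 * q' 0))).triple ![0, 1] q' (τ 2 r)
    set q'' := shear 2 (-q' 1 / (2 * q' 0)) q' with hq''
    set r' := shear 2 (-q' 1 / (2 * q' 0)) (τ 2 r) with hr'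
    refine ⟨_, ⟨q'' 0, q'' 2, r' 0, r' 1, r' 2, ?_, rfl⟩, h1.trans ?_⟩
    · simpa [hq'', shear_two] using h2
    · convert hs using 2
      · simp [shear_one]
      · have : q'' 1 = 0 := by
          simp [hq'', shear_two]
          field_simp
          ring
        ext j
        fin_cases j <;> simp [this]
      · ext j
        fin_cases j <;> rfl

theorem isHypersurfaceOfDegree_linearQuadraticQuadratic_of_isAlgClosed (L : Type u) [Field L]
    [CharZero L] [IsAlgClosed L] [Algebra K L] : IsHypersurfaceOfDegree K ![1, 2, 2] 8 := by
  have hS : ∀ y ∈ sliceLinearQuadraticQuadratic L, ∃ a c r s t : L, a ≠ 0 ∧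
      y = point₃ ![0, 1] ![a, 0, c] ![r, s, t] ∧ linearQuadraticQuadratic (y 0) (y 1) (y 2) =
        ![a * s, a, r, - 4 * a * c, - 2 * a * t - 2 * c * r, s ^ 2 - 4 * r * t] := by
    rintro _ ⟨a, c, r, s, t, ha, rfl⟩
    exact ⟨a, c, r, s, t, ha, rfl, linearQuadraticQuadratic_slice a c r s t⟩
  refine isHypersurfaceOfDegree_of_quadratic (L := L) isInvariantFamily_linearQuadraticQuadratic
    (sliceLinearQuadraticQuadratic L) (isSlice_linearQuadraticQuadratic K) ?_
    (X 0 ^ 2 * X 4 - 2 * X 0 * X 1 * X 3 + X 1 ^ 2 * X 2) ?_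
    (fun p _ => exists_of_forall_mem_localized ?_ p)
    (X 1) ![0, 1, 1, 0, 0] rfl ?_ ?_ ?_ ?_ rfl ?_
  · intro y hy
    obtain ⟨a, c, r, s, t, ha, -, h⟩ := hS y hy
    rw [h]
    exact ha
  · intro y hy
    obtain ⟨a, c, r, s, t, ha, -, h⟩ := hS y hy
    rw [h]
    simp [Fin.succ, map_ofNat]
    ring
  · have key : ∀ (g : CoordPoint L ![1, 2, 2] → L) (v : L → L → L → L → L → L) (N : ℕ)
        (Q : MvPolynomial (Fin 6) K),
        (∀ a c r s t : L, g (point₃ ![0, 1] ![a, 0, c] ![r, s, t]) = v a c r s t) →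
        (∀ a c r s t : L, a ^ N * v a c r s t =
          aeval (![a * s, a, r, - 4 * a * c, - 2 * a * t - 2 * c * r, s ^ 2 - 4 * r * t] :
            Fin 6 → L) Q) →
        g ∈ localized (sliceLinearQuadraticQuadratic L)
          (fun x => linearQuadraticQuadratic (x 0) (x 1) (x 2))
          (X 1 : MvPolynomial (Fin 6) K) := by
      intro g v N Q hv hQ
      refine mem_localized N Q fun y hy => ?_
      obtain ⟨a, c, r, s, t, ha, rfl, h⟩ := hS y hy
      rw [h, ← hQ, ← hv, aeval_X]
      rfl
    refine forall_coordIdx₃ (fun j => ?_) (fun j => ?_) (fun j => ?_) <;> fin_cases j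
    · exact key _ (fun _ _ _ _ _ => 0) 0 0 (fun _ _ _ _ _ => rfl) fun a c r s t => by simp
    · exact key _ (fun _ _ _ _ _ => 1) 0 1 (fun _ _ _ _ _ => rfl) fun a c r s t => by simp
    · exact key _ (fun a _ _ _ _ => a) 0 (X 1) (fun _ _ _ _ _ => rfl) fun a c r s t => by simp
    · exact key _ (fun _ _ _ _ _ => 0) 0 0 (fun _ _ _ _ _ => rfl) fun a c r s t => by simp
    · exact key _ (fun _ c _ _ _ => c) 1 (- C (1 / 4) * X 3) (fun _ _ _ _ _ => rfl)
        fun a c r s t => by simp [map_ofNat]; ring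
    · exact key _ (fun _ _ r _ _ => r) 0 (X 2) (fun _ _ _ _ _ => rfl) fun a c r s t => by simp
    · exact key _ (fun _ _ _ s _ => s) 1 (X 0) (fun _ _ _ _ _ => rfl) fun a c r s t => by simp
    · exact key _ (fun _ _ _ _ t => t) 2 (- C (1 / 2) * X 1 * X 4 + C (1 / 4) * X 2 * X 3)
        (fun _ _ _ _ _ => rfl) fun a c r s t => by simp [map_ofNat]; ring
  · simp
  · simp
  · intro u z h0 hu hz0 hz
    simp only [aeval_X] at hu
    simp [h0, map_ofNat] at hz
    suffices h : ∃ l q r, linearQuadraticQuadratic l q r = ![z, 0, u 1, u 2, u 3, u 4] by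
      obtain ⟨l, q, r, h⟩ := h
      exact ⟨point₃ l q r, h.trans (by ext i; fin_cases i <;> first | rfl | exact h0.symm)⟩
    -- The first quadratic form vanishes at the zero of `y`; its discriminant is the square of its
    -- middle coefficient, which is correct by `z² = u 1 ^ 2 * u 2`.
    refine ⟨![0, 1], ![0, - z / u 1, - u 3 / (2 * u 1)], ![u 1, 0, - u 4 / (4 * u 1)], ?_⟩
    ext i
    fin_cases i <;> simp [linearQuadraticQuadratic, jacobian, evalQuadratic, polarDisc] <;>
      field_simp
    · linear_combination hz
    · ring
  · intro i; fin_cases i <;> simp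
  · intro u
    simp [Fin.succ, map_ofNat]
    ring

theorem isHypersurfaceOfDegree_linearQuadraticQuadratic : IsHypersurfaceOfDegree K ![1, 2, 2] 8 :=
  isHypersurfaceOfDegree_linearQuadraticQuadratic_of_isAlgClosed K (AlgebraicClosure K)

end LinearQuadraticQuadratic

/-! ### Four linear forms -/

/-- Generating invariants of four linear forms. -/
def fourLinear {R : Type*} [CommRing R] (l₁ l₂ l₃ l₄ : Fin 2 → R) : Fin 6 → R :=
  ![bracket l₁ l₃ + bracket l₂ l₄, bracket l₁ l₂, bracket l₃ l₄, bracket l₁ l₄, bracket l₂ l₃,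
    bracket l₁ l₃ - bracket l₂ l₄]

theorem isInvariantFamily_fourLinear :
    IsInvariantFamily.{u} (d := ![1, 1, 1, 1])
      (fun x => fourLinear (x 0) (x 1) (x 2) (x 3)) ![2, 2, 2, 2, 2, 2] :=
  .of_quadruple
    (fun φ l₁ l₂ l₃ l₄ i => by fin_cases i <;> simp [fourLinear, bracket])
    (fun t l₁ l₂ l₃ l₄ => by simp only [fourLinear, bracket_shear])
    (fun l₁ l₂ l₃ l₄ => by simp only [fourLinear, bracket_flip])
    (fun s l₁ l₂ l₃ l₄ i => by fin_cases i <;> simp [fourLinear, bracket] <;> ring)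

section FourLinear

variable (K : Type u) [Field K] [CharZero K]

/-- Normal forms of four linear forms. -/
def sliceFourLinear (L : Type u) [Field L] : Set (CoordPoint L ![1, 1, 1, 1]) :=
  {y | ∃ m a b c d : L, m ≠ 0 ∧ y = point₄ ![0, 1] ![m, 0] ![a, b] ![c, d]}

theorem fourLinear_slice {R : Type*} [CommRing R] (m a b c d : R) :
    fourLinear ![0, 1] ![m, 0] ![a, b] ![c, d] =
      ![- a + m * d, - m, a * d - b * c, - c, m * b, - a - m * d] := by
  ext i
  fin_cases i <;> simp [fourLinear, bracket]

theorem isSlice_fourLinear {L : Type u} [Field L] [CharZero L] [Algebra K L] :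
    IsSlice K (sliceFourLinear L) := by
  have hΦ := isInvariantFamily_fourLinear.{u}
  refine ⟨X ⟨0, 0⟩ * (hΦ.toInvariants K 1).1, ?_, ?_⟩
  · intro h0
    have := congrArg
      (evalAt (point₄ ![1, 0] ![0, 1] ![0, 0] ![0, 0] : CoordPoint K ![1, 1, 1, 1])) h0
    rw [map_mul, hΦ.evalAt_toInvariants K, evalAt_X] at this
    change (1 : K) * fourLinear ![1, 0] ![0, 1] ![0, 0] ![0, 0] 1 = _ at this
    simp [fourLinear, bracket] at this
  · intro x hx
    obtain ⟨l, m, n, k, rfl⟩ := exists_eq_point₄ x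
    rw [map_mul, evalAt_X] at hx
    obtain ⟨τ, hτ, hτl⟩ := exists_isMove_linear (K := K) (l := l) (left_ne_zero_of_mul hx)
    have h1 := hτ.quadruple l m n k
    rw [h1 _ (Subtype.property _), hΦ.evalAt_toInvariants K] at hx
    have h2 : bracket (τ 1 l) (τ 1 m) ≠ 0 := right_ne_zero_of_mul hx
    rw [hτl] at h1 h2
    set m' := τ 1 m
    replace h2 : m' 0 ≠ 0 := by simpa [bracket] using h2
    have hs := (isMove_shear (K := K) (-m' 1 / m' 0)).quadruple ![0, 1] m' (τ 1 n) (τ 1 k)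
    set n' := shear 1 (-m' 1 / m' 0) (τ 1 n) with hn'
    set k' := shear 1 (-m' 1 / m' 0) (τ 1 k) with hk'
    refine ⟨_, ⟨m' 0, n' 0, n' 1, k' 0, k' 1, h2, rfl⟩, h1.trans ?_⟩
    convert hs using 2
    · simp [shear_one]
    · simp [shear_one, h2]
    · ext j
      fin_cases j <;> rfl
    · ext j
      fin_cases j <;> rfl

theorem isHypersurfaceOfDegree_fourLinear_of_isAlgClosed (L : Type u) [Field L]
    [CharZero L] [IsAlgClosed L] [Algebra K L] : IsHypersurfaceOfDegree K ![1, 1, 1, 1] 4 := by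
  have hS : ∀ y ∈ sliceFourLinear L, ∃ m a b c d : L, m ≠ 0 ∧
      y = point₄ ![0, 1] ![m, 0] ![a, b] ![c, d] ∧ fourLinear (y 0) (y 1) (y 2) (y 3) =
        ![- a + m * d, - m, a * d - b * c, - c, m * b, - a - m * d] := by
    rintro _ ⟨m, a, b, c, d, hm, rfl⟩
    exact ⟨m, a, b, c, d, hm, rfl, fourLinear_slice m a b c d⟩
  refine isHypersurfaceOfDegree_of_quadratic (L := L) isInvariantFamily_fourLinear
    (sliceFourLinear L) (isSlice_fourLinear K) ?_
    -- Plücker's relation `[13][24] = [12][34] + [14][23]`. Taking the sum and difference of `[13]`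
    -- and `[24]` as generators turns the product on the left into a difference of squares.
    (X 4 ^ 2 + 4 * X 0 * X 1 + 4 * X 2 * X 3) ?_
    (fun p _ => exists_of_forall_mem_localized ?_ p)
    (X 2) ![0, 0, 1, 1, 0] rfl ?_ ?_ ?_ ?_ rfl ?_
  · intro y hy
    obtain ⟨m, a, b, c, d, hm, -, h⟩ := hS y hy
    rw [h]
    exact neg_ne_zero.mpr hm
  · intro y hy
    obtain ⟨m, a, b, c, d, hm, -, h⟩ := hS y hy
    rw [h]
    simp [Fin.succ, map_ofNat]
    ring
  · have key : ∀ (g : CoordPoint L ![1, 1, 1, 1] → L) (v : L → L → L → L → L → L) (N : ℕ)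
        (Q : MvPolynomial (Fin 6) K),
        (∀ m a b c d : L, g (point₄ ![0, 1] ![m, 0] ![a, b] ![c, d]) = v m a b c d) →
        (∀ m a b c d : L, (- m) ^ N * v m a b c d =
          aeval (![- a + m * d, - m, a * d - b * c, - c, m * b, - a - m * d] : Fin 6 → L) Q) →
        g ∈ localized (sliceFourLinear L)
          (fun x => fourLinear (x 0) (x 1) (x 2) (x 3)) (X 1 : MvPolynomial (Fin 6) K) := by
      intro g v N Q hv hQ
      refine mem_localized N Q fun y hy => ?_
      obtain ⟨m, a, b, c, d, hm, rfl, h⟩ := hS y hy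
      rw [h, ← hQ, ← hv, aeval_X]
      rfl
    refine forall_coordIdx₄ (fun j => ?_) (fun j => ?_) (fun j => ?_) (fun j => ?_) <;>
      fin_cases j
    · exact key _ (fun _ _ _ _ _ => 0) 0 0 (fun _ _ _ _ _ => rfl) fun m a b c d => by simp
    · exact key _ (fun _ _ _ _ _ => 1) 0 1 (fun _ _ _ _ _ => rfl) fun m a b c d => by simp
    · exact key _ (fun m _ _ _ _ => m) 0 (- X 1) (fun _ _ _ _ _ => rfl) fun m a b c d => by simp
    · exact key _ (fun _ _ _ _ _ => 0) 0 0 (fun _ _ _ _ _ => rfl) fun m a b c d => by simp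
    · exact key _ (fun _ a _ _ _ => a) 0 (- C (1 / 2) * (X 0 + X 5)) (fun _ _ _ _ _ => rfl)
        fun m a b c d => by simp [map_ofNat]; ring
    · exact key _ (fun _ _ b _ _ => b) 1 (- X 4) (fun _ _ _ _ _ => rfl) fun m a b c d => by simp
    · exact key _ (fun _ _ _ c _ => c) 0 (- X 3) (fun _ _ _ _ _ => rfl) fun m a b c d => by simp
    · exact key _ (fun _ _ _ _ d => d) 1 (- C (1 / 2) * (X 0 - X 5)) (fun _ _ _ _ _ => rfl)
        fun m a b c d => by simp [map_ofNat]; ring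
  · simp
  · simp
  · intro u z h0 hu hz0 hz
    simp only [aeval_X] at hu
    simp [h0, map_ofNat] at hz
    suffices h : ∃ l₁ l₂ l₃ l₄, fourLinear l₁ l₂ l₃ l₄ = ![z, 0, u 1, u 2, u 3, u 4] by
      obtain ⟨l₁, l₂, l₃, l₄, h⟩ := h
      exact ⟨point₄ l₁ l₂ l₃ l₄, h.trans (by ext i; fin_cases i <;> first | rfl | exact h0.symm)⟩
    -- The first two forms are parallel, and `[13] = (z + u 4) / 2`, `[24] = (z - u 4) / 2` are
    -- prescribed; `[23]` is then right by the relation.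
    refine ⟨![0, 1], ![0, (z - u 4) / (2 * u 2)], ![- (z + u 4) / 2, u 1 / u 2], ![- u 2, 0], ?_⟩
    ext i
    fin_cases i <;> simp [fourLinear, bracket] <;> field_simp
    · ring
    · linear_combination hz
    · ring
  · intro i; fin_cases i <;> simp
  · intro u
    simp [Fin.succ, map_ofNat]
    ring

theorem isHypersurfaceOfDegree_fourLinear : IsHypersurfaceOfDegree K ![1, 1, 1, 1] 4 :=
  isHypersurfaceOfDegree_fourLinear_of_isAlgClosed K (AlgebraicClosure K)

end FourLinear

/-! ### Torus weights and parity -/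

section Weights

variable {K L : Type u} [Field K] [Field L] [Algebra K L] {n : ℕ} {d : Fin n → ℕ}

/-- The weight of a monomial in the coordinates under the diagonal torus. -/
def torusWeight (m : CoordIdx d →₀ ℕ) : ℤ := ∑ c, ((d c.1 : ℤ) - 2 * (c.2 : ℕ)) * m c

/-- The torus element with parameter `2` multiplies a monomial by `2` to its weight, which equals
`1` only for weight zero. -/
theorem torusWeight_eq_zero [CharZero K] {p : CoordRing K d} (hp : p ∈ invariants K d) {m : CoordIdx d →₀ ℕ}
    (hm : m ∈ p.support) : torusWeight m = 0 := by
  have h := prod_pow_eq_of_mem_support (L := K)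
    (fun c : CoordIdx d => (2 : K) ^ (d c.1 - (c.2 : ℕ)) * (2 : K)⁻¹ ^ (c.2 : ℕ)) 1 p (fun x => by
      rw [map_one, one_mul]
      exact (sameInvariants_torus (K := K) (L := K) (s := 2) two_ne_zero
        (fun i j => x ⟨i, j⟩) p hp).symm) hm
  have h2 : ∀ c : CoordIdx d, ((2 : K) ^ (d c.1 - (c.2 : ℕ)) * (2 : K)⁻¹ ^ (c.2 : ℕ)) ^ m c =
      2 ^ (((d c.1 : ℤ) - 2 * (c.2 : ℕ)) * m c) := by
    intro c
    have : (c.2 : ℕ) ≤ d c.1 := by have := c.2.2; omega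
    rw [zpow_mul, zpow_natCast]
    congr 1
    rw [← zpow_natCast, ← zpow_natCast, inv_zpow', ← zpow_add₀ two_ne_zero]
    congr 1
    push_cast [this]
    ring
  have h3 : ∀ (s : Finset (CoordIdx d)) (g : CoordIdx d → ℤ),
      ∏ c ∈ s, (2 : K) ^ g c = 2 ^ ∑ c ∈ s, g c := by
    classical
    intro s g
    induction s using Finset.induction_on with
    | empty => simp
    | insert c s hc ih => rw [Finset.prod_insert hc, Finset.sum_insert hc, ih, zpow_add₀ two_ne_zero]
  rw [Finsupp.prod_fintype _ _ (fun _ => pow_zero _), Finset.prod_congr rfl fun c _ => h2 c, h3] at h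
  change (2 : K) ^ torusWeight m = 1 at h
  have h4 : (2 : K) ^ (torusWeight m).natAbs = 1 := by
    obtain hw | hw := Int.natAbs_eq (torusWeight m)
    · rwa [hw, zpow_natCast] at h
    · rwa [hw, zpow_neg, zpow_natCast, inv_eq_one] at h
  have h5 : 2 ^ (torusWeight m).natAbs = 1 := by exact_mod_cast h4
  simpa using h5

theorem aeval_mem_of_forall_mem_support {Y σ : Type*} [Fintype σ] (B : Subalgebra K (Y → L))
    (x : Y → σ → L) {p : MvPolynomial σ K}
    (hB : ∀ m ∈ p.support, (fun y => ∏ c, x y c ^ m c) ∈ B) : (fun y => aeval (x y) p) ∈ B := by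
  have : (fun y => aeval (x y) p) =
      ∑ m ∈ p.support, (coeff m p) • (fun y => ∏ c, x y c ^ m c) := by
    funext y
    rw [aeval_def, eval₂_eq', Finset.sum_apply]
    exact Finset.sum_congr rfl fun m _ => by rw [Pi.smul_apply, Algebra.smul_def]
  rw [this]
  exact B.sum_mem fun m hm => B.smul_mem (hB m hm) _

/-- A slice whose normal form has a torus as stabilizer does not make single coordinates rational in
the invariants; only monomials of weight zero need to be. -/
theorem evalAt_mem_of_torusWeight [CharZero K] {Y : Type*} (B : Subalgebra K (Y → L))
    (x : Y → CoordPoint L d)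
    (hB : ∀ m : CoordIdx d →₀ ℕ, torusWeight m = 0 → (fun y => ∏ c, x y c.1 c.2 ^ m c) ∈ B)
    {p : CoordRing K d} (hp : p ∈ invariants K d) : (fun y => evalAt (x y) p) ∈ B := by
  unfold evalAt
  exact aeval_mem_of_forall_mem_support B (fun y (c : CoordIdx d) => x y c.1 c.2)
    fun m hm => hB m (torusWeight_eq_zero hp hm)

theorem exists_even_odd {m : ℕ} (Q : MvPolynomial (Fin (m + 1)) K) :
    ∃ Q₀ Q₁ : MvPolynomial (Fin (m + 1)) K, ∀ (t : L) (u : Fin m → L),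
      aeval (Fin.cons t u : Fin (m + 1) → L) Q = aeval (Fin.cons (t ^ 2) u : Fin (m + 1) → L) Q₀ +
        t * aeval (Fin.cons (t ^ 2) u : Fin (m + 1) → L) Q₁ := by
  induction Q using MvPolynomial.induction_on with
  | C a => exact ⟨C a, 0, fun t u => by simp⟩
  | add p q hp hq =>
    obtain ⟨p₀, p₁, hp⟩ := hp
    obtain ⟨q₀, q₁, hq⟩ := hq
    refine ⟨p₀ + q₀, p₁ + q₁, fun t u => ?_⟩
    rw [map_add, map_add, map_add, hp, hq]
    ring
  | mul_X p i hp =>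
    obtain ⟨p₀, p₁, hp⟩ := hp
    refine Fin.cases ⟨p₁ * X 0, p₀, fun t u => ?_⟩ (fun i => ⟨p₀ * X i.succ, p₁ * X i.succ,
      fun t u => ?_⟩) i
    · rw [map_mul, map_mul, hp]
      simp only [aeval_X, Fin.cons_zero]
      ring
    · rw [map_mul, map_mul, map_mul, hp]
      simp only [aeval_X, Fin.cons_succ]
      ring

/-- The parameter `t` is a square root of the invariant `Φ i`. Averaging over the symmetry `σ`,
which changes the sign of `t` and fixes everything else, removes its odd powers. -/
theorem exists_of_mem_localized_of_even [CharZero L] {Y : Type*} {m : ℕ} {S : Set Y} {Φ : Y → Fin m → L}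
    {t g : Y → L} {i : Fin m} (σ : Y → Y) (hS : ∀ y ∈ S, σ y ∈ S) (ht : ∀ y ∈ S, t (σ y) = - t y)
    (hΦ : ∀ y ∈ S, Φ (σ y) = Φ y) (hg : ∀ y ∈ S, g (σ y) = g y) (hi : ∀ y ∈ S, Φ y i = t y ^ 2)
    (h : g ∈ localized (K := K) S (fun y => (Fin.cons (t y) (Φ y) : Fin (m + 1) → L)) (X 0)) :
    ∃ (N : ℕ) (Q : MvPolynomial (Fin m) K), ∀ y ∈ S, Φ y i ^ N * g y = aeval (Φ y) Q := by
  obtain ⟨N, Q, hQ⟩ := h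
  obtain ⟨Q₀, Q₁, hQ'⟩ := exists_even_odd (L := L) (X 0 ^ N * Q)
  refine ⟨N, aeval (Fin.cons (X i) X : Fin (m + 1) → MvPolynomial (Fin m) K) Q₀, fun y hy => ?_⟩
  have h1 : ∀ y ∈ S, t y ^ (2 * N) * g y = aeval (Fin.cons (t y ^ 2) (Φ y) : Fin (m + 1) → L) Q₀ +
        t y * aeval (Fin.cons (t y ^ 2) (Φ y) : Fin (m + 1) → L) Q₁ := by
    intro y hy
    rw [← hQ', map_mul, ← hQ y hy, map_pow, aeval_X, Fin.cons_zero]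
    ring
  have h2 := h1 _ (hS y hy)
  rw [ht y hy, hΦ y hy, hg y hy, neg_sq, pow_mul, neg_sq] at h2
  have h3 := h1 y hy
  have h4 : aeval (Φ y) (aeval (Fin.cons (X i) X : Fin (m + 1) → MvPolynomial (Fin m) K) Q₀) =
      aeval (Fin.cons (t y ^ 2) (Φ y) : Fin (m + 1) → L) Q₀ := by
    rw [← AlgHom.comp_apply, comp_aeval]
    congr 2
    funext j
    refine Fin.cases ?_ (fun j => ?_) j <;> simp [hi y hy]
  rw [h4, hi y hy]
  rw [pow_mul] at h3
  linear_combination (h2 + h3) / 2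

theorem prod_coordIdx₂ {M : Type*} [CommMonoid M] {e₀ e₁ : ℕ} (F : CoordIdx ![e₀, e₁] → M) :
    ∏ c, F c = (∏ j : Fin (e₀ + 1), F ⟨0, j⟩) * ∏ j : Fin (e₁ + 1), F ⟨1, j⟩ := by
  rw [Fintype.prod_sigma, Fin.prod_univ_two]
  rfl

theorem prod_coordIdx₃ {M : Type*} [CommMonoid M] {e₀ e₁ e₂ : ℕ}
    (F : CoordIdx ![e₀, e₁, e₂] → M) :
    ∏ c, F c = (∏ j : Fin (e₀ + 1), F ⟨0, j⟩) * (∏ j : Fin (e₁ + 1), F ⟨1, j⟩) *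
      ∏ j : Fin (e₂ + 1), F ⟨2, j⟩ := by
  rw [Fintype.prod_sigma, Fin.prod_univ_three]
  rfl

theorem sum_coordIdx₂ {M : Type*} [AddCommMonoid M] {e₀ e₁ : ℕ} (F : CoordIdx ![e₀, e₁] → M) :
    ∑ c, F c = (∑ j : Fin (e₀ + 1), F ⟨0, j⟩) + ∑ j : Fin (e₁ + 1), F ⟨1, j⟩ := by
  rw [Fintype.sum_sigma, Fin.sum_univ_two]
  rfl

theorem sum_coordIdx₃ {M : Type*} [AddCommMonoid M] {e₀ e₁ e₂ : ℕ}
    (F : CoordIdx ![e₀, e₁, e₂] → M) :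
    ∑ c, F c = (∑ j : Fin (e₀ + 1), F ⟨0, j⟩) + (∑ j : Fin (e₁ + 1), F ⟨1, j⟩) +
      ∑ j : Fin (e₂ + 1), F ⟨2, j⟩ := by
  rw [Fintype.sum_sigma, Fin.sum_univ_three]
  rfl

end Weights

/-! ### A quadratic form and a cubic form -/

/-- Generating invariants of a quadratic form and a cubic form. -/
def quadraticCubic {R : Type*} [CommRing R] (q : Fin 3 → R) (f : Fin 4 → R) : Fin 5 → R :=
  ![4 * evalQuadratic (jacobian q (hessianCubic f)) (transvectCubic f q), polarDisc q q,
    polarDisc q (hessianCubic f), evalQuadratic q (transvectCubic f q),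
    polarDisc (hessianCubic f) (hessianCubic f)]

theorem isInvariantFamily_quadraticCubic :
    IsInvariantFamily.{u} (d := ![2, 3]) (fun x => quadraticCubic (x 0) (x 1)) ![7, 2, 3, 5, 4] :=
  .of_pair
    (fun φ q f i => by
      fin_cases i <;> simp [quadraticCubic, jacobian, transvectCubic, hessianCubic, evalQuadratic,
        polarDisc, map_ofNat])
    (fun t q f => by
      simp only [quadraticCubic, jacobian_shear, hessianCubic_shear, transvectCubic_shear,
        evalQuadratic_shear, polarDisc_shear])
    (fun q f => by
      simp only [quadraticCubic, jacobian_flip, hessianCubic_flip, transvectCubic_flip,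
        evalQuadratic_flip, polarDisc_flip])
    (fun s q f i => by
      fin_cases i <;> simp [quadraticCubic, jacobian, transvectCubic, hessianCubic, evalQuadratic,
        polarDisc] <;> ring)

section QuadraticCubic

variable (K : Type u) [Field K] [CharZero K]

/-- Normal forms of a quadratic form and a cubic form. -/
def sliceQuadraticCubic (L : Type u) [Field L] : Set (CoordPoint L ![2, 3]) :=
  {y | ∃ (t : L) (f : Fin 4 → L), t ≠ 0 ∧ y = point₂ ![0, t, 0] f}

theorem quadraticCubic_slice {R : Type*} [CommRing R] (t : R) (f : Fin 4 → R) :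
    quadraticCubic ![0, t, 0] f =
      ![12 * t ^ 3 * (f 1 ^ 3 * f 3 - f 0 * f 2 ^ 3), t ^ 2, t * (9 * (f 0 * f 3) - f 1 * f 2),
        - t ^ 3 * (f 1 * f 2), 81 * (f 0 * f 3) ^ 2 - 54 * (f 0 * f 3) * (f 1 * f 2) -
          3 * (f 1 * f 2) ^ 2 + 12 * (f 0 * f 2 ^ 3 + f 1 ^ 3 * f 3)] := by
  ext i
  fin_cases i <;> simp [quadraticCubic, jacobian, transvectCubic, hessianCubic, evalQuadratic,
    polarDisc] <;> ring

theorem isSlice_quadraticCubic {L : Type u} [Field L] [CharZero L] [IsAlgClosed L] [Algebra K L] :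
    IsSlice K (sliceQuadraticCubic L) := by
  have hΦ := isInvariantFamily_quadraticCubic.{u}
  refine ⟨(hΦ.toInvariants K 1).1, ?_, ?_⟩
  · intro h0
    have := congrArg (evalAt (point₂ ![0, 1, 0] ![0, 0, 0, 0] : CoordPoint K ![2, 3])) h0
    rw [hΦ.evalAt_toInvariants K] at this
    change quadraticCubic ![0, 1, 0] ![0, 0, 0, 0] 1 = _ at this
    simp [quadraticCubic, polarDisc] at this
  · intro x hx
    obtain ⟨q, f, rfl⟩ := exists_eq_point₂ x
    rw [hΦ.evalAt_toInvariants K] at hx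
    obtain ⟨τ, t, hτ, ht, hτq⟩ := exists_isMove_quadratic (K := K) (q := q) hx
    have h1 := hτ.pair q f
    rw [hτq] at h1
    exact ⟨_, ⟨t, _, ht, rfl⟩, h1⟩

/-- The coordinates `a, b, c, d` of a cubic have weights `3, 1, -1, -3`; the four products generate
all monomials of weight zero. -/
theorem monomial_mem_of_cubic_weight {K Y L : Type*} [Field K] [Field L] [Algebra K L]
    (B : Subalgebra K (Y → L)) {a b c d : Y → L} (had : a * d ∈ B) (hbc : b * c ∈ B)
    (hac : a * c ^ 3 ∈ B) (hbd : b ^ 3 * d ∈ B) {i j k l : ℕ} (h : 3 * i + j = k + 3 * l) :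
    a ^ i * b ^ j * c ^ k * d ^ l ∈ B := by
  obtain hil | hil := le_total l i
  · obtain ⟨r, rfl⟩ := Nat.exists_eq_add_of_le hil
    obtain rfl : k = 3 * r + j := by omega
    have : a ^ (l + r) * b ^ j * c ^ (3 * r + j) * d ^ l =
        (a * d) ^ l * (a * c ^ 3) ^ r * (b * c) ^ j := by ring
    rw [this]
    exact B.mul_mem (B.mul_mem (B.pow_mem had _) (B.pow_mem hac _)) (B.pow_mem hbc _)
  · obtain ⟨r, rfl⟩ := Nat.exists_eq_add_of_le hil
    obtain rfl : j = 3 * r + k := by omega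
    have : a ^ i * b ^ (3 * r + k) * c ^ k * d ^ (i + r) =
        (a * d) ^ i * (b ^ 3 * d) ^ r * (b * c) ^ k := by ring
    rw [this]
    exact B.mul_mem (B.mul_mem (B.pow_mem had _) (B.pow_mem hbd _)) (B.pow_mem hbc _)

theorem exists_of_mem_invariants_quadraticCubic {L : Type u} [Field L] [CharZero L] [Algebra K L]
    {p : CoordRing K ![2, 3]} (hp : p ∈ invariants K ![2, 3]) :
    ∃ (N : ℕ) (Q : MvPolynomial (Fin 5) K), ∀ y ∈ sliceQuadraticCubic L,
      quadraticCubic (y 0) (y 1) 1 ^ N * evalAt y p = aeval (quadraticCubic (y 0) (y 1)) Q := by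
  let x : L × (Fin 4 → L) → CoordPoint L ![2, 3] := fun v => point₂ ![0, v.1, 0] v.2
  let Φ : L × (Fin 4 → L) → Fin 5 → L := fun v => quadraticCubic ![0, v.1, 0] v.2
  let Ψ : L × (Fin 4 → L) → Fin 6 → L := fun v => Fin.cons v.1 (Φ v)
  have hΨ : ∀ v, Ψ v = ![v.1, 12 * v.1 ^ 3 * (v.2 1 ^ 3 * v.2 3 - v.2 0 * v.2 2 ^ 3), v.1 ^ 2,
      v.1 * (9 * (v.2 0 * v.2 3) - v.2 1 * v.2 2), - v.1 ^ 3 * (v.2 1 * v.2 2),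
      81 * (v.2 0 * v.2 3) ^ 2 - 54 * (v.2 0 * v.2 3) * (v.2 1 * v.2 2) -
        3 * (v.2 1 * v.2 2) ^ 2 + 12 * (v.2 0 * v.2 2 ^ 3 + v.2 1 ^ 3 * v.2 3)] := fun v => by
    simp only [Ψ, Φ, quadraticCubic_slice]
    rfl
  let B := localized (K := K) Set.univ Ψ (X 0)
  have key : ∀ (g : L × (Fin 4 → L) → L) (N : ℕ) (Q : MvPolynomial (Fin 6) K),
      (∀ v, v.1 ^ N * g v = aeval (Ψ v) Q) → g ∈ B := fun g N Q h =>
    mem_localized N Q fun v _ => by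
      rw [← h, aeval_X]
      rfl
  -- With `a, b, c, d` the coefficients of the cubic: `P` represents `t³ a d`, `P'` represents `t⁶
  -- (a c³ + b³ d)`, and `P''` represents `t³ (b³ d - a c³)`.
  let P : MvPolynomial (Fin 6) K := C (1 / 9) * (X 0 ^ 2 * X 3 - X 4)
  let P' : MvPolynomial (Fin 6) K :=
    C (1 / 12) * (X 0 ^ 6 * X 5 - 81 * P ^ 2 - 54 * P * X 4 + 3 * X 4 ^ 2)
  let P'' : MvPolynomial (Fin 6) K := C (1 / 12) * X 1
  have ht : (fun v : L × (Fin 4 → L) => v.1) ∈ B := key _ 0 (X 0) fun v => by simp [hΨ]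
  have had : (fun v : L × (Fin 4 → L) => v.2 0) * (fun v => v.2 3) ∈ B := key _ 3 P fun v => by
    simp [hΨ, P, map_ofNat]; ring
  have hbc : (fun v : L × (Fin 4 → L) => v.2 1) * (fun v => v.2 2) ∈ B :=
    key _ 3 (- X 4) fun v => by simp [hΨ]
  have hac : (fun v : L × (Fin 4 → L) => v.2 0) * (fun v => v.2 2) ^ 3 ∈ B :=
    key _ 6 (C (1 / 2) * (P' - X 0 ^ 3 * P'')) fun v => by
      simp [hΨ, P, P', P'', map_ofNat]; ring
  have hbd : (fun v : L × (Fin 4 → L) => v.2 1) ^ 3 * (fun v => v.2 3) ∈ B :=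
    key _ 6 (C (1 / 2) * (P' + X 0 ^ 3 * P'')) fun v => by
      simp [hΨ, P, P', P'', map_ofNat]; ring
  have hm : ∀ m : CoordIdx ![2, 3] →₀ ℕ, torusWeight m = 0 →
      (fun v => ∏ c, x v c.1 c.2 ^ m c) ∈ B := by
    intro m hm
    have h1 : ∀ v, ∏ c, x v c.1 c.2 ^ m c = 0 ^ m ⟨0, 0⟩ * v.1 ^ m ⟨0, 1⟩ * 0 ^ m ⟨0, 2⟩ *
        (v.2 0 ^ m ⟨1, 0⟩ * v.2 1 ^ m ⟨1, 1⟩ * v.2 2 ^ m ⟨1, 2⟩ * v.2 3 ^ m ⟨1, 3⟩) := fun v => by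
      rw [prod_coordIdx₂, Fin.prod_univ_three, Fin.prod_univ_four]
      rfl
    rw [torusWeight, sum_coordIdx₂, Fin.sum_univ_three, Fin.sum_univ_four] at hm
    by_cases h00 : m ⟨0, 0⟩ = 0
    · by_cases h02 : m ⟨0, 2⟩ = 0
      · have hm' : 3 * m ⟨1, 0⟩ + m ⟨1, 1⟩ = m ⟨1, 2⟩ + 3 * m ⟨1, 3⟩ := by
          simp at hm
          have hm2 : 2 * (m ⟨0, 0⟩ : ℤ) + -(2 * m ⟨0, 2⟩) +
            (3 * m ⟨1, 0⟩ + m ⟨1, 1⟩ + -m ⟨1, 2⟩ + -(3 * m ⟨1, 3⟩)) = 0 := hm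
          omega
        refine mem_localized_of_eq (B.mul_mem (B.pow_mem ht (m ⟨0, 1⟩))
          (monomial_mem_of_cubic_weight B had hbc hac hbd hm')) fun v _ => ?_
        rw [h1, h00, h02]
        simp
      · exact mem_localized_of_eq B.zero_mem fun v _ => by rw [h1, zero_pow h02]; simp
    · exact mem_localized_of_eq B.zero_mem fun v _ => by rw [h1, zero_pow h00]; simp
  -- The flip preserves the slice and replaces `t` by `-t`.
  have hΦ : ∀ v : L × (Fin 4 → L), Φ (- v.1, flip 3 v.2) = Φ v := fun v => by
    funext i
    have : quadraticCubic (flip 2 ![0, v.1, 0]) (flip 3 v.2) i =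
      quadraticCubic ![0, v.1, 0] v.2 i := isInvariantFamily_quadraticCubic.flip_eq (x v) i
    simpa [Φ, flip_two] using this
  have hg : ∀ v : L × (Fin 4 → L), evalAt (x (- v.1, flip 3 v.2)) p = evalAt (x v) p := fun v => by
    have := (isMove_flip (K := K) (L := L)).pair ![0, v.1, 0] v.2 p hp
    simpa [x, flip_two] using this.symm
  obtain ⟨N, Q, hQ⟩ := exists_of_mem_localized_of_even (S := Set.univ) (Φ := Φ)
    (t := fun v => v.1) (g := fun v => evalAt (x v) p) (i := 1) (fun v => (- v.1, flip 3 v.2))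
    (fun _ _ => trivial) (fun _ _ => rfl) (fun v _ => hΦ v) (fun v _ => hg v)
    (fun v _ => by simp [Φ, quadraticCubic_slice]) (evalAt_mem_of_torusWeight B x hm hp)
  refine ⟨N, Q, ?_⟩
  rintro _ ⟨t, f, ht, rfl⟩
  exact hQ (t, f) trivial

theorem isHypersurfaceOfDegree_quadraticCubic_of_isAlgClosed (L : Type u) [Field L] [CharZero L]
    [IsAlgClosed L] [Algebra K L] : IsHypersurfaceOfDegree K ![2, 3] 14 := by
  refine isHypersurfaceOfDegree_of_quadratic (L := L) isInvariantFamily_quadraticCubic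
    (sliceQuadraticCubic L) (isSlice_quadraticCubic K) ?_
    -- This is the relation for a linear form `l` and two quadratic forms, applied to the
    -- transvectant `l`, to `q` and to the Hessian `H`. The value of `H` at the zero of `l` has been
    -- replaced by a quarter of `(q, q) (H, H) - (q, H)²`, for the polar form.
    (X 0 ^ 3 * X 3 ^ 2 - 2 * X 0 ^ 2 * X 3 * X 1 ^ 2 + X 0 * X 1 ^ 4 - 8 * X 0 * X 3 * X 1 * X 2 +
      8 * X 1 ^ 3 * X 2 + 16 * X 3 * X 2 ^ 2) ?_
    (fun p hp => exists_of_mem_invariants_quadraticCubic K hp)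
    (X 2) ![0, 0, 1, 1] rfl ?_ ?_ ?_ ?_ rfl ?_
  · rintro _ ⟨t, f, ht, rfl⟩
    have h : quadraticCubic ![0, t, 0] f 1 ≠ 0 := by simp [quadraticCubic_slice, ht]
    exact h
  · rintro _ ⟨t, f, ht, rfl⟩
    have h := quadraticCubic_slice t f
    generalize hv : quadraticCubic ![0, t, 0] f = v at h
    have h' : quadraticCubic (point₂ ![0, t, 0] f 0) (point₂ ![0, t, 0] f 1) = v := hv
    rw [h', h]
    simp [Fin.succ, map_ofNat]
    ring
  · simp
  · simp
  · intro u z h0 hu hz0 hz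
    simp only [aeval_X] at hu
    simp [h0, map_ofNat] at hz
    suffices h : ∃ q f, quadraticCubic q f = ![z, 0, u 1, u 2, u 3] by
      obtain ⟨q, f, h⟩ := h
      exact ⟨point₂ q f, h.trans (by ext i; fin_cases i <;> first | rfl | exact h0.symm)⟩
    -- For `q = y²` and coefficients `(a, 0, c, d)` one has `u 2 = 9 a²`, `u 1 = -6 a c` and `z =
    -- -324 a³ d`. The remaining invariant `u 3` is forced by the relation.
    obtain ⟨a, ha⟩ := IsAlgClosed.exists_pow_nat_eq (u 2 / 9) two_pos
    have ha2 : u 2 = 9 * a ^ 2 := by rw [ha]; ring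
    have ha0 : a ≠ 0 := by
      rintro rfl
      exact hu (by rw [ha2]; ring)
    refine ⟨![0, 0, 1], ![a, 0, - u 1 / (6 * a), - z / (324 * a ^ 3)], ?_⟩
    rw [ha2] at hz
    ext i
    fin_cases i <;> simp [quadraticCubic, jacobian, transvectCubic, hessianCubic, evalQuadratic,
      polarDisc]
    · field_simp
      ring
    · field_simp
      ring
    · linear_combination - ha2
    · field_simp
      linear_combination 17496 * hz
  · intro i; fin_cases i <;> simp
  · intro u
    simp [Fin.succ, map_ofNat]
    ring

theorem isHypersurfaceOfDegree_quadraticCubic : IsHypersurfaceOfDegree K ![2, 3] 14 :=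
  isHypersurfaceOfDegree_quadraticCubic_of_isAlgClosed K (AlgebraicClosure K)

end QuadraticCubic

/-! ### A quadratic form and a quartic form -/

/-- Generating invariants of a quadratic form and a quartic form. -/
def quadraticQuartic {R : Type*} [CommRing R] (q : Fin 3 → R) (f : Fin 5 → R) : Fin 6 → R :=
  ![polarDisc (jacobian q (transvectQuartic f q)) (transvectQuartic f (transvectQuartic f q)),
    polarDisc q q, quarticI f, quarticJ f, polarDisc q (transvectQuartic f q),
    polarDisc (transvectQuartic f q) (transvectQuartic f q)]

theorem isInvariantFamily_quadraticQuartic :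
    IsInvariantFamily.{u} (d := ![2, 4]) (fun x => quadraticQuartic (x 0) (x 1))
      ![6, 2, 2, 3, 3, 4] :=
  .of_pair
    (fun φ q f i => by
      fin_cases i <;> simp [quadraticQuartic, jacobian, transvectQuartic, polarDisc, quarticI,
        quarticJ, map_ofNat])
    (fun t q f => by
      simp only [quadraticQuartic, jacobian_shear, transvectQuartic_shear, quarticI_shear,
        quarticJ_shear, polarDisc_shear])
    (fun q f => by
      simp only [quadraticQuartic, jacobian_flip, transvectQuartic_flip, quarticI_flip,
        quarticJ_flip, polarDisc_flip])
    (fun s q f i => by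
      fin_cases i <;> simp [quadraticQuartic, jacobian, transvectQuartic, polarDisc, quarticI,
        quarticJ] <;> ring)

section QuadraticQuartic

variable (K : Type u) [Field K] [CharZero K]

/-- Normal forms of a quadratic form and a quartic form. -/
def sliceQuadraticQuartic (L : Type u) [Field L] : Set (CoordPoint L ![2, 4]) :=
  {y | ∃ (t : L) (f : Fin 5 → L), t ≠ 0 ∧ y = point₂ ![0, t, 0] f}

theorem quadraticQuartic_slice {R : Type*} [CommRing R] (t : R) (f : Fin 5 → R) :
    quadraticQuartic ![0, t, 0] f =
      ![216 * t ^ 3 * (f 1 ^ 2 * f 4 - f 0 * f 3 ^ 2), t ^ 2,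
        12 * (f 0 * f 4) - 3 * (f 1 * f 3) + f 2 ^ 2,
        72 * f 2 * (f 0 * f 4) + 9 * f 2 * (f 1 * f 3) - 27 * (f 0 * f 3 ^ 2 + f 1 ^ 2 * f 4) -
          2 * f 2 ^ 3, - 4 * t ^ 2 * f 2, 16 * t ^ 2 * f 2 ^ 2 - 36 * t ^ 2 * (f 1 * f 3)] := by
  ext i
  fin_cases i <;> simp [quadraticQuartic, jacobian, transvectQuartic, polarDisc, quarticI,
    quarticJ] <;> ring

theorem isSlice_quadraticQuartic {L : Type u} [Field L] [CharZero L] [IsAlgClosed L] [Algebra K L] :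
    IsSlice K (sliceQuadraticQuartic L) := by
  have hΦ := isInvariantFamily_quadraticQuartic.{u}
  refine ⟨(hΦ.toInvariants K 1).1, ?_, ?_⟩
  · intro h0
    have := congrArg (evalAt (point₂ ![0, 1, 0] ![0, 0, 0, 0, 0] : CoordPoint K ![2, 4])) h0
    rw [hΦ.evalAt_toInvariants K] at this
    change quadraticQuartic ![0, 1, 0] ![0, 0, 0, 0, 0] 1 = _ at this
    simp [quadraticQuartic, polarDisc] at this
  · intro x hx
    obtain ⟨q, f, rfl⟩ := exists_eq_point₂ x
    rw [hΦ.evalAt_toInvariants K] at hx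
    obtain ⟨τ, t, hτ, ht, hτq⟩ := exists_isMove_quadratic (K := K) (q := q) hx
    have h1 := hτ.pair q f
    rw [hτq] at h1
    exact ⟨_, ⟨t, _, ht, rfl⟩, h1⟩

/-- The coordinates `a, …, e` of a quartic have halved weights `2, 1, 0, -1, -2`, and the five
listed elements generate the monomials of weight zero. -/
theorem monomial_mem_of_quartic_weight {K Y L : Type*} [Field K] [Field L] [Algebra K L]
    (B : Subalgebra K (Y → L)) {a b c d e : Y → L} (hc : c ∈ B) (hae : a * e ∈ B)
    (hbd : b * d ∈ B) (had : a * d ^ 2 ∈ B) (hbe : b ^ 2 * e ∈ B) {i j k l n : ℕ}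
    (h : 2 * i + j = l + 2 * n) : a ^ i * b ^ j * c ^ k * d ^ l * e ^ n ∈ B := by
  obtain hni | hni := le_total n i
  · obtain ⟨r, rfl⟩ := Nat.exists_eq_add_of_le hni
    obtain rfl : l = 2 * r + j := by omega
    have : a ^ (n + r) * b ^ j * c ^ k * d ^ (2 * r + j) * e ^ n =
        c ^ k * (a * e) ^ n * (a * d ^ 2) ^ r * (b * d) ^ j := by ring
    rw [this]
    exact B.mul_mem (B.mul_mem (B.mul_mem (B.pow_mem hc _) (B.pow_mem hae _)) (B.pow_mem had _))
      (B.pow_mem hbd _)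
  · obtain ⟨r, rfl⟩ := Nat.exists_eq_add_of_le hni
    obtain rfl : j = 2 * r + l := by omega
    have : a ^ i * b ^ (2 * r + l) * c ^ k * d ^ l * e ^ (i + r) =
        c ^ k * (a * e) ^ i * (b ^ 2 * e) ^ r * (b * d) ^ l := by ring
    rw [this]
    exact B.mul_mem (B.mul_mem (B.mul_mem (B.pow_mem hc _) (B.pow_mem hae _)) (B.pow_mem hbe _))
      (B.pow_mem hbd _)

theorem exists_of_mem_invariants_quadraticQuartic {L : Type u} [Field L] [CharZero L] [Algebra K L]
    {p : CoordRing K ![2, 4]} (hp : p ∈ invariants K ![2, 4]) :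
    ∃ (N : ℕ) (Q : MvPolynomial (Fin 6) K), ∀ y ∈ sliceQuadraticQuartic L,
      quadraticQuartic (y 0) (y 1) 1 ^ N * evalAt y p = aeval (quadraticQuartic (y 0) (y 1)) Q := by
  let x : L × (Fin 5 → L) → CoordPoint L ![2, 4] := fun v => point₂ ![0, v.1, 0] v.2
  let Φ : L × (Fin 5 → L) → Fin 6 → L := fun v => quadraticQuartic ![0, v.1, 0] v.2
  let Ψ : L × (Fin 5 → L) → Fin 7 → L := fun v => Fin.cons v.1 (Φ v)
  have hΨ : ∀ v, Ψ v = ![v.1, 216 * v.1 ^ 3 * (v.2 1 ^ 2 * v.2 4 - v.2 0 * v.2 3 ^ 2), v.1 ^ 2, 12 * (v.2 0 * v.2 4) - 3 * (v.2 1 * v.2 3) + v.2 2 ^ 2,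
        72 * v.2 2 * (v.2 0 * v.2 4) + 9 * v.2 2 * (v.2 1 * v.2 3) - 27 * (v.2 0 * v.2 3 ^ 2 + v.2 1 ^ 2 * v.2 4) -
          2 * v.2 2 ^ 3, - 4 * v.1 ^ 2 * v.2 2, 16 * v.1 ^ 2 * v.2 2 ^ 2 - 36 * v.1 ^ 2 * (v.2 1 * v.2 3)] := fun v => by
    simp only [Ψ, Φ, quadraticQuartic_slice]
    rfl
  let B := localized (K := K) Set.univ Ψ (X 0)
  have key : ∀ (g : L × (Fin 5 → L) → L) (N : ℕ) (Q : MvPolynomial (Fin 7) K),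
      (∀ v, v.1 ^ N * g v = aeval (Ψ v) Q) → g ∈ B := fun g N Q h =>
    mem_localized N Q fun v _ => by
      rw [← h, aeval_X]
      rfl
  -- With `a, …, e` the coefficients of the quartic, these represent `t² c`, `t⁴ b d`, `t⁴ a e`, `t⁶
  -- (a d² + b² e)` and `t³ (b² e - a d²)`.
  let P₁ : MvPolynomial (Fin 7) K := - C (1 / 4) * X 5
  let P₂ : MvPolynomial (Fin 7) K := C (1 / 36) * (X 5 ^ 2 - X 0 ^ 2 * X 6)
  let P₃ : MvPolynomial (Fin 7) K := C (1 / 12) * (X 0 ^ 4 * X 3 + 3 * P₂ - P₁ ^ 2)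
  let P₄ : MvPolynomial (Fin 7) K :=
    C (1 / 27) * (72 * P₁ * P₃ + 9 * P₁ * P₂ - 2 * P₁ ^ 3 - X 0 ^ 6 * X 4)
  let P₅ : MvPolynomial (Fin 7) K := C (1 / 216) * X 1
  have ht : (fun v : L × (Fin 5 → L) => v.1) ∈ B := key _ 0 (X 0) fun v => by simp [hΨ]
  have hc : (fun v : L × (Fin 5 → L) => v.2 2) ∈ B := key _ 2 P₁ fun v => by
    simp [hΨ, P₁, map_ofNat]; ring
  have hbd : (fun v : L × (Fin 5 → L) => v.2 1) * (fun v => v.2 3) ∈ B := key _ 4 P₂ fun v => by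
    simp [hΨ, P₂, map_ofNat]; ring
  have hae : (fun v : L × (Fin 5 → L) => v.2 0) * (fun v => v.2 4) ∈ B := key _ 4 P₃ fun v => by
    simp [hΨ, P₁, P₂, P₃, map_ofNat]; ring
  have had : (fun v : L × (Fin 5 → L) => v.2 0) * (fun v => v.2 3) ^ 2 ∈ B :=
    key _ 6 (C (1 / 2) * (P₄ - X 0 ^ 3 * P₅)) fun v => by
      simp [hΨ, P₁, P₂, P₃, P₄, P₅, map_ofNat]; ring
  have hbe : (fun v : L × (Fin 5 → L) => v.2 1) ^ 2 * (fun v => v.2 4) ∈ B :=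
    key _ 6 (C (1 / 2) * (P₄ + X 0 ^ 3 * P₅)) fun v => by
      simp [hΨ, P₁, P₂, P₃, P₄, P₅, map_ofNat]; ring
  have hm : ∀ m : CoordIdx ![2, 4] →₀ ℕ, torusWeight m = 0 →
      (fun v => ∏ c, x v c.1 c.2 ^ m c) ∈ B := by
    intro m hm
    have h1 : ∀ v, ∏ c, x v c.1 c.2 ^ m c = 0 ^ m ⟨0, 0⟩ * v.1 ^ m ⟨0, 1⟩ * 0 ^ m ⟨0, 2⟩ *
        (v.2 0 ^ m ⟨1, 0⟩ * v.2 1 ^ m ⟨1, 1⟩ * v.2 2 ^ m ⟨1, 2⟩ * v.2 3 ^ m ⟨1, 3⟩ *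
          v.2 4 ^ m ⟨1, 4⟩) := fun v => by
      rw [prod_coordIdx₂, Fin.prod_univ_three, Fin.prod_univ_five]
      rfl
    rw [torusWeight, sum_coordIdx₂, Fin.sum_univ_three, Fin.sum_univ_five] at hm
    by_cases h00 : m ⟨0, 0⟩ = 0
    · by_cases h02 : m ⟨0, 2⟩ = 0
      · have hm' : 2 * m ⟨1, 0⟩ + m ⟨1, 1⟩ = m ⟨1, 3⟩ + 2 * m ⟨1, 4⟩ := by
          simp at hm
          have hm2 : 2 * (m ⟨0, 0⟩ : ℤ) + -(2 * m ⟨0, 2⟩) +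
            (4 * m ⟨1, 0⟩ + 2 * m ⟨1, 1⟩ + -(2 * m ⟨1, 3⟩) + -(4 * m ⟨1, 4⟩)) = 0 := hm
          omega
        refine mem_localized_of_eq (B.mul_mem (B.pow_mem ht (m ⟨0, 1⟩))
          (monomial_mem_of_quartic_weight B (k := m ⟨1, 2⟩) hc hae hbd had hbe hm')) fun v _ => ?_
        rw [h1, h00, h02]
        simp
      · exact mem_localized_of_eq B.zero_mem fun v _ => by rw [h1, zero_pow h02]; simp
    · exact mem_localized_of_eq B.zero_mem fun v _ => by rw [h1, zero_pow h00]; simp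
  have hΦ : ∀ v : L × (Fin 5 → L), Φ (- v.1, flip 4 v.2) = Φ v := fun v => by
    funext i
    have : quadraticQuartic (flip 2 ![0, v.1, 0]) (flip 4 v.2) i =
      quadraticQuartic ![0, v.1, 0] v.2 i := isInvariantFamily_quadraticQuartic.flip_eq (x v) i
    simpa [Φ, flip_two] using this
  have hg : ∀ v : L × (Fin 5 → L), evalAt (x (- v.1, flip 4 v.2)) p = evalAt (x v) p := fun v => by
    have := (isMove_flip (K := K) (L := L)).pair ![0, v.1, 0] v.2 p hp
    simpa [x, flip_two] using this.symm
  obtain ⟨N, Q, hQ⟩ := exists_of_mem_localized_of_even (S := Set.univ) (Φ := Φ)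
    (t := fun v => v.1) (g := fun v => evalAt (x v) p) (i := 1) (fun v => (- v.1, flip 4 v.2))
    (fun _ _ => trivial) (fun _ _ => rfl) (fun v _ => hΦ v) (fun v _ => hg v)
    (fun v _ => by simp [Φ, quadraticQuartic_slice]) (evalAt_mem_of_torusWeight B x hm hp)
  refine ⟨N, Q, ?_⟩
  rintro _ ⟨t, f, ht, rfl⟩
  exact hQ (t, f) trivial

theorem isHypersurfaceOfDegree_quadraticQuartic_of_isAlgClosed (L : Type u) [Field L] [CharZero L]
    [IsAlgClosed L] [Algebra K L] : IsHypersurfaceOfDegree K ![2, 4] 12 := by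
  refine isHypersurfaceOfDegree_of_quadratic (L := L) isInvariantFamily_quadraticQuartic
    (sliceQuadraticQuartic L) (isSlice_quadraticQuartic K) ?_
    -- Minus the Gram determinant of `q`, `T q`, `T² q`, where `T` is transvection with the quartic.
    -- It is self-adjoint for the polar form and satisfies `T³ = 12 I T + 8 J`, which eliminates the
    -- higher products.
    (- (X 0 * X 4 * (12 * X 1 * X 4 + 8 * X 2 * X 3) - X 0 * (12 * X 1 * X 3 + 8 * X 2 * X 0) ^ 2 -
      X 3 ^ 2 * (12 * X 1 * X 4 + 8 * X 2 * X 3) +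
      2 * X 3 * X 4 * (12 * X 1 * X 3 + 8 * X 2 * X 0) - X 4 ^ 3)) ?_
    (fun p hp => exists_of_mem_invariants_quadraticQuartic K hp)
    (X 3) ![0, 0, 1, 1, 0] rfl ?_ ?_ ?_ ?_ rfl ?_
  · rintro _ ⟨t, f, ht, rfl⟩
    have h : quadraticQuartic ![0, t, 0] f 1 ≠ 0 := by simp [quadraticQuartic_slice, ht]
    exact h
  · rintro _ ⟨t, f, ht, rfl⟩
    have h := quadraticQuartic_slice t f
    generalize hv : quadraticQuartic ![0, t, 0] f = v at h
    have h' : quadraticQuartic (point₂ ![0, t, 0] f 0) (point₂ ![0, t, 0] f 1) = v := hv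
    rw [h', h]
    simp [Fin.succ, map_ofNat]
    ring
  · simp
  · simp
  · intro u z h0 hu hz0 hz
    simp only [aeval_X] at hu
    simp [h0, map_ofNat] at hz
    suffices h : ∃ q f, quadraticQuartic q f = ![z, 0, u 1, u 2, u 3, u 4] by
      obtain ⟨q, f, h⟩ := h
      exact ⟨point₂ q f, h.trans (by ext i; fin_cases i <;> first | rfl | exact h0.symm)⟩
    -- For `q = y²` and coefficients `(a, 0, c, d, e)` one has `u 3 = -24 a`, `u 4 = -96 a c` and `u
    -- 1 = 12 a e + c²`; `z` determines `d`, and the relation gives `u 2`.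
    obtain ⟨a, ha⟩ : ∃ a, a = - u 3 / 24 := ⟨_, rfl⟩
    have ha3 : u 3 = - 24 * a := by rw [ha]; ring
    have ha0 : a ≠ 0 := by
      rintro rfl
      exact hu (by rw [ha3]; ring)
    obtain ⟨c, hc⟩ : ∃ c, c = - u 4 / (96 * a) := ⟨_, rfl⟩
    have hc4 : u 4 = - 96 * a * c := by
      rw [hc]
      field_simp
    refine ⟨![0, 0, 1], ![a, 0, c, - z / (1728 * a ^ 2), (u 1 - c ^ 2) / (12 * a)], ?_⟩
    rw [ha3, hc4] at hz
    ext i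
    fin_cases i <;> simp [quadraticQuartic, jacobian, transvectQuartic, quarticI, quarticJ,
      polarDisc]
    · field_simp
      ring
    · field_simp
      ring
    · field_simp
      linear_combination - 324 * hz
    · linear_combination - ha3
    · linear_combination - hc4
  · intro i; fin_cases i <;> simp
  · intro u
    simp [Fin.succ, map_ofNat]
    ring

theorem isHypersurfaceOfDegree_quadraticQuartic : IsHypersurfaceOfDegree K ![2, 4] 12 :=
  isHypersurfaceOfDegree_quadraticQuartic_of_isAlgClosed K (AlgebraicClosure K)

end QuadraticQuartic

/-! ### Three quadratic forms -/

/-- Generating invariants of three quadratic forms. -/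
def threeQuadratic {R : Type*} [CommRing R] (q r s : Fin 3 → R) : Fin 7 → R :=
  ![polarDisc (jacobian q r) s, polarDisc q q, polarDisc q r, polarDisc q s, polarDisc r r,
    polarDisc r s, polarDisc s s]

theorem isInvariantFamily_threeQuadratic :
    IsInvariantFamily.{u} (d := ![2, 2, 2]) (fun x => threeQuadratic (x 0) (x 1) (x 2))
      ![3, 2, 2, 2, 2, 2, 2] :=
  .of_triple
    (fun φ q r s i => by fin_cases i <;> simp [threeQuadratic, jacobian, polarDisc, map_ofNat])
    (fun t q r s => by simp only [threeQuadratic, jacobian_shear, polarDisc_shear])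
    (fun q r s => by simp only [threeQuadratic, jacobian_flip, polarDisc_flip])
    (fun t q r s i => by fin_cases i <;> simp [threeQuadratic, jacobian, polarDisc] <;> ring)

section ThreeQuadratic

variable (K : Type u) [Field K] [CharZero K]

/-- Normal forms of three quadratic forms. -/
def sliceThreeQuadratic (L : Type u) [Field L] : Set (CoordPoint L ![2, 2, 2]) :=
  {y | ∃ (t : L) (r s : Fin 3 → L), t ≠ 0 ∧ y = point₃ ![0, t, 0] r s}

theorem threeQuadratic_slice {R : Type*} [CommRing R] (t : R) (r s : Fin 3 → R) :
    threeQuadratic ![0, t, 0] r s =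
      ![2 * t * (r 0 * s 2 - r 2 * s 0), t ^ 2, t * r 1, t * s 1, r 1 ^ 2 - 4 * (r 0 * r 2),
        r 1 * s 1 - 2 * (r 0 * s 2 + r 2 * s 0), s 1 ^ 2 - 4 * (s 0 * s 2)] := by
  ext i
  fin_cases i <;> simp [threeQuadratic, jacobian, polarDisc] <;> ring

theorem isSlice_threeQuadratic {L : Type u} [Field L] [CharZero L] [IsAlgClosed L] [Algebra K L] :
    IsSlice K (sliceThreeQuadratic L) := by
  have hΦ := isInvariantFamily_threeQuadratic.{u}
  refine ⟨(hΦ.toInvariants K 1).1, ?_, ?_⟩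
  · intro h0
    have := congrArg (evalAt (point₃ ![0, 1, 0] ![0, 0, 0] ![0, 0, 0] :
      CoordPoint K ![2, 2, 2])) h0
    rw [hΦ.evalAt_toInvariants K] at this
    change threeQuadratic ![0, 1, 0] ![0, 0, 0] ![0, 0, 0] 1 = _ at this
    simp [threeQuadratic, polarDisc] at this
  · intro x hx
    obtain ⟨q, r, s, rfl⟩ := exists_eq_point₃ x
    rw [hΦ.evalAt_toInvariants K] at hx
    obtain ⟨τ, t, hτ, ht, hτq⟩ := exists_isMove_quadratic (K := K) (q := q) hx
    have h1 := hτ.triple q r s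
    rw [hτq] at h1
    exact ⟨_, ⟨t, _, _, ht, rfl⟩, h1⟩

theorem monomial_mem_of_quadratic_weight {K Y L : Type*} [Field K] [Field L] [Algebra K L]
    (B : Subalgebra K (Y → L)) {a b c a' b' c' : Y → L} (hb : b ∈ B) (hb' : b' ∈ B)
    (hac : a * c ∈ B) (hac' : a * c' ∈ B) (hca' : c * a' ∈ B) (ha'c' : a' * c' ∈ B)
    {i j k i' j' k' : ℕ} (h : i + i' = k + k') :
    a ^ i * b ^ j * c ^ k * (a' ^ i' * b' ^ j' * c' ^ k') ∈ B := by
  obtain hki | hki := le_total k i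
  · obtain ⟨r, rfl⟩ := Nat.exists_eq_add_of_le hki
    obtain rfl : k' = r + i' := by omega
    have : a ^ (k + r) * b ^ j * c ^ k * (a' ^ i' * b' ^ j' * c' ^ (r + i')) =
        b ^ j * b' ^ j' * (a * c) ^ k * (a * c') ^ r * (a' * c') ^ i' := by ring
    rw [this]
    exact B.mul_mem (B.mul_mem (B.mul_mem (B.mul_mem (B.pow_mem hb _) (B.pow_mem hb' _))
      (B.pow_mem hac _)) (B.pow_mem hac' _)) (B.pow_mem ha'c' _)
  · obtain ⟨r, rfl⟩ := Nat.exists_eq_add_of_le hki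
    obtain rfl : i' = r + k' := by omega
    have : a ^ i * b ^ j * c ^ (i + r) * (a' ^ (r + k') * b' ^ j' * c' ^ k') =
        b ^ j * b' ^ j' * (a * c) ^ i * (c * a') ^ r * (a' * c') ^ k' := by ring
    rw [this]
    exact B.mul_mem (B.mul_mem (B.mul_mem (B.mul_mem (B.pow_mem hb _) (B.pow_mem hb' _))
      (B.pow_mem hac _)) (B.pow_mem hca' _)) (B.pow_mem ha'c' _)

theorem exists_of_mem_invariants_threeQuadratic {L : Type u} [Field L] [CharZero L] [Algebra K L]
    {p : CoordRing K ![2, 2, 2]} (hp : p ∈ invariants K ![2, 2, 2]) :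
    ∃ (N : ℕ) (Q : MvPolynomial (Fin 7) K), ∀ y ∈ sliceThreeQuadratic L,
      threeQuadratic (y 0) (y 1) (y 2) 1 ^ N * evalAt y p =
        aeval (threeQuadratic (y 0) (y 1) (y 2)) Q := by
  let Y := L × (Fin 3 → L) × (Fin 3 → L)
  let x : Y → CoordPoint L ![2, 2, 2] := fun v => point₃ ![0, v.1, 0] v.2.1 v.2.2
  let Φ : Y → Fin 7 → L := fun v => threeQuadratic ![0, v.1, 0] v.2.1 v.2.2
  let Ψ : Y → Fin 8 → L := fun v => Fin.cons v.1 (Φ v)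
  have hΨ : ∀ v, Ψ v = ![v.1, 2 * v.1 * (v.2.1 0 * v.2.2 2 - v.2.1 2 * v.2.2 0), v.1 ^ 2,
      v.1 * v.2.1 1, v.1 * v.2.2 1, v.2.1 1 ^ 2 - 4 * (v.2.1 0 * v.2.1 2),
      v.2.1 1 * v.2.2 1 - 2 * (v.2.1 0 * v.2.2 2 + v.2.1 2 * v.2.2 0),
      v.2.2 1 ^ 2 - 4 * (v.2.2 0 * v.2.2 2)] := fun v => by
    simp only [Ψ, Φ, threeQuadratic_slice]
    rfl
  let B := localized (K := K) Set.univ Ψ (X 0)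
  have key : ∀ (g : Y → L) (N : ℕ) (Q : MvPolynomial (Fin 8) K),
      (∀ v, v.1 ^ N * g v = aeval (Ψ v) Q) → g ∈ B := fun g N Q h =>
    mem_localized N Q fun v _ => by
      rw [← h, aeval_X]
      rfl
  -- For outer coefficients `a, c` and `a', c'` of the last two forms, `P` and `P'` represent `t²`
  -- times the sum and difference of `a c'` and `c a'`.
  let P : MvPolynomial (Fin 8) K := C (1 / 2) * (X 3 * X 4 - X 0 ^ 2 * X 6)
  let P' : MvPolynomial (Fin 8) K := C (1 / 2) * X 0 * X 1
  have ht : (fun v : Y => v.1) ∈ B := key _ 0 (X 0) fun v => by simp [hΨ]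
  have hb : (fun v : Y => v.2.1 1) ∈ B := key _ 1 (X 3) fun v => by simp [hΨ]
  have hb' : (fun v : Y => v.2.2 1) ∈ B := key _ 1 (X 4) fun v => by simp [hΨ]
  have hac : (fun v : Y => v.2.1 0) * (fun v : Y => v.2.1 2) ∈ B :=
    key _ 2 (C (1 / 4) * (X 3 ^ 2 - X 0 ^ 2 * X 5)) fun v => by simp [hΨ, map_ofNat]; ring
  have ha'c' : (fun v : Y => v.2.2 0) * (fun v : Y => v.2.2 2) ∈ B :=
    key _ 2 (C (1 / 4) * (X 4 ^ 2 - X 0 ^ 2 * X 7)) fun v => by simp [hΨ, map_ofNat]; ring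
  have hac' : (fun v : Y => v.2.1 0) * (fun v : Y => v.2.2 2) ∈ B :=
    key _ 2 (C (1 / 2) * (P + P')) fun v => by simp [hΨ, P, P', map_ofNat]; ring
  have hca' : (fun v : Y => v.2.1 2) * (fun v : Y => v.2.2 0) ∈ B :=
    key _ 2 (C (1 / 2) * (P - P')) fun v => by simp [hΨ, P, P', map_ofNat]; ring
  have hm : ∀ m : CoordIdx ![2, 2, 2] →₀ ℕ, torusWeight m = 0 →
      (fun v => ∏ c, x v c.1 c.2 ^ m c) ∈ B := by
    intro m hm
    have h1 : ∀ v, ∏ c, x v c.1 c.2 ^ m c = 0 ^ m ⟨0, 0⟩ * v.1 ^ m ⟨0, 1⟩ * 0 ^ m ⟨0, 2⟩ *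
        (v.2.1 0 ^ m ⟨1, 0⟩ * v.2.1 1 ^ m ⟨1, 1⟩ * v.2.1 2 ^ m ⟨1, 2⟩) *
        (v.2.2 0 ^ m ⟨2, 0⟩ * v.2.2 1 ^ m ⟨2, 1⟩ * v.2.2 2 ^ m ⟨2, 2⟩) := fun v => by
      rw [prod_coordIdx₃, Fin.prod_univ_three, Fin.prod_univ_three, Fin.prod_univ_three]
      rfl
    rw [torusWeight, sum_coordIdx₃, Fin.sum_univ_three, Fin.sum_univ_three,
      Fin.sum_univ_three] at hm
    by_cases h00 : m ⟨0, 0⟩ = 0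
    · by_cases h02 : m ⟨0, 2⟩ = 0
      · have hm' : m ⟨1, 0⟩ + m ⟨2, 0⟩ = m ⟨1, 2⟩ + m ⟨2, 2⟩ := by
          simp at hm
          have hm2 : 2 * (m ⟨0, 0⟩ : ℤ) + -(2 * m ⟨0, 2⟩) + (2 * m ⟨1, 0⟩ + -(2 * m ⟨1, 2⟩)) +
            (2 * m ⟨2, 0⟩ + -(2 * m ⟨2, 2⟩)) = 0 := hm
          omega
        refine mem_localized_of_eq (B.mul_mem (B.pow_mem ht (m ⟨0, 1⟩))
          (monomial_mem_of_quadratic_weight B (j := m ⟨1, 1⟩) (j' := m ⟨2, 1⟩) hb hb' hac hac'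
            hca' ha'c' hm')) fun v _ => ?_
        rw [h1, h00, h02]
        simp [mul_assoc]
      · exact mem_localized_of_eq B.zero_mem fun v _ => by rw [h1, zero_pow h02]; simp
    · exact mem_localized_of_eq B.zero_mem fun v _ => by rw [h1, zero_pow h00]; simp
  have hΦ : ∀ v : Y, Φ (- v.1, flip 2 v.2.1, flip 2 v.2.2) = Φ v := fun v => by
    funext i
    have : threeQuadratic (flip 2 ![0, v.1, 0]) (flip 2 v.2.1) (flip 2 v.2.2) i =
      threeQuadratic ![0, v.1, 0] v.2.1 v.2.2 i :=
      isInvariantFamily_threeQuadratic.flip_eq (x v) i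
    rw [show flip 2 ![0, v.1, 0] = ![0, - v.1, 0] by simp [flip_two]] at this
    exact this
  have hg : ∀ v : Y, evalAt (x (- v.1, flip 2 v.2.1, flip 2 v.2.2)) p = evalAt (x v) p :=
    fun v => by
      have := (isMove_flip (K := K) (L := L)).triple ![0, v.1, 0] v.2.1 v.2.2 p hp
      rw [show flip 2 ![0, v.1, 0] = ![0, - v.1, 0] by simp [flip_two]] at this
      exact this.symm
  obtain ⟨N, Q, hQ⟩ := exists_of_mem_localized_of_even (S := Set.univ) (Φ := Φ)
    (t := fun v => v.1) (g := fun v => evalAt (x v) p) (i := 1)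
    (fun v => (- v.1, flip 2 v.2.1, flip 2 v.2.2))
    (fun _ _ => trivial) (fun _ _ => rfl) (fun v _ => hΦ v) (fun v _ => hg v)
    (fun v _ => by simp [Φ, threeQuadratic_slice]) (evalAt_mem_of_torusWeight B x hm hp)
  refine ⟨N, Q, ?_⟩
  rintro _ ⟨t, r, s, ht, rfl⟩
  exact hQ (t, r, s) trivial

theorem isHypersurfaceOfDegree_threeQuadratic_of_isAlgClosed (L : Type u) [Field L] [CharZero L]
    [IsAlgClosed L] [Algebra K L] : IsHypersurfaceOfDegree K ![2, 2, 2] 6 := by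
  refine isHypersurfaceOfDegree_of_quadratic (L := L) isInvariantFamily_threeQuadratic
    (sliceThreeQuadratic L) (isSlice_threeQuadratic K) ?_
    -- Minus the Gram determinant of the three forms: `z` is a determinant, up to scale.
    (X 0 * X 4 ^ 2 - X 0 * X 3 * X 5 + X 1 ^ 2 * X 5 - 2 * X 1 * X 2 * X 4 + X 2 ^ 2 * X 3) ?_
    (fun p hp => exists_of_mem_invariants_threeQuadratic K hp)
    (X 1) ![0, 1, 0, 0, 0, 1] rfl ?_ ?_ ?_ ?_ rfl ?_
  · rintro _ ⟨t, r, s, ht, rfl⟩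
    have h : threeQuadratic ![0, t, 0] r s 1 ≠ 0 := by simp [threeQuadratic_slice, ht]
    exact h
  · rintro _ ⟨t, r, s, ht, rfl⟩
    have h := threeQuadratic_slice t r s
    generalize hv : threeQuadratic ![0, t, 0] r s = v at h
    have h' : threeQuadratic (point₃ ![0, t, 0] r s 0) (point₃ ![0, t, 0] r s 1)
      (point₃ ![0, t, 0] r s 2) = v := hv
    rw [h', h]
    simp [Fin.succ, map_ofNat]
    ring
  · simp
  · simp
  · intro u z h0 hu hz0 hz
    simp only [aeval_X] at hu
    simp [h0, map_ofNat] at hz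
    suffices h : ∃ q r s, threeQuadratic q r s = ![z, 0, u 1, u 2, u 3, u 4, u 5] by
      obtain ⟨q, r, s, h⟩ := h
      exact ⟨point₃ q r s, h.trans (by ext i; fin_cases i <;> first | rfl | exact h0.symm)⟩
    -- With `q = y²`, pairing with `q` fixes the leading coefficients of the other two forms and `z
    -- = u 1 * s 1`. The discriminant of the third form is then right by the relation.
    refine ⟨![0, 0, 1], ![- u 1 / 2, 0, u 3 / (2 * u 1)],
      ![- u 2 / 2, z / u 1, u 4 / u 1 - u 3 * u 2 / (2 * u 1 ^ 2)], ?_⟩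
    ext i
    fin_cases i <;> simp [threeQuadratic, jacobian, polarDisc] <;> field_simp
    · ring
    · ring
    · linear_combination 2 * hz
  · intro i; fin_cases i <;> simp
  · intro u
    simp [Fin.succ, map_ofNat]
    ring

theorem isHypersurfaceOfDegree_threeQuadratic : IsHypersurfaceOfDegree K ![2, 2, 2] 6 :=
  isHypersurfaceOfDegree_threeQuadratic_of_isAlgClosed K (AlgebraicClosure K)

end ThreeQuadratic

/-! ### Two quartic forms -/

/-- Generating invariants of two quartic forms. -/
def quarticQuartic {R : Type*} [CommRing R] (f g : Fin 5 → R) : Fin 8 → R :=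
  ![polarQuartic (hessianQuartic f) (hessianQuartic g), polarQuartic f f, polarQuartic f g,
    polarQuartic g g, polarQuartic (hessianQuartic f) f, polarQuartic (hessianQuartic f) g,
    polarQuartic (hessianQuartic g) f, polarQuartic (hessianQuartic g) g]

theorem isInvariantFamily_quarticQuartic :
    IsInvariantFamily.{u} (d := ![4, 4]) (fun x => quarticQuartic (x 0) (x 1))
      ![4, 2, 2, 2, 3, 3, 3, 3] :=
  .of_pair
    (fun φ f g i => by
      fin_cases i <;> simp [quarticQuartic, hessianQuartic, polarQuartic, map_ofNat])
    (fun t f g => by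
      simp only [quarticQuartic, hessianQuartic_shear, polarQuartic_shear])
    (fun f g => by
      simp only [quarticQuartic, hessianQuartic_flip, polarQuartic_flip])
    (fun s f g i => by
      fin_cases i <;> simp [quarticQuartic, hessianQuartic, polarQuartic] <;> ring)

section QuarticQuartic

variable (K : Type u) [Field K] [CharZero K]

/-- Normal forms of two quartic forms. -/
def sliceQuarticQuartic (L : Type u) [Field L] : Set (CoordPoint L ![4, 4]) :=
  {y | ∃ (a c : L) (g : Fin 5 → L), y = point₂ ![a, 0, c, 0, a] g}

/-- The quadratic form to be moved to `t x y` is an eigenvector of transvection with the first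
quartic, and this makes the coefficients of `x³ y` and `x y³` vanish. The open condition is
nonvanishing of the discriminant of that quartic. -/
theorem isSlice_quarticQuartic {L : Type u} [Field L] [CharZero L] [IsAlgClosed L] [Algebra K L] :
    IsSlice K (sliceQuarticQuartic L) := by
  have hΦ := isInvariantFamily_quarticQuartic.{u}
  let D : invariants K ![4, 4] := 8 * hΦ.toInvariants K 1 ^ 3 - hΦ.toInvariants K 4 ^ 2
  have hD : ∀ {R : Type u} [CommRing R] [Algebra K R] (f g : Fin 5 → R),
      evalAt (point₂ f g : CoordPoint R ![4, 4]) D.1 =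
        8 * polarQuartic f f ^ 3 - polarQuartic (hessianQuartic f) f ^ 2 := fun f g => by
    change evalAt _ (8 * (hΦ.toInvariants K 1).1 ^ 3 - (hΦ.toInvariants K 4).1 ^ 2) = _
    rw [map_sub, map_mul, map_pow, map_pow, hΦ.evalAt_toInvariants K, hΦ.evalAt_toInvariants K,
      map_ofNat]
    rfl
  refine ⟨D.1, ?_, ?_⟩
  · intro h0
    have := hD (R := K) ![1, 0, 0, 0, 1] 0
    rw [h0, map_zero] at this
    simp [polarQuartic, hessianQuartic] at this
  · intro x hx
    obtain ⟨f, g, rfl⟩ := exists_eq_point₂ x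
    have hmove : ∀ τ, IsMove K τ → 8 * polarQuartic (τ 4 f) (τ 4 f) ^ 3 -
        polarQuartic (hessianQuartic (τ 4 f)) (τ 4 f) ^ 2 ≠ 0 := fun τ hτ => by
      rw [← hD (τ 4 f) (τ 4 g), ← hτ.pair f g _ D.2]
      exact hx
    let T : (Fin 3 → L) →ₗ[L] (Fin 3 → L) :=
      { toFun := transvectQuartic f
        map_add' := fun q r => by
          ext j; fin_cases j <;> simp [transvectQuartic] <;> ring
        map_smul' := fun k q => by
          ext j; fin_cases j <;> simp [transvectQuartic] <;> ring }
    obtain ⟨k, hk⟩ := Module.End.exists_eigenvalue T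
    obtain ⟨q, hq⟩ := hk.exists_hasEigenvector
    have hqk : transvectQuartic f q = k • q := hq.apply_eq_smul
    -- An eigenvector that is a multiple of `y²` would force the first two coefficients of the
    -- quartic to vanish, hence a double root.
    have hq0 : polarDisc q q ≠ 0 := by
      intro h0
      obtain ⟨τ, t, hτ, ht, hτq⟩ := exists_isMove_of_polarDisc_eq_zero (K := K) h0 hq.2
      have h1 := hτ.transvectQuartic_eq hqk
      rw [hτq] at h1
      have h2 := congrFun h1 0
      have h3 := congrFun h1 1
      simp [transvectQuartic, ht] at h2 h3
      apply hmove τ hτ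
      simp [polarQuartic, hessianQuartic, h2, h3]
      ring
    obtain ⟨τ, t, hτ, ht, hτq⟩ := exists_isMove_quadratic (K := K) hq0
    have h1 := hτ.transvectQuartic_eq hqk
    rw [hτq] at h1
    have h2 := congrFun h1 0
    have h3 := congrFun h1 2
    simp [transvectQuartic, ht] at h2 h3
    have h4 := hmove τ hτ
    have h5 : τ 4 f 0 ≠ 0 ∧ τ 4 f 4 ≠ 0 := by
      rw [← mul_ne_zero_iff]
      intro h5
      apply h4
      simp [polarQuartic, hessianQuartic, h2, h3]
      linear_combination 6912 * (τ 4 f 2 ^ 2 - 4 * (τ 4 f 0 * τ 4 f 4)) ^ 2 * h5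
    -- The torus multiplies the outer coefficients by `s⁴` and `s⁻⁴`, so equalizing them needs an
    -- eighth root.
    obtain ⟨s, hs⟩ := IsAlgClosed.exists_pow_nat_eq (τ 4 f 4 / τ 4 f 0) (show 0 < 8 by norm_num)
    have hs0 : s ≠ 0 := by
      rintro rfl
      rw [zero_pow (by norm_num)] at hs
      exact div_ne_zero h5.2 h5.1 hs.symm
    have h6 : s ^ 8 * τ 4 f 0 = τ 4 f 4 := by
      rw [hs]
      field_simp [h5.1]
    have h7 := ((isMove_torus (K := K) hs0).comp hτ).pair f g
    have h8 : torus 4 s (τ 4 f) = ![s ^ 4 * τ 4 f 0, 0, τ 4 f 2, 0, s ^ 4 * τ 4 f 0] := by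
      ext j
      fin_cases j <;> simp [torus_four, h2, h3, hs0]
      field_simp
      exact h6.symm
    rw [h8] at h7
    exact ⟨_, ⟨_, _, _, rfl⟩, h7⟩

end QuarticQuartic

/-! ### Restriction of invariants to the slice of two quartics. -/

section QuarticQuarticSlice

/-- A parametrization of the normal forms of two quartic forms. -/
def quarticPoint {R : Type*} [CommRing R] (v : Fin 7 → R) : CoordPoint R ![4, 4] :=
  point₂ ![v 0, 0, v 1, 0, v 0] ![v 2 + v 4, v 5 + v 6, v 3, v 5 - v 6, v 2 - v 4]

theorem quarticQuartic_slice {R : Type*} [CommRing R] (v : Fin 7 → R) :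
    quarticQuartic ![v 0, 0, v 1, 0, v 0] ![v 2 + v 4, v 5 + v 6, v 3, v 5 - v 6, v 2 - v 4] =
      ![(v 1 ^ 2 - 12 * v 0 ^ 2) * (-384 * (v 2 ^ 2 - v 4 ^ 2) + 48 * (v 6 ^ 2 - v 5 ^ 2)) +
          32 * v 1 ^ 2 * v 3 ^ 2 - 384 * v 0 ^ 2 * v 3 ^ 2 -
          576 * v 0 * v 1 * (v 6 ^ 2 + v 5 ^ 2) + 1536 * v 0 * v 1 * v 3 * v 2,
        2 * v 1 ^ 2 + 24 * v 0 ^ 2,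
        2 * v 1 * v 3 + 24 * v 0 * v 2,
        24 * (v 2 ^ 2 - v 4 ^ 2) + 6 * (v 6 ^ 2 - v 5 ^ 2) + 2 * v 3 ^ 2,
        - 8 * v 1 ^ 3 + 288 * v 0 ^ 2 * v 1,
        - 8 * v 1 ^ 2 * v 3 + 96 * v 0 ^ 2 * v 3 + 192 * v 0 * v 1 * v 2,
        96 * v 1 * (v 2 ^ 2 - v 4 ^ 2) - 12 * v 1 * (v 6 ^ 2 - v 5 ^ 2) - 8 * v 1 * v 3 ^ 2 -
          72 * v 0 * (v 6 ^ 2 + v 5 ^ 2) + 192 * v 0 * v 3 * v 2,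
        - 216 * v 2 * (v 6 ^ 2 + v 5 ^ 2) + 432 * (v 4 * v 5 * v 6) - 8 * v 3 ^ 3 +
          288 * v 3 * (v 2 ^ 2 - v 4 ^ 2) - 36 * v 3 * (v 6 ^ 2 - v 5 ^ 2)] := by
  ext i
  fin_cases i <;> simp [quarticQuartic, hessianQuartic, polarQuartic] <;> ring

variable (K : Type u) [Field K] {L : Type u} [Field L] [Algebra K L]

/-- The value of the invariants at a normal form, together with the parameters of the first
quartic form. -/
def quarticParam (v : Fin 7 → L) : Fin 10 → L :=
  Fin.cons (v 0) (Fin.cons (v 1)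
    (quarticQuartic ![v 0, 0, v 1, 0, v 0] ![v 2 + v 4, v 5 + v 6, v 3, v 5 - v 6, v 2 - v 4]))

theorem aeval_map_quarticPoint {p : CoordRing K ![4, 4]} (v : Fin 7 → L) :
    aeval v (evalAt (quarticPoint (X : Fin 7 → MvPolynomial (Fin 7) K)) p) =
      evalAt (quarticPoint v) p := by
  rw [map_evalAt]
  congr 2
  funext i j
  revert j
  refine Fin.cases ?_ (fun i => Fin.cases ?_ (fun i => i.elim0) i) i
  · intro j
    change aeval v ((![X 0, 0, X 1, 0, X 0] : Fin 5 → MvPolynomial (Fin 7) K) j) =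
      (![v 0, 0, v 1, 0, v 0] : Fin 5 → L) j
    revert j
    change ∀ j : Fin 5, _
    intro j
    fin_cases j <;> simp
  · intro j
    change aeval v ((![X 2 + X 4, X 5 + X 6, X 3, X 5 - X 6, X 2 - X 4] :
      Fin 5 → MvPolynomial (Fin 7) K) j) =
      (![v 2 + v 4, v 5 + v 6, v 3, v 5 - v 6, v 2 - v 4] : Fin 5 → L) j
    revert j
    change ∀ j : Fin 5, _
    intro j
    fin_cases j <;> simp

theorem even_of_neg_one_pow_eq_one {K : Type*} [Field K] [CharZero K] {n : ℕ}
    (h : (-1 : K) ^ n = 1) : Even n :=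
  (neg_one_pow_eq_one_iff_even (by norm_num)).mp h

/-- The flip and a torus element of order four fix the first normal form. They change the signs of
parameters `4, 5` and of `5, 6`, generating a Klein four-group. -/
theorem even_of_mem_support_quarticPoint [CharZero K] {p : CoordRing K ![4, 4]}
    (hp : p ∈ invariants K ![4, 4]) {m : Fin 7 →₀ ℕ}
    (hm : m ∈ (evalAt (quarticPoint (X : Fin 7 → MvPolynomial (Fin 7) K)) p).support) :
    Even (m 5 + m 6) ∧ Even (m 4 + m 5) := by
  constructor
  · have h := prod_pow_eq_of_mem_support (L := AlgebraicClosure K)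
      ![1, 1, 1, 1, 1, -1, -1] 1 _ (fun v => ?_) hm
    · rw [Finsupp.prod_fintype _ _ (fun _ => pow_zero _)] at h
      simp only [Fin.prod_univ_succ] at h
      simp at h
      rw [← pow_add] at h
      exact even_of_neg_one_pow_eq_one h
    · obtain ⟨I, hI⟩ := IsAlgClosed.exists_pow_nat_eq (-1 : AlgebraicClosure K) two_pos
      have hI0 : I ≠ 0 := by
        rintro rfl
        simp at hI
      have h1 : I⁻¹ = - I := by
        field_simp
        linear_combination hI
      have h4 : I ^ 4 = 1 := by linear_combination (I ^ 2 - 1) * hI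
      have h5 : (-I) ^ 4 = 1 := by linear_combination (I ^ 2 - 1) * hI
      rw [map_one, one_mul, aeval_map_quarticPoint, aeval_map_quarticPoint]
      refine Eq.trans ?_ ((isMove_torus (K := K) hI0).pair _ _ p hp).symm
      congr 2
      unfold quarticPoint
      congr 1
      · ext j
        fin_cases j <;> simp [torus_four, h1, h4, h5]
        linear_combination - v 1 * h4
      · ext j
        fin_cases j <;> simp [torus_four, h1, h4, h5]
        · linear_combination (v 5 + v 6) * h4
        · linear_combination - v 3 * h4
        · linear_combination (v 5 - v 6) * h4
  · have h := prod_pow_eq_of_mem_support (L := AlgebraicClosure K)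
      ![1, 1, 1, 1, -1, -1, 1] 1 _ (fun v => ?_) hm
    · rw [Finsupp.prod_fintype _ _ (fun _ => pow_zero _)] at h
      simp only [Fin.prod_univ_succ] at h
      simp at h
      rw [← pow_add] at h
      exact even_of_neg_one_pow_eq_one h
    · rw [map_one, one_mul, aeval_map_quarticPoint, aeval_map_quarticPoint]
      refine Eq.trans ?_ ((isMove_flip (K := K)).pair _ _ p hp).symm
      congr 2
      unfold quarticPoint
      congr 1
      · ext j
        fin_cases j <;> simp [flip_four]
      · ext j
        fin_cases j <;> simp [flip_four] <;> ring

/-- The three exponents have the same parity, so the monomial consists of squares times possibly one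
factor `r * m * n`. -/
theorem monomial_mem_of_even {K L Y : Type*} [Field K] [Field L] [Algebra K L]
    (B : Subalgebra K (Y → L)) {r m n : Y → L}
    (hr : r ^ 2 ∈ B) (hm : m ^ 2 ∈ B) (hn : n ^ 2 ∈ B) (hrmn : r * m * n ∈ B) {i j k : ℕ}
    (hjk : Even (j + k)) (hij : Even (i + j)) : r ^ i * m ^ j * n ^ k ∈ B := by
  obtain ⟨j', rfl | rfl⟩ := Nat.even_or_odd' j
  · obtain ⟨i', rfl⟩ : ∃ i', i = 2 * i' := ⟨i / 2, by grind⟩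
    obtain ⟨k', rfl⟩ : ∃ k', k = 2 * k' := ⟨k / 2, by grind⟩
    rw [pow_mul, pow_mul, pow_mul]
    exact B.mul_mem (B.mul_mem (B.pow_mem hr _) (B.pow_mem hm _)) (B.pow_mem hn _)
  · obtain ⟨i', rfl⟩ : ∃ i', i = 2 * i' + 1 := ⟨i / 2, by grind⟩
    obtain ⟨k', rfl⟩ : ∃ k', k = 2 * k' + 1 := ⟨k / 2, by grind⟩
    have : r ^ (2 * i' + 1) * m ^ (2 * j' + 1) * n ^ (2 * k' + 1) =
        (r ^ 2) ^ i' * (m ^ 2) ^ j' * (n ^ 2) ^ k' * (r * m * n) := by ring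
    rw [this]
    exact B.mul_mem (B.mul_mem (B.mul_mem (B.pow_mem hr _) (B.pow_mem hm _)) (B.pow_mem hn _)) hrmn

/-- After inverting `a (4 a² - c²)`, the invariants give `s, k` linearly, then `r², m², n²`
linearly, and finally `r m n`. Here `v = (a, c, s, k, r, m, n)`. -/
theorem evalAt_quarticPoint_mem [CharZero K] [CharZero L] {p : CoordRing K ![4, 4]}
    (hp : p ∈ invariants K ![4, 4]) : (fun v : Fin 7 → L => evalAt (quarticPoint v) p) ∈
      localized (K := K) Set.univ quarticParam (X 0 * (4 * X 0 ^ 2 - X 1 ^ 2)) := by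
  set B := localized (K := K) (L := L) Set.univ quarticParam (X 0 * (4 * X 0 ^ 2 - X 1 ^ 2)) with hB
  have hD : ∀ v : Fin 7 → L, aeval (quarticParam v)
      (X 0 * (4 * X 0 ^ 2 - X 1 ^ 2) : MvPolynomial (Fin 10) K) =
      v 0 * (4 * v 0 ^ 2 - v 1 ^ 2) := fun v => by simp [quarticParam, map_ofNat]
  have hΨ := fun i => apply_mem_localized (K := K) (S := Set.univ)
    (Φ := quarticParam (L := L)) (a := X 0 * (4 * X 0 ^ 2 - X 1 ^ 2)) i
  -- The equations for `s` and `k` are linear, with determinant `576 a (4 a² - c²)`.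
  have hs : (fun v : Fin 7 → L => v 2) ∈ B :=
    mem_localized 1 (C (1 / 576) * ((96 * X 0 ^ 2 - 8 * X 1 ^ 2) * X 4 - 2 * X 1 * X 7))
      fun v _ => by
        rw [hD, quarticParam, quarticQuartic_slice]
        simp [map_ofNat]
        ring
  have hk : (fun v : Fin 7 → L => v 3) ∈ B :=
    mem_localized 1 (C (1 / 576) * (24 * X 0 * X 7 - 192 * X 0 * X 1 * X 4)) fun v _ => by
        rw [hD, quarticParam, quarticQuartic_slice]
        simp [map_ofNat]
        ring
  let W : (Fin 7 → L) → Fin 8 → L := fun v => ![quarticParam v 0, quarticParam v 1, v 2, v 3,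
    quarticParam v 2, quarticParam v 5, quarticParam v 8, quarticParam v 9]
  have hW : ∀ i, (fun v => W v i) ∈ B := by
    intro i
    fin_cases i
    exacts [hΨ 0, hΨ 1, hs, hk, hΨ 2, hΨ 5, hΨ 8, hΨ 9]
  have hW' : ∀ v, W v = ![v 0, v 1, v 2, v 3,
      (v 1 ^ 2 - 12 * v 0 ^ 2) * (-384 * (v 2 ^ 2 - v 4 ^ 2) + 48 * (v 6 ^ 2 - v 5 ^ 2)) +
          32 * v 1 ^ 2 * v 3 ^ 2 - 384 * v 0 ^ 2 * v 3 ^ 2 -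
          576 * v 0 * v 1 * (v 6 ^ 2 + v 5 ^ 2) + 1536 * v 0 * v 1 * v 3 * v 2,
      24 * (v 2 ^ 2 - v 4 ^ 2) + 6 * (v 6 ^ 2 - v 5 ^ 2) + 2 * v 3 ^ 2,
      96 * v 1 * (v 2 ^ 2 - v 4 ^ 2) - 12 * v 1 * (v 6 ^ 2 - v 5 ^ 2) - 8 * v 1 * v 3 ^ 2 -
          72 * v 0 * (v 6 ^ 2 + v 5 ^ 2) + 192 * v 0 * v 3 * v 2,
      - 216 * v 2 * (v 6 ^ 2 + v 5 ^ 2) + 432 * (v 4 * v 5 * v 6) - 8 * v 3 ^ 3 +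
          288 * v 3 * (v 2 ^ 2 - v 4 ^ 2) - 36 * v 3 * (v 6 ^ 2 - v 5 ^ 2)] := fun v => by
    simp only [W, quarticParam, quarticQuartic_slice]
    rfl
  -- The combination `E` eliminates `n² + m²` and equals `144 (4 a² - c²) (8 (s² - r²) - (n² -
  -- m²))`. Then `P`, `Q`, `T` represent `D` times `s² - r²`, `n² - m²`, `n² + m²`.
  let G : MvPolynomial (Fin 8) K := X 5 - 2 * X 3 ^ 2
  let H : MvPolynomial (Fin 8) K := X 6 + 8 * X 1 * X 3 ^ 2 - 192 * X 0 * X 3 * X 2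
  let E : MvPolynomial (Fin 8) K := X 4 - 32 * X 1 ^ 2 * X 3 ^ 2 + 384 * X 0 ^ 2 * X 3 ^ 2 -
    1536 * X 0 * X 1 * X 2 * X 3 - 8 * X 1 * H
  let D : MvPolynomial (Fin 8) K := X 0 * (4 * X 0 ^ 2 - X 1 ^ 2)
  let P : MvPolynomial (Fin 8) K := C (1 / 144) * (2 * D * G + C (1 / 12) * X 0 * E)
  let Q : MvPolynomial (Fin 8) K := C (1 / 6) * (D * G - 24 * P)
  let T : MvPolynomial (Fin 8) K :=
    C (1 / 72) * (C (1 / 12) * X 1 * E - (4 * X 0 ^ 2 - X 1 ^ 2) * H)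
  have hr : (fun v : Fin 7 → L => v 4) ^ 2 ∈ B :=
    mem_localized_of_mul 1 (aeval_mem_of_forall_mem B hW (D * X 2 ^ 2 - P)) fun v _ => by
      rw [hD, hW']
      simp [D, P, E, H, G, map_ofNat]
      ring
  have hn : (fun v : Fin 7 → L => v 6) ^ 2 ∈ B :=
    mem_localized_of_mul 1 (aeval_mem_of_forall_mem B hW (C (1 / 2) * (T + Q))) fun v _ => by
      rw [hD, hW']
      simp [D, P, Q, T, E, H, G, map_ofNat]
      ring
  have hm : (fun v : Fin 7 → L => v 5) ^ 2 ∈ B :=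
    mem_localized_of_mul 1 (aeval_mem_of_forall_mem B hW (C (1 / 2) * (T - Q))) fun v _ => by
      rw [hD, hW']
      simp [D, P, Q, T, E, H, G, map_ofNat]
      ring
  let U : (Fin 7 → L) → Fin 6 → L := fun v =>
    ![quarticParam v 9, v 2, v 3, v 4 ^ 2, v 5 ^ 2, v 6 ^ 2]
  have hU : ∀ i, (fun v => U v i) ∈ B := by
    intro i
    fin_cases i
    exacts [hΨ 9, hs, hk, hr, hm, hn]
  have hU' : ∀ v, U v = ![- 216 * v 2 * (v 6 ^ 2 + v 5 ^ 2) + 432 * (v 4 * v 5 * v 6) -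
        8 * v 3 ^ 3 + 288 * v 3 * (v 2 ^ 2 - v 4 ^ 2) - 36 * v 3 * (v 6 ^ 2 - v 5 ^ 2),
      v 2, v 3, v 4 ^ 2, v 5 ^ 2, v 6 ^ 2] := fun v => by
    simp only [U, quarticParam, quarticQuartic_slice]
    rfl
  have hrmn : (fun v : Fin 7 → L => v 4) * (fun v => v 5) * (fun v => v 6) ∈ B :=
    mem_localized_of_eq (aeval_mem_of_forall_mem B hU (C (1 / 432) * (X 0 +
      216 * X 1 * (X 5 + X 4) + 8 * X 2 ^ 3 - 288 * X 2 * (X 1 ^ 2 - X 3) +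
      36 * X 2 * (X 5 - X 4)))) fun v _ => by
      simp [hU', map_ofNat]
      ring
  simp only [← aeval_map_quarticPoint]
  refine aeval_mem_of_forall_mem_support B (fun v => v) fun m hm' => ?_
  obtain ⟨h1, h2⟩ := even_of_mem_support_quarticPoint K hp hm'
  refine mem_localized_of_eq (B.mul_mem (B.mul_mem (B.mul_mem (B.mul_mem
    (B.pow_mem (hΨ 0) (m 0)) (B.pow_mem (hΨ 1) (m 1))) (B.pow_mem hs (m 2))) (B.pow_mem hk (m 3)))
    (monomial_mem_of_even B hr hm hn hrmn h1 h2)) fun v _ => ?_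
  rw [Fin.prod_univ_seven]
  simp [quarticParam, mul_assoc]

end QuarticQuarticSlice

/-! ### Eliminating the parameters of the first quartic. -/

section QuarticQuarticLocalization

/-- The cubic equation for the parameter `c` of the normal form, with coefficients in the
invariants, allows reducing all powers of `c` below the third. -/
theorem exists_eq_of_cubic {K L : Type*} [Field K] [CharZero K] [Field L] [CharZero L] [Algebra K L]
    (Q : MvPolynomial (Fin 9) K) :
    ∃ q₀ q₁ q₂ : MvPolynomial (Fin 8) K, ∀ (c : L) (u : Fin 8 → L),
      32 * c ^ 3 = 12 * u 1 * c - u 4 → aeval (Fin.cons c u : Fin 9 → L) Q =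
        aeval u q₀ + c * aeval u q₁ + c ^ 2 * aeval u q₂ := by
  induction Q using MvPolynomial.induction_on with
  | C a => exact ⟨C a, 0, 0, fun t u _ => by simp⟩
  | add p q hp hq =>
    obtain ⟨p₀, p₁, p₂, hp⟩ := hp
    obtain ⟨q₀, q₁, q₂, hq⟩ := hq
    refine ⟨p₀ + q₀, p₁ + q₁, p₂ + q₂, fun t u h => ?_⟩
    rw [map_add, map_add, map_add, map_add, hp t u h, hq t u h]
    ring
  | mul_X p i hp =>
    obtain ⟨p₀, p₁, p₂, hp⟩ := hp
    refine Fin.cases ⟨- C (1 / 32) * X 4 * p₂, p₀ + C (3 / 8) * X 1 * p₂, p₁, fun t u h => ?_⟩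
      (fun i => ⟨p₀ * X i, p₁ * X i, p₂ * X i, fun t u h => ?_⟩) i
    · rw [map_mul, hp t u h]
      simp [map_ofNat]
      linear_combination (1 / 32) * aeval u p₂ * h
    · rw [map_mul, map_mul, map_mul, map_mul, hp t u h]
      simp only [aeval_X, Fin.cons_succ]
      ring

variable (K : Type u) [Field K] [CharZero K] {L : Type u} [Field L] [CharZero L] [IsAlgClosed L]
  [Algebra K L]

theorem exists_sameInvariants_neg (a c : L) (g : Fin 5 → L) : ∃ g', SameInvariants K
    (point₂ ![a, 0, c, 0, a] g : CoordPoint L ![4, 4]) (point₂ ![-a, 0, c, 0, -a] g') := by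
  obtain ⟨s, hs⟩ := IsAlgClosed.exists_pow_nat_eq (-1 : L) (show 0 < 4 by norm_num)
  have hs0 : s ≠ 0 := by
    rintro rfl
    simp at hs
  have h := (isMove_torus (K := K) hs0).pair ![a, 0, c, 0, a] g
  have h1 : torus 4 s ![a, 0, c, 0, a] = ![-a, 0, c, 0, -a] := by
    ext j
    fin_cases j <;> simp [torus_four, hs, hs0]
  rw [h1] at h
  exact ⟨_, h⟩

/-- Normal forms are not unique: the new middle coefficient is another root of the same resolvent
cubic. Applied to `a` and to `-a`, this yields the two other roots. -/
theorem exists_sameInvariants_rotate (a c : L) (g : Fin 5 → L) : ∃ g', SameInvariants K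
    (point₂ ![a, 0, c, 0, a] g : CoordPoint L ![4, 4])
    (point₂ ![(2 * a + c) / 4, 0, (6 * a - c) / 2, 0, (2 * a + c) / 4] g') := by
  obtain ⟨s, hs⟩ := IsAlgClosed.exists_pow_nat_eq (2 : L) two_pos
  have hs0 : s ≠ 0 := by
    rintro rfl
    simp at hs
  have h := ((isMove_torus (K := K) hs0).comp (isMove_flip.comp ((isMove_shear (1 / 2)).comp
    (isMove_flip.comp (isMove_shear 1))))).pair ![a, 0, c, 0, a] g
  have h4 : s ^ 4 = 4 := by linear_combination (s ^ 2 + 2) * hs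
  have h1 : torus 4 s (flip 4 (shear 4 (1 / 2) (flip 4 (shear 4 1 ![a, 0, c, 0, a])))) =
      ![(2 * a + c) / 4, 0, (6 * a - c) / 2, 0, (2 * a + c) / 4] := by
    ext j
    fin_cases j <;> simp [torus_four, flip_four, shear_four, h4, hs] <;>
      first | ring1 | (right; ring1)
  rw [h1] at h
  exact ⟨_, h⟩

/-- The sign change of `a` leaves an expression in `a²`, which is a polynomial in `c` and the
invariants; averaging over the three roots then removes `c`. The denominator becomes the
discriminant, equal to `6912 (a (4 a² - c²))²` on the slice. -/
theorem exists_of_mem_invariants_quarticQuartic {p : CoordRing K ![4, 4]}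
    (hp : p ∈ invariants K ![4, 4]) : ∃ (N : ℕ) (Q : MvPolynomial (Fin 8) K),
      ∀ y ∈ sliceQuarticQuartic L, aeval (quarticQuartic (y 0) (y 1)) (8 * X 1 ^ 3 - X 4 ^ 2 :
        MvPolynomial (Fin 8) K) ^ N * evalAt y p = aeval (quarticQuartic (y 0) (y 1)) Q := by
  have hΦ : ∀ {f g f' g' : Fin 5 → L}, SameInvariants K (point₂ f g : CoordPoint L ![4, 4])
      (point₂ f' g') → quarticQuartic f g = quarticQuartic f' g' := by
    intro f g f' g' h
    funext i
    have hF := isInvariantFamily_quarticQuartic.{u}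
    have h1 := h _ (hF.toInvariants K i).2
    rw [hF.evalAt_toInvariants K, hF.evalAt_toInvariants K] at h1
    exact h1
  have hu : ∀ (a c : L) (g : Fin 5 → L),
      quarticQuartic ![a, 0, c, 0, a] g 1 = 24 * a ^ 2 + 2 * c ^ 2 ∧
      quarticQuartic ![a, 0, c, 0, a] g 4 = 288 * a ^ 2 * c - 8 * c ^ 3 := by
    intro a c g
    constructor
    · change polarQuartic ![a, 0, c, 0, a] ![a, 0, c, 0, a] = _
      simp [polarQuartic]
      ring
    · change polarQuartic (hessianQuartic ![a, 0, c, 0, a]) ![a, 0, c, 0, a] = _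
      simp [polarQuartic, hessianQuartic]
      ring
  obtain ⟨N, Q, hQ⟩ := evalAt_quarticPoint_mem (L := L) K hp
  obtain ⟨Q₀, Q₁, hQ'⟩ := exists_even_odd (L := L) ((X 0 * (4 * X 0 ^ 2 - X 1 ^ 2)) ^ N * Q)
  obtain ⟨q₀, q₁, q₂, hq⟩ := exists_eq_of_cubic (L := L) (C (6912 ^ N) *
    aeval (Fin.cons (C (1 / 24) * (X 2 - 2 * X 0 ^ 2)) X : Fin 10 → MvPolynomial (Fin 9) K) Q₀)
  have h1 : ∀ (a c : L) (g : Fin 5 → L), (a * (4 * a ^ 2 - c ^ 2)) ^ (2 * N) *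
      evalAt (point₂ ![a, 0, c, 0, a] g : CoordPoint L ![4, 4]) p =
      aeval (Fin.cons (a ^ 2) (Fin.cons c (quarticQuartic ![a, 0, c, 0, a] g)) : Fin 10 → L) Q₀ +
      a * aeval (Fin.cons (a ^ 2) (Fin.cons c (quarticQuartic ![a, 0, c, 0, a] g)) :
        Fin 10 → L) Q₁ := by
    intro a c g
    have h := hQ ![a, c, (g 0 + g 4) / 2, g 2, (g 0 - g 4) / 2, (g 1 + g 3) / 2, (g 1 - g 3) / 2]
      trivial
    have hg : quarticPoint ![a, c, (g 0 + g 4) / 2, g 2, (g 0 - g 4) / 2, (g 1 + g 3) / 2,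
        (g 1 - g 3) / 2] = point₂ ![a, 0, c, 0, a] g := by
      unfold quarticPoint
      congr 1
      ext j
      fin_cases j <;> simp <;> ring
    have hg' : quarticParam ![a, c, (g 0 + g 4) / 2, g 2, (g 0 - g 4) / 2, (g 1 + g 3) / 2,
        (g 1 - g 3) / 2] = Fin.cons a (Fin.cons c (quarticQuartic ![a, 0, c, 0, a] g)) := by
      unfold quarticParam
      congr 3
      ext j
      fin_cases j <;> simp <;> ring
    beta_reduce at h
    rw [hg, hg'] at h
    rw [← hQ', map_mul, ← h, map_pow]
    simp [map_ofNat]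
    ring
  have h2 : ∀ (a c : L) (g : Fin 5 → L),
      aeval (quarticQuartic ![a, 0, c, 0, a] g) (8 * X 1 ^ 3 - X 4 ^ 2 :
        MvPolynomial (Fin 8) K) ^ N * evalAt (point₂ ![a, 0, c, 0, a] g : CoordPoint L ![4, 4]) p =
      aeval (quarticQuartic ![a, 0, c, 0, a] g) q₀ +
        c * aeval (quarticQuartic ![a, 0, c, 0, a] g) q₁ +
        c ^ 2 * aeval (quarticQuartic ![a, 0, c, 0, a] g) q₂ := by
    intro a c g
    obtain ⟨g', hg'⟩ := exists_sameInvariants_neg K a c g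
    have h3 := h1 a c g
    have h4 := h1 (-a) c g'
    rw [← hΦ hg', ← hg' p hp, neg_sq, show (-a * (4 * a ^ 2 - c ^ 2)) ^ (2 * N) =
      (a * (4 * a ^ 2 - c ^ 2)) ^ (2 * N) by rw [neg_mul, pow_mul, neg_sq, ← pow_mul]] at h4
    obtain ⟨hu1, hu4⟩ := hu a c g
    rw [← hq c _ (by rw [hu1, hu4]; ring)]
    have h5 : aeval (Fin.cons c (quarticQuartic ![a, 0, c, 0, a] g) : Fin 9 → L)
        (aeval (Fin.cons (C (1 / 24) * (X 2 - 2 * X 0 ^ 2)) X : Fin 10 → MvPolynomial (Fin 9) K)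
          Q₀) = aeval (Fin.cons (a ^ 2) (Fin.cons c (quarticQuartic ![a, 0, c, 0, a] g)) :
            Fin 10 → L) Q₀ := by
      rw [← AlgHom.comp_apply, comp_aeval]
      congr 2
      funext j
      refine Fin.cases ?_ (fun j => ?_) j
      · have : (Fin.cons c (quarticQuartic ![a, 0, c, 0, a] g) : Fin 9 → L) 2 =
          24 * a ^ 2 + 2 * c ^ 2 := hu1
        simp [map_ofNat, this]
      · simp
    rw [map_mul, h5, map_sub, map_mul, map_pow, map_pow, aeval_X, aeval_X, hu1, hu4]
    have h6 : (8 * (24 * a ^ 2 + 2 * c ^ 2) ^ 3 - (288 * a ^ 2 * c - 8 * c ^ 3) ^ 2) ^ N =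
        6912 ^ N * (a * (4 * a ^ 2 - c ^ 2)) ^ (2 * N) := by
      rw [pow_mul, ← mul_pow]
      congr 1
      ring
    simp only [map_ofNat, map_pow]
    rw [h6]
    linear_combination (6912 ^ N / 2) * (h3 + h4)
  -- The average over the three roots of the cubic: the roots have mean zero, and their squares have
  -- mean `u 1 / 4`, where `u 1` is the invariant `X 1`.
  refine ⟨N, q₀ + C (1 / 4) * X 1 * q₂, ?_⟩
  rintro _ ⟨a, c, g, rfl⟩
  obtain ⟨g₁, hg₁⟩ := exists_sameInvariants_rotate K a c g
  obtain ⟨g', hg'⟩ := exists_sameInvariants_neg K a c g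
  obtain ⟨g₂, hg₂⟩ := exists_sameInvariants_rotate K (-a) c g'
  have hg₂' := hg'.trans hg₂
  have e0 := h2 a c g
  have e1 := h2 ((2 * a + c) / 4) ((6 * a - c) / 2) g₁
  have e2 := h2 ((2 * -a + c) / 4) ((6 * -a - c) / 2) g₂
  rw [← hΦ hg₁, ← hg₁ p hp] at e1
  rw [← hΦ hg₂', ← hg₂' p hp] at e2
  obtain ⟨hu1, hu4⟩ := hu a c g
  change aeval (quarticQuartic ![a, 0, c, 0, a] g) _ ^ N * _ =
    aeval (quarticQuartic ![a, 0, c, 0, a] g) _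
  rw [map_add, map_mul, map_mul, aeval_X, hu1]
  simp only [aeval_C, map_div₀, map_one, map_ofNat]
  linear_combination (e0 + e1 + e2) / 3

end QuarticQuarticLocalization

/-! ### The cubic relation, and points realizing its solutions. -/

section QuarticQuarticRelation

/-- The cubic equation satisfied by the invariant of degree four of two quartic forms. -/
def quarticCubic {R : Type*} [CommRing R] (u : Fin 7 → R) : Cubic R where
  a := 1
  b := -12 * u 0 * u 2 - 12 * u 1 ^ 2
  c := 192 * u 0 * u 1 ^ 2 * u 2 + 24 * u 0 * u 4 * u 6 - 24 * u 0 * u 5 ^ 2 -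
    24 * u 1 * u 3 * u 6 + 24 * u 1 * u 4 * u 5 + 24 * u 2 * u 3 * u 5 - 24 * u 2 * u 4 ^ 2
  d := 256 * u 0 ^ 3 * u 2 ^ 3 - 32 * u 0 ^ 3 * u 6 ^ 2 - 768 * u 0 ^ 2 * u 1 ^ 2 * u 2 ^ 2 +
    192 * u 0 ^ 2 * u 1 * u 5 * u 6 - 96 * u 0 ^ 2 * u 2 * u 5 ^ 2 -
    384 * u 0 * u 1 ^ 2 * u 4 * u 6 + 384 * u 0 * u 1 * u 2 * u 4 * u 5 -
    96 * u 0 * u 2 ^ 2 * u 4 ^ 2 + 256 * u 1 ^ 3 * u 3 * u 6 - 384 * u 1 ^ 2 * u 2 * u 3 * u 5 +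
    192 * u 1 * u 2 ^ 2 * u 3 * u 4 - 32 * u 2 ^ 3 * u 3 ^ 2 + 4 * u 3 ^ 2 * u 6 ^ 2 -
    24 * u 3 * u 4 * u 5 * u 6 + 16 * u 3 * u 5 ^ 3 + 16 * u 4 ^ 3 * u 6 - 12 * u 4 ^ 2 * u 5 ^ 2

theorem eval₂_toPoly {R S : Type*} [CommRing R] [CommRing S] (φ : R →+* S) (T : Cubic R) (z : S) :
    T.toPoly.eval₂ φ z = φ T.a * z ^ 3 + φ T.b * z ^ 2 + φ T.c * z + φ T.d := by
  simp [Cubic.toPoly]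

/-- The value of the cubic at a normal form, where `d` stands for the product `r * m * n`. -/
theorem quarticCubic_eval {R : Type*} [CommRing R] (a c s k r m n d z : R) (u : Fin 7 → R)
    (hz : z = (c ^ 2 - 12 * a ^ 2) * (-384 * (s ^ 2 - r ^ 2) + 48 * (n ^ 2 - m ^ 2)) +
      32 * c ^ 2 * k ^ 2 - 384 * a ^ 2 * k ^ 2 - 576 * a * c * (n ^ 2 + m ^ 2) +
      1536 * a * c * k * s)
    (h0 : u 0 = 2 * c ^ 2 + 24 * a ^ 2) (h1 : u 1 = 2 * c * k + 24 * a * s)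
    (h2 : u 2 = 24 * (s ^ 2 - r ^ 2) + 6 * (n ^ 2 - m ^ 2) + 2 * k ^ 2)
    (h3 : u 3 = - 8 * c ^ 3 + 288 * a ^ 2 * c)
    (h4 : u 4 = - 8 * c ^ 2 * k + 96 * a ^ 2 * k + 192 * a * c * s)
    (h5 : u 5 = 96 * c * (s ^ 2 - r ^ 2) - 12 * c * (n ^ 2 - m ^ 2) - 8 * c * k ^ 2 -
      72 * a * (n ^ 2 + m ^ 2) + 192 * a * k * s)
    (h6 : u 6 = - 216 * s * (n ^ 2 + m ^ 2) + 432 * d - 8 * k ^ 3 + 288 * k * (s ^ 2 - r ^ 2) -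
      36 * k * (n ^ 2 - m ^ 2)) :
    z ^ 3 + (quarticCubic u).b * z ^ 2 + (quarticCubic u).c * z + (quarticCubic u).d =
      -5159780352 * (a * (4 * a ^ 2 - c ^ 2)) ^ 2 * (d ^ 2 - (r * m * n) ^ 2) := by
  simp only [quarticCubic, h0, h1, h2, h3, h4, h5, h6, hz]
  ring

/-- The normal form is reconstructed: `c` from the resolvent cubic, `a` as a square root, then `s,
k`, then the squares of `r, m, n`. The last invariant prescribes `d`, and the cubic relation says
exactly that `d² = (r m n)²`. -/
theorem exists_quarticQuartic_eq {L : Type*} [Field L] [CharZero L] [IsAlgClosed L] (u : Fin 7 → L)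
    (z : L) (hu : 8 * u 0 ^ 3 - u 3 ^ 2 ≠ 0)
    (hz : z ^ 3 + (quarticCubic u).b * z ^ 2 + (quarticCubic u).c * z + (quarticCubic u).d = 0) :
    ∃ f g : Fin 5 → L, quarticQuartic f g = Fin.cons z u := by
  obtain ⟨c, hc⟩ : ∃ c : L, 32 * c ^ 3 - 12 * u 0 * c + u 3 = 0 := by
    let T : Cubic L := ⟨32, 0, -12 * u 0, u 3⟩
    have hT : T.toPoly.degree = 3 := Cubic.degree_of_a_ne_zero (by simp [T])
    obtain ⟨c, hc⟩ := IsAlgClosed.exists_root T.toPoly (by rw [hT]; decide)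
    refine ⟨c, ?_⟩
    rw [Polynomial.IsRoot, Polynomial.eval, eval₂_toPoly] at hc
    simp [T] at hc
    linear_combination hc
  obtain ⟨a, ha⟩ := IsAlgClosed.exists_pow_nat_eq ((u 0 - 2 * c ^ 2) / 24) two_pos
  have h0 : u 0 = 2 * c ^ 2 + 24 * a ^ 2 := by linear_combination -24 * ha
  have h3 : u 3 = - 8 * c ^ 3 + 288 * a ^ 2 * c := by
    linear_combination hc + 12 * c * h0
  have hD : 6912 * (a * (4 * a ^ 2 - c ^ 2)) ^ 2 ≠ 0 := by
    rw [h0, h3] at hu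
    convert hu using 1
    ring
  have hD' : a * (4 * a ^ 2 - c ^ 2) ≠ 0 := by
    intro h
    simp [h] at hD
  obtain ⟨ha0, hac⟩ := mul_ne_zero_iff.mp hD'
  obtain ⟨s, k, h1, h4⟩ : ∃ s k : L, u 1 = 2 * c * k + 24 * a * s ∧
      u 4 = - 8 * c ^ 2 * k + 96 * a ^ 2 * k + 192 * a * c * s := by
    obtain ⟨i, hi⟩ : ∃ i, a * (4 * a ^ 2 - c ^ 2) * i = 1 := ⟨_, mul_inv_cancel₀ hD'⟩
    refine ⟨((96 * a ^ 2 - 8 * c ^ 2) * u 1 - 2 * c * u 4) * i / 576,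
      (24 * a * u 4 - 192 * a * c * u 1) * i / 576, ?_, ?_⟩
    · linear_combination - u 1 * hi
    · linear_combination - u 4 * hi
  -- Here `R, V, W` are the future values of `s² - r²`, `n² + m²`, `n² - m²`, determined by a linear
  -- system that the nonzero discriminant makes solvable.
  obtain ⟨R, V, W, hzR, h2, h5⟩ : ∃ R V W : L,
      z = (c ^ 2 - 12 * a ^ 2) * (-384 * R + 48 * W) +
        32 * c ^ 2 * k ^ 2 - 384 * a ^ 2 * k ^ 2 - 576 * a * c * V + 1536 * a * c * k * s ∧
      u 2 = 24 * R + 6 * W + 2 * k ^ 2 ∧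
      u 5 = 96 * c * R - 12 * c * W - 8 * c * k ^ 2 - 72 * a * V + 192 * a * k * s := by
    obtain ⟨G, hG⟩ : ∃ G, G = u 2 - 2 * k ^ 2 := ⟨_, rfl⟩
    obtain ⟨H, hH⟩ : ∃ H, H = u 5 + 8 * c * k ^ 2 - 192 * a * k * s := ⟨_, rfl⟩
    obtain ⟨E, hE⟩ : ∃ E, 12 * (4 * a ^ 2 - c ^ 2) * E = z - 32 * c ^ 2 * k ^ 2 +
        384 * a ^ 2 * k ^ 2 - 1536 * a * c * k * s - 8 * c * H :=
      ⟨(z - 32 * c ^ 2 * k ^ 2 + 384 * a ^ 2 * k ^ 2 - 1536 * a * c * k * s - 8 * c * H) /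
        (12 * (4 * a ^ 2 - c ^ 2)), by field_simp⟩
    obtain ⟨V, hV⟩ : ∃ V, 72 * a * V = c * E - H := ⟨(c * E - H) / (72 * a), by field_simp⟩
    refine ⟨(2 * G + E) / 144, V, (G - (2 * G + E) / 6) / 6, ?_, ?_, ?_⟩
    · linear_combination - hE + 8 * c * hV
    · linear_combination - hG
    · linear_combination - hH + hV
  obtain ⟨n, hn⟩ := IsAlgClosed.exists_pow_nat_eq ((V + W) / 2) two_pos
  obtain ⟨m, hm⟩ := IsAlgClosed.exists_pow_nat_eq ((V - W) / 2) two_pos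
  obtain ⟨r, hr⟩ := IsAlgClosed.exists_pow_nat_eq (s ^ 2 - R) two_pos
  have hR : R = s ^ 2 - r ^ 2 := by rw [hr]; ring
  have hV : V = n ^ 2 + m ^ 2 := by rw [hn, hm]; ring
  have hW : W = n ^ 2 - m ^ 2 := by rw [hn, hm]; ring
  subst hR hV hW
  obtain ⟨d, h6⟩ : ∃ d, u 6 = - 216 * s * (n ^ 2 + m ^ 2) + 432 * d - 8 * k ^ 3 +
      288 * k * (s ^ 2 - r ^ 2) - 36 * k * (n ^ 2 - m ^ 2) :=
    ⟨(u 6 - (- 216 * s * (n ^ 2 + m ^ 2) - 8 * k ^ 3 +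
      288 * k * (s ^ 2 - r ^ 2) - 36 * k * (n ^ 2 - m ^ 2))) / 432, by ring⟩
  rw [quarticCubic_eval a c s k r m n d z u hzR h0 h1 h2 h3 h4 h5 h6] at hz
  have hd : d ^ 2 = (r * m * n) ^ 2 := by
    rw [← sub_eq_zero]
    exact (mul_eq_zero.mp hz).resolve_left
      (mul_ne_zero (by norm_num) (pow_ne_zero 2 hD'))
  -- Only `r²` has been used so far, so the sign of `r` is free to make `d = r m n`.
  obtain ⟨r', hr', hd'⟩ : ∃ r', r' ^ 2 = r ^ 2 ∧ d = r' * m * n := by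
    rcases sq_eq_sq_iff_eq_or_eq_neg.mp hd with h | h
    · exact ⟨r, rfl, h⟩
    · exact ⟨-r, by ring, by rw [h]; ring⟩
  subst hd'
  rw [← hr'] at hzR h2 h5 h6
  refine ⟨_, _, (quarticQuartic_slice ![a, c, s, k, r', m, n]).trans ?_⟩
  funext i
  refine Fin.cases ?_ (fun i => ?_) i
  · exact hzR.symm
  · fin_cases i
    exacts [h0.symm, h1.symm, h2.symm, h3.symm, h4.symm, h5.symm, h6.symm]

end QuarticQuarticRelation

/-- A common divisor involves no variable occurring in either polynomial with degree zero in the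
other, so disjoint sets of variables leave only constants. -/
theorem isRelPrime_of_degreeOf {σ K : Type*} [Field K] {p q : MvPolynomial σ K}
    (hp : p ≠ 0) (hq : q ≠ 0) (h : ∀ i, degreeOf i p = 0 ∨ degreeOf i q = 0) : IsRelPrime p q := by
  have key : ∀ {r s : MvPolynomial σ K} {i : σ}, s ≠ 0 → r ∣ s → degreeOf i s = 0 →
      degreeOf i r = 0 := by
    rintro r _ i hs ⟨t, rfl⟩ h0
    rw [degreeOf_mul_eq (left_ne_zero_of_mul hs) (right_ne_zero_of_mul hs)] at h0
    omega
  intro r hrp hrq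
  have hr : ∀ i, degreeOf i r = 0 := fun i => (h i).elim (key hp hrp) (key hq hrq)
  have hr0 : r.totalDegree = 0 := by
    rw [totalDegree_eq_zero_iff]
    intro m hm i
    exact Nat.le_zero.mp (degreeOf_le_iff.mp (hr i).le m hm)
  obtain ⟨c, hc⟩ : ∃ c, r = C c := ⟨_, totalDegree_eq_zero_iff_eq_C.mp hr0⟩
  rw [hc]
  refine (isUnit_iff_ne_zero.mpr ?_).map C
  rintro rfl
  rw [hc, map_zero, zero_dvd_iff] at hrp
  exact hp hrp

theorem isRelPrime_quarticDisc {K : Type*} [Field K] [CharZero K] :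
    IsRelPrime (8 * X 0 ^ 3 - X 3 ^ 2 : MvPolynomial (Fin 7) K) (8 * X 2 ^ 3 - X 6 ^ 2) := by
  have key : ∀ i j k : Fin 7, i ≠ j → i ≠ k →
      degreeOf i (8 * X j ^ 3 - X k ^ 2 : MvPolynomial (Fin 7) K) = 0 := by
    intro i j k hj hk
    have h1 : degreeOf i (8 * X j ^ 3 : MvPolynomial (Fin 7) K) ≤ 0 := by
      refine (degreeOf_C_mul_le (X j ^ 3) i (8 : K)).trans ((degreeOf_pow_le _ _ _).trans ?_)
      rw [degreeOf_X_of_ne hj]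
    have h2 : degreeOf i (X k ^ 2 : MvPolynomial (Fin 7) K) ≤ 0 := by
      refine (degreeOf_pow_le _ _ _).trans ?_
      rw [degreeOf_X_of_ne hk]
    exact Nat.le_zero.mp ((degreeOf_sub_le _ _ _).trans (max_le h1 h2))
  have hne : ∀ j k : Fin 7, j ≠ k → (8 * X j ^ 3 - X k ^ 2 : MvPolynomial (Fin 7) K) ≠ 0 := by
    intro j k hjk h
    have := congrArg (aeval (Function.update (0 : Fin 7 → K) j 1)) h
    simp [map_ofNat, Function.update_of_ne hjk.symm] at this
  refine isRelPrime_of_degreeOf (hne 0 3 (by decide)) (hne 2 6 (by decide)) fun i => ?_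
  by_cases h : i = 2 ∨ i = 6
  · left
    rcases h with rfl | rfl <;> exact key _ _ _ (by decide) (by decide)
  · right
    push Not at h
    exact key _ _ _ h.1 h.2

/-- The invariants of pairs of quartic forms with the two forms exchanged. -/
theorem exists_swap {K : Type u} [Field K] [CharZero K] {p : CoordRing K ![4, 4]}
    (hp : p ∈ invariants K ![4, 4]) : ∃ q ∈ invariants K ![4, 4],
      ∀ {R : Type u} [CommRing R] [Algebra K R] (f g : Fin 5 → R),
        evalAt (point₂ f g : CoordPoint R ![4, 4]) q =
          evalAt (point₂ g f : CoordPoint R ![4, 4]) p := by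
  let q : CoordRing K ![4, 4] := evalAt (point₂ (fun j => X ⟨1, j⟩) (fun j => X ⟨0, j⟩)) p
  have hq : ∀ {R : Type u} [CommRing R] [Algebra K R] (f g : Fin 5 → R),
        evalAt (point₂ f g : CoordPoint R ![4, 4]) q =
          evalAt (point₂ g f : CoordPoint R ![4, 4]) p := by
    intro R _ _ f g
    simp only [q]
    rw [map_evalAt]
    congr 2
    funext i
    refine Fin.cases ?_ (fun i => Fin.cases ?_ (fun i => i.elim0) i) i
    · funext j
      exact evalAt_X _ _
    · funext j
      exact evalAt_X _ _
  have hmove : ∀ {τ : (e : ℕ) → (Fin (e + 1) → K) → Fin (e + 1) → K}, IsMove K τ →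
      ∀ f g, evalAt (point₂ (τ 4 f) (τ 4 g) : CoordPoint K ![4, 4]) q =
        evalAt (point₂ f g : CoordPoint K ![4, 4]) q := by
    intro τ hτ f g
    rw [hq, hq]
    exact (hτ.pair g f p hp).symm
  have hpt : ∀ (τ : (e : ℕ) → (Fin (e + 1) → K) → Fin (e + 1) → K) (f g : Fin 5 → K),
      (fun i => τ (![4, 4] i) ((point₂ f g : CoordPoint K ![4, 4]) i)) =
        point₂ (τ 4 f) (τ 4 g) := by
    intro τ f g
    funext i
    refine Fin.cases rfl (fun i => Fin.cases rfl (fun i => i.elim0) i) i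
  refine ⟨q, (mem_invariants_iff q).mpr ⟨fun t x => ?_, fun x => ?_⟩, hq⟩
  · obtain ⟨f, g, rfl⟩ := exists_eq_point₂ x
    rw [hpt fun e => shear e t]
    exact hmove (isMove_shear t) f g
  · obtain ⟨f, g, rfl⟩ := exists_eq_point₂ x
    rw [hpt flip]
    exact hmove isMove_flip f g

/-! ### Generation and relations for two quartics. -/

section QuarticQuarticMain

variable (K L : Type u) [Field K] [CharZero K] [Field L] [CharZero L] [IsAlgClosed L] [Algebra K L]

/-- For general `u` the cubic has three distinct roots, too many for a nonzero polynomial of degree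
below three. -/
theorem eq_zero_of_forall_quarticCubic {P : Polynomial (MvPolynomial (Fin 7) K)}
    (hP : P.degree < 3) (H : ∀ (u : Fin 7 → L) (z : L), 8 * u 0 ^ 3 - u 3 ^ 2 ≠ 0 →
      z ^ 3 + (quarticCubic u).b * z ^ 2 + (quarticCubic u).c * z + (quarticCubic u).d = 0 →
      P.eval₂ (aeval u : MvPolynomial (Fin 7) K →ₐ[K] L).toRingHom z = 0) : P = 0 := by
  classical
  have hT : ∀ u : Fin 7 → L, aeval u (quarticCubic (X : Fin 7 → MvPolynomial (Fin 7) K)).discr =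
      (quarticCubic u).discr := by
    intro u
    simp [Cubic.discr, quarticCubic, map_ofNat]
  let h : MvPolynomial (Fin 7) K := (8 * X 0 ^ 3 - X 3 ^ 2) * (quarticCubic X).discr
  have hh : h ≠ 0 := by
    -- At the sample point used below the cubic is `z³ + 24 z - 16`, which has nonzero discriminant.
    intro h0
    have h1 := congrArg (aeval (![1, 0, 0, 0, 1, 0, 1] : Fin 7 → L)) h0
    simp only [h, map_mul, hT] at h1
    simp [Cubic.discr, quarticCubic, map_ofNat] at h1
    norm_num at h1
  ext1 i
  rw [Polynomial.coeff_zero]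
  refine eq_zero_of_forall_aeval_of_ne (L := L) hh fun u hu => ?_
  rw [map_mul, hT] at hu
  obtain ⟨hu1, hu2⟩ := mul_ne_zero_iff.mp hu
  simp [map_ofNat] at hu1
  have h1 : (quarticCubic u).a ≠ 0 := one_ne_zero
  have h2 := Cubic.card_roots_of_discr_ne_zero (φ := RingHom.id L) h1
    (IsAlgClosed.splits _) hu2
  have h3 : P.map (aeval u : MvPolynomial (Fin 7) K →ₐ[K] L).toRingHom = 0 := by
    refine Polynomial.eq_zero_of_degree_lt_of_eval_finset_eq_zero
      ((quarticCubic u).map (RingHom.id L)).roots.toFinset ?_ fun z hz => ?_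
    · rw [h2]
      exact Polynomial.degree_map_le.trans_lt hP
    · rw [Polynomial.eval_map]
      refine H u z hu1 ?_
      rw [Multiset.mem_toFinset, Cubic.roots] at hz
      have h4 := Polynomial.isRoot_of_mem_roots hz
      rw [Polynomial.IsRoot, Polynomial.eval, eval₂_toPoly] at h4
      simpa [Cubic.map, quarticCubic] using h4
  have h4 := congrArg (fun p => Polynomial.coeff p i) h3
  simpa using h4

/-- The relation is cubic, so the quadratic criterion does not apply. Denominators are removed by
comparing two expressions of an invariant, with powers of the coprime discriminants of the two forms
as denominators. -/
theorem isHypersurfaceOfDegree_quarticQuartic_of_isAlgClosed (K L : Type u) [Field K] [CharZero K]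
    [Field L] [CharZero L] [IsAlgClosed L] [Algebra K L] :
    IsHypersurfaceOfDegree K ![4, 4] 12 := by
  have hΦ := isInvariantFamily_quarticQuartic.{u}
  have hS := isSlice_quarticQuartic K (L := L)
  set f := hΦ.toInvariants K with hfdef
  have hfΦ : ∀ (x : CoordPoint L ![4, 4]) i, evalAt x (f i : CoordRing K ![4, 4]) =
      quarticQuartic (x 0) (x 1) i := fun x i => hΦ.evalAt_toInvariants K x i
  have hpres : ∀ p (x : CoordPoint L ![4, 4]),
      evalAt x (presentation f p : CoordRing K ![4, 4]) = aeval (quarticQuartic (x 0) (x 1)) p := by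
    intro p x
    rw [← Subalgebra.coe_val, ← AlgHom.comp_apply, ← AlgHom.comp_apply, presentation, comp_aeval]
    congr 2
    funext i
    exact hfΦ x i
  let ι := finSuccEquiv K 7
  let T : Cubic (MvPolynomial (Fin 7) K) := quarticCubic X
  obtain ⟨F, hιF⟩ : ∃ F, ι F = T.toPoly := ι.surjective _
  have hFm : (ι F).Monic := by rw [hιF]; exact Cubic.monic_of_a_eq_one rfl
  have hFdeg : (ι F).degree = 3 := by
    rw [hιF]; exact Cubic.degree_of_a_ne_zero one_ne_zero
  have hFeval : ∀ x : Fin 8 → L, aeval x F = x 0 ^ 3 + (quarticCubic fun i => x i.succ).b * x 0 ^ 2 +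
      (quarticCubic fun i => x i.succ).c * x 0 + (quarticCubic fun i => x i.succ).d := by
    intro x
    rw [aeval_eq_eval₂_finSuccEquiv]
    change (ι F).eval₂ _ _ = _
    rw [hιF, eval₂_toPoly]
    simp [T, quarticCubic, map_ofNat]
  have hF0 : presentation f F = 0 := by
    apply Subtype.ext
    refine hS.eq (presentation f F).2 (zero_mem _) ?_
    rintro _ ⟨a, c, g, rfl⟩
    rw [hpres, hFeval]
    have hg : g = ![(g 0 + g 4) / 2 + (g 0 - g 4) / 2, (g 1 + g 3) / 2 + (g 1 - g 3) / 2, g 2,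
        (g 1 + g 3) / 2 - (g 1 - g 3) / 2, (g 0 + g 4) / 2 - (g 0 - g 4) / 2] := by
      ext j
      fin_cases j <;> simp <;> ring
    have hs := (congrArg (quarticQuartic ![a, 0, c, 0, a]) hg).trans
      (quarticQuartic_slice ![a, c, (g 0 + g 4) / 2, g 2, (g 0 - g 4) / 2,
        (g 1 + g 3) / 2, (g 1 - g 3) / 2])
    refine (quarticCubic_eval a c _ _ _ _ _ ((g 0 - g 4) / 2 * ((g 1 + g 3) / 2) *
      ((g 1 - g 3) / 2)) _ _ (congrFun hs 0) (congrFun hs 1) (congrFun hs 2) (congrFun hs 3)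
      (congrFun hs 4) (congrFun hs 5) (congrFun hs 6) (congrFun hs 7)).trans ?_
    simp
  let ev : Polynomial (MvPolynomial (Fin 7) K) →+* CoordRing K ![4, 4] :=
    ((invariants K ![4, 4]).val.comp ((presentation f).comp (ι.symm : _ →ₐ[K] _))).toRingHom
  have hev : ∀ p, ev (ι p) = (presentation f p : CoordRing K ![4, 4]) := fun p => by simp [ev]
  have hevmem : ∀ P, ev P ∈ invariants K ![4, 4] := fun P => by
    obtain ⟨p, rfl⟩ := ι.surjective P
    rw [hev]
    exact Subtype.property _
  have hevx : ∀ P (x : CoordPoint L ![4, 4]), evalAt x (ev P) =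
      P.eval₂ (aeval fun i : Fin 7 => quarticQuartic (x 0) (x 1) i.succ :
        MvPolynomial (Fin 7) K →ₐ[K] L).toRingHom (quarticQuartic (x 0) (x 1) 0) := by
    intro P x
    obtain ⟨p, rfl⟩ := ι.surjective P
    rw [hev, hpres, aeval_eq_eval₂_finSuccEquiv]
  -- Every solution of the cubic with nonzero discriminant of the first form comes from a pair of
  -- quartics, so a relation of degree below three vanishes at all of them.
  have hzero : ∀ P, P.degree < 3 → ev P = 0 → P = 0 := by
    intro P hP hP0
    refine eq_zero_of_forall_quarticCubic K L hP fun u z hu hz => ?_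
    obtain ⟨a, b, hab⟩ := exists_quarticQuartic_eq u z hu hz
    have h1 := hevx P (point₂ a b)
    rw [hP0, map_zero] at h1
    change 0 = P.eval₂ (aeval fun i : Fin 7 => quarticQuartic a b i.succ :
      MvPolynomial (Fin 7) K →ₐ[K] L).toRingHom (quarticQuartic a b 0) at h1
    rw [hab] at h1
    exact h1.symm
  let Δ : MvPolynomial (Fin 7) K := 8 * X 0 ^ 3 - X 3 ^ 2
  let Δ' : MvPolynomial (Fin 7) K := 8 * X 2 ^ 3 - X 6 ^ 2
  have hΔ : ∀ x : CoordPoint L ![4, 4], evalAt x (ev (Polynomial.C Δ)) =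
      aeval (quarticQuartic (x 0) (x 1)) (8 * X 1 ^ 3 - X 4 ^ 2 : MvPolynomial (Fin 8) K) := by
    intro x
    rw [hevx, Polynomial.eval₂_C]
    simp [Δ, map_ofNat]
  have hΔ' : ∀ a b : Fin 5 → L, evalAt (point₂ a b) (ev (Polynomial.C Δ')) =
      evalAt (point₂ b a : CoordPoint L ![4, 4]) (ev (Polynomial.C Δ)) := by
    intro a b
    rw [hevx, hevx, Polynomial.eval₂_C, Polynomial.eval₂_C]
    simp [Δ, Δ', map_ofNat]
    rfl
  have hrel : IsRelPrime Δ Δ' := isRelPrime_quarticDisc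
  have hΔ0 : ev (Polynomial.C Δ) ≠ 0 := by
    intro h0
    have h1 := hzero _ (Polynomial.degree_C_le.trans_lt (by decide)) h0
    rw [Polynomial.C_eq_zero] at h1
    have h2 := congrArg (aeval (![1, 0, 0, 0, 0, 0, 0] : Fin 7 → L)) h1
    simp [Δ, map_ofNat] at h2
  have hloc : ∀ p ∈ invariants K ![4, 4], ∃ N Q, ev (Polynomial.C Δ) ^ N * p = ev Q := by
    intro p hp
    obtain ⟨N, Q, hQ⟩ := exists_of_mem_invariants_quarticQuartic (L := L) K hp
    refine ⟨N, ι Q, hS.eq (mul_mem (pow_mem (hevmem _) N) hp) (hevmem _) fun y hy => ?_⟩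
    rw [map_mul, map_pow, hΔ, hQ y hy, hev, hpres]
  have hdeg : ∀ (a : MvPolynomial (Fin 7) K) (P : Polynomial (MvPolynomial (Fin 7) K)),
      (Polynomial.C a * P).degree ≤ P.degree := fun a P =>
    (Polynomial.degree_mul_le _ _).trans (add_le_of_nonpos_left Polynomial.degree_C_le)
  have hmod : ∀ P, ∃ P', P'.degree < 3 ∧ ev P' = ev P := fun P =>
    ⟨P %ₘ ι F, hFdeg ▸ Polynomial.degree_modByMonic_lt P hFm, by
      conv_rhs => rw [← Polynomial.modByMonic_add_div P (ι F), map_add, map_mul, hev F, hF0]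
      simp⟩
  refine isHypersurfaceOfDegree_of_monic f _ (fun i => hΦ.isHomogeneous K i) F hFm hF0 ?_
    (by norm_num) (fun i => by fin_cases i <;> simp) ?_ fun p hp hp0 => ?_
  · refine isWeightedHomogeneous_of_scaling (L := L) _ 12 F fun x => ?_
    rw [hFeval, hFeval]
    simp [quarticCubic, Fin.succ]
    ring
  · rintro ⟨p, hp⟩
    obtain ⟨N, Q, hQ⟩ := hloc p hp
    obtain ⟨q, hq, hpq⟩ := exists_swap hp
    obtain ⟨N', Q', hQ'⟩ := hloc q hq
    obtain ⟨s, rfl⟩ := ι.surjective Q'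
    -- Exchanging the two forms permutes the generators by this involution and turns `Δ` into `Δ'`.
    have hQ'' : ev (Polynomial.C Δ') ^ N' * p =
        ev (ι (rename ![0, 3, 2, 1, 7, 6, 5, 4] s)) := by
      refine hS.eq (mul_mem (pow_mem (hevmem _) N') hp) (hevmem _) ?_
      rintro y -
      obtain ⟨a, b, rfl⟩ := exists_eq_point₂ y
      have h1 := congrArg (evalAt (point₂ b a : CoordPoint L ![4, 4])) hQ'
      rw [map_mul, map_pow, ← hΔ', hpq, hev, hpres] at h1
      rw [map_mul, map_pow, h1, hev, hpres, aeval_rename]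
      congr 2
      funext i
      change quarticQuartic b a i = quarticQuartic a b (![0, 3, 2, 1, 7, 6, 5, 4] i)
      fin_cases i <;> simp [quarticQuartic, polarQuartic] <;> ring
    obtain ⟨P, hP3, hP⟩ := hmod Q
    obtain ⟨P', hP3', hP'⟩ := hmod (ι (rename ![0, 3, 2, 1, 7, 6, 5, 4] s))
    -- Both products have the image `Δ ^ N * Δ' ^ N' * p` and degree below three in `z`, where the
    -- evaluation is injective. Coprimality then makes `Δ ^ N` divide `P`.
    have h1 : Polynomial.C (Δ' ^ N') * P - Polynomial.C (Δ ^ N) * P' = 0 := by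
      refine hzero _ ?_ ?_
      · refine (Polynomial.degree_sub_le _ _).trans_lt (max_lt ?_ ?_)
        · exact (hdeg _ _).trans_lt hP3
        · exact (hdeg _ _).trans_lt hP3'
      · rw [map_sub, map_mul, map_mul, hP, hP', ← hQ, ← hQ'', Polynomial.C_pow, Polynomial.C_pow,
          map_pow, map_pow]
        ring
    have h2 : Polynomial.C (Δ ^ N) ∣ P := by
      rw [Polynomial.C_dvd_iff_dvd_coeff]
      intro i
      refine (hrel.pow (m := N) (n := N')).dvd_of_dvd_mul_left ⟨P'.coeff i, ?_⟩
      rw [← Polynomial.coeff_C_mul, ← Polynomial.coeff_C_mul, sub_eq_zero.mp h1]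
    obtain ⟨P₀, rfl⟩ := h2
    obtain ⟨p₀, rfl⟩ := ι.surjective P₀
    refine ⟨p₀, Subtype.ext (mul_left_cancel₀ (pow_ne_zero N hΔ0) ?_)⟩
    rw [hQ, ← hP, map_mul, Polynomial.C_pow, map_pow, hev]
  · apply ι.injective
    rw [map_zero]
    exact hzero _ (hFdeg ▸ hp) (by rw [hev, hp0]; rfl)

theorem isHypersurfaceOfDegree_quarticQuartic (K : Type u) [Field K] [CharZero K] :
    IsHypersurfaceOfDegree K ![4, 4] 12 :=
  isHypersurfaceOfDegree_quarticQuartic_of_isAlgClosed K (AlgebraicClosure K)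

end QuarticQuarticMain

end SL2Invariants

end

theorem mainTheorem9 (K : Type*) [Field K] [CharZero K] :
    SL2Invariants.IsHypersurfaceOfDegree K ![1, 3] 12 ∧
    SL2Invariants.IsHypersurfaceOfDegree K ![1, 4] 18 ∧
    SL2Invariants.IsHypersurfaceOfDegree K ![2, 3] 14 ∧
    SL2Invariants.IsHypersurfaceOfDegree K ![2, 4] 12 ∧
    SL2Invariants.IsHypersurfaceOfDegree K ![4, 4] 12 ∧
    SL2Invariants.IsHypersurfaceOfDegree K ![1, 1, 2] 6 ∧
    SL2Invariants.IsHypersurfaceOfDegree K ![1, 2, 2] 8 ∧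
    SL2Invariants.IsHypersurfaceOfDegree K ![2, 2, 2] 6 ∧
    SL2Invariants.IsHypersurfaceOfDegree K ![1, 1, 1, 1] 4 :=
  ⟨SL2Invariants.isHypersurfaceOfDegree_linearCubic K,
    SL2Invariants.isHypersurfaceOfDegree_linearQuartic K,
    SL2Invariants.isHypersurfaceOfDegree_quadraticCubic K,
    SL2Invariants.isHypersurfaceOfDegree_quadraticQuartic K,
    SL2Invariants.isHypersurfaceOfDegree_quarticQuartic K,
    SL2Invariants.isHypersurfaceOfDegree_linearLinearQuadratic K,
    SL2Invariants.isHypersurfaceOfDegree_linearQuadraticQuadratic K,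
    SL2Invariants.isHypersurfaceOfDegree_threeQuadratic K,
    SL2Invariants.isHypersurfaceOfDegree_fourLinear K⟩
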